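/- **Setting.** Let $p\ge 2$, $1\le d\le p$, $\beta\ge 1$, $\gamma\in[1,\beta+1]$, $K>1$, $\eta\in(0,\beta+1]$. Functions on $\mathbb T^d=\mathbb R^d/\mathbb Z^d$ are identified with $\mathbb Z^d$-periodic functions. For $s>0$ put $$\|f\|_{\mathcal H^s}=\sum_{|\nu|\le\lfloor s\rfloor}\|\partial^\nu f\|_\infty+\sum_{|\nu|=\lfloor s\rfloor}\sup_{x\ne y}\frac{|\partial^\nu f(x)-\partial^\nu f(y)|}{\min\{1,\|x-y\|^{s-\lfloor s\rfloor}\}}\qquad(f\in C^{\lfloor s\rfloor}),$$ let $\mathcal H^s_R$ be the ball of radius $R$ (for maps into $\mathbb R^p$, every component has norm at most $R$), and $\mathcal H^\eta_K=\mathcal H^\eta_K(\mathbb T^d,\mathbb R^p)$. For probability measures on $\mathbb R^p$ let $d_{\mathcal H^\gamma_1}(\mu,\nu)=\sup\{\int D\,d\mu-\int D\,d\nu: D\in\mathcal H^\gamma_1(\mathbb R^p,\mathbb R)\}$, and let $U$ be uniform on the unit cube of $\mathbb R^d$. **Wavelets.** Let $\phi\in\mathcal H^{\lfloor\beta\rfloor+3}(\mathbb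 R)$ be a Daubechies scaling function of order $M\ge1$, i.e. $\phi$ is supported in $[0,N]$, $N=2M-1$, $\int\phi=1$, its integer translates are orthonormal, $\phi=\sum_{k=0}^{N}h_k\phi(2\cdot-k)$ with $h_k=2\int\phi(y)\phi(2y-k)\,dy$, and the wavelet $\psi=\sum_{k=-N+1}^{1}\lambda_k\phi(2\cdot-k)$, $\lambda_k=(-1)^{k+1}h_{1-k}$, has $M$ vanishing moments. Let $\phi^{per}_j(s)=2^{j/2}\sum_{k\in\mathbb Z}\phi(2^j(s-k))$, likewise $\psi_j^{per}$, and for $j\ge 0$, $1\le l<2^d$, $z\in\{0,\dots,2^j-1\}^d$ let $\psi^{per}_{jlz}(u)=\prod_{i=1}^d\psi^{per}_{jl_i}(u_i-2^{-j}z_i)$, where $l_1,\dots,l_d$ are the binary digits of $l$, $\psi^{per}_{j0}=\phi^{per}_j$ and $\psi^{per}_{j1}=\psi^{per}_j$; for $l=2^d$ put $\psi^{per}_{jlz}=1$ if $j=0$, $z=0$, and $0$ otherwise. Let $\|f\|_{\mathcal B^\eta_{\infty,\infty}}=\sup_{j\ge0}2^{j(\eta+d/2)}\sum_{l=1}^{2^d}\sup_z|\langle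 f,\psi^{per}_{jlz}\rangle_{L^2(\mathbb T^d)}|$. A constant $C_\eta>0$ is called admissible if $\|f\|_{\mathcal B^\eta_{\infty,\infty}}\le C_\eta\|f\|_{\mathcal H^\eta}$ for all $f\in\mathcal H^\eta(\mathbb T^d,\mathbb R)$. **The class.** Given $\hat\phi:\mathbb R\to\mathbb R$, put $\hat\psi=\sum_{k=-N+1}^{1}\lambda_k\hat\phi(2\cdot-k)$, $$\hat\phi^{per}_j(s)=2^{j/2}\sum_{k=\lceil-1-2^{-j}N\rceil}^{0}\hat\phi(2^j(s-k)),\qquad \hat\psi^{per}_j(s)=2^{j/2}\sum_{k=\lceil-1-2^{-(j+1)}(N+1)\rceil}^{\lfloor1+2^{-(j+1)}(N-1)\rfloor}\hat\psi(2^j(s-k)),$$ and define $\hat\psi^{per}_{jlz}$ on $[0,1)^d$ from these by the same product formula and the same convention for $l=2^d$. For $\delta\in(0,1)$ let $\hat{\mathcal F}^{\eta,\delta}_{per}$ be the set of all $f:\mathbb T^d\to\mathbb R^p$ whose components are, on $[0,1)^d$, $$f_i=\sum_{j=0}^{\lfloor\log_2\delta^{-1}\rfloor}\sum_{l=1}^{2^d}\sum_{z\in\{0,\dots,2^j-1\}^d}\hat\alpha(j,l,z)_i\,\hat\psi^{per}_{jlz},\qquad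 |\hat\alpha(j,l,z)_i|\le C_\eta K2^{-j(\eta+d/2)}.$$ Write $|\mathcal F_\epsilon|$ for the least cardinality of a set $A$ of functions such that every $f\in\mathcal F$ is within $\epsilon$ of an element of $A$ in the uniform norm (the supremum over the domain of the Euclidean norm of the values in $\mathbb R^p$). **Proposition.** Admissible constants exist. Let $C_\eta$ be any admissible constant, $C_0>0$, and $r\in(0,1)$. Then there are $C,C_2>0$, depending only on these data, on $p,d,\beta,\gamma,K,\eta$ and on $\phi$, such that for all $\delta\in(0,r]$, all $L\ge\delta^{-(\lfloor\beta\rfloor+1+\gamma)}$ and all $\hat\phi:\mathbb R\to\mathbb R$ with $\|\phi-\hat\phi\|_{\mathcal H^{\lfloor\beta\rfloor+2}}\le C_0L^{-1}$ the following hold. 1. If $\gamma\le\eta+1$, and $\eta\ge1$ or $\gamma=1$, then $$\sup_{f^\star\in\mathcal H^\eta_K}\ \inf_{f\in\hat{\mathcal F}^{\eta,\delta}_{per}}d_{\mathcal H^\gamma_1}(f_{\#U},f^\star_{\#U})\le C\log(\delta^{-1})^{C_2}\,\delta^{\eta+\gamma-1}.$$ 2. If $\delta\le1/2$, then for all $\epsilon\in(\delta^{\eta-1}L^{-1},r]$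 the covering number $|(\hat{\mathcal F}^{\eta,\delta}_{per})_\epsilon|$ is finite and $$\log|(\hat{\mathcal F}^{\eta,\delta}_{per})_\epsilon|\le C\delta^{-d}\log(\lfloor\delta^{-1}\rfloor)\log(\epsilon^{-1}).$$ -/

import Mathlib

open MeasureTheory
open scoped ENNReal

noncomputable section

namespace HatPer

/-- `ℝ^n` with its Euclidean norm. -/
abbrev E (n : ℕ) : Type := EuclideanSpace ℝ (Fin n)

/-! ### The torus

A function on `𝕋^d = ℝ^d / ℤ^d` is represented by a `ℤ^d`-periodic function on `ℝ^d`. -/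

/-- `f` is `ℤ^d`-periodic, i.e. a function on the torus `𝕋^d`. -/
def IsPeriodic {d : ℕ} {Y : Type*} (f : E d → Y) : Prop :=
  ∀ (u : E d) (i : Fin d), f (u + EuclideanSpace.single i 1) = f u

/-- The fundamental domain `[0,1)^d` of the torus. -/
def unitCube (d : ℕ) : Set (E d) := {u | ∀ i, u i ∈ Set.Ico (0 : ℝ) 1}

/-- The law of `U`, the uniform distribution on the `d`-dimensional unit cube. -/
def uniformCube (d : ℕ) : Measure (E d) := (volume : Measure (E d)).restrict (unitCube d)

/-! ### Hölder spaces -/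

/-- `sup_{x ≠ y} |f x - f y| / min {1, ‖x - y‖ ^ α}`. For a periodic `f` this is also the supremum
for the distance of the torus, since the latter is the least distance between lifts. -/
def holderSemi {X : Type*} [NormedAddCommGroup X] (α : ℝ) (f : X → ℝ) : ℝ≥0∞ :=
  ⨆ (x : X) (y : X) (_ : x ≠ y), ENNReal.ofReal (|f x - f y| / min 1 (‖x - y‖ ^ α))

/-- The partial derivative `∂f/∂x_i`. -/
def partialD {d : ℕ} (i : Fin d) (f : E d → ℝ) : E d → ℝ :=
  fun x => fderiv ℝ f x (EuclideanSpace.single i 1)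

/-- The partial derivative `∂^ν f` for a multi-index `ν`. -/
def multiD {d : ℕ} (ν : Fin d → ℕ) (f : E d → ℝ) : E d → ℝ :=
  (List.finRange d).foldr (fun i g => (partialD i)^[ν i] g) f

/-- The Hölder norm
`∑_{|ν| ≤ ⌊s⌋} ‖∂^ν f‖_∞ + ∑_{|ν| = ⌊s⌋} ‖∂^ν f‖_{s - ⌊s⌋}` (for `f` of class `C^⌊s⌋`). -/
def holderNorm {d : ℕ} (s : ℝ) (f : E d → ℝ) : ℝ≥0∞ :=
  (∑ n ∈ Finset.range (⌊s⌋₊ + 1),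
      ∑ ν ∈ Finset.piAntidiag (Finset.univ : Finset (Fin d)) n, ⨆ x, ‖multiD ν f x‖ₑ)
    + ∑ ν ∈ Finset.piAntidiag (Finset.univ : Finset (Fin d)) ⌊s⌋₊,
        holderSemi (s - ⌊s⌋₊) (multiD ν f)

/-- The Hölder ball `𝓗^s_R(ℝ^d, ℝ)`. -/
def holderBall (d : ℕ) (s R : ℝ) : Set (E d → ℝ) :=
  {f | ContDiff ℝ ⌊s⌋₊ f ∧ holderNorm s f ≤ ENNReal.ofReal R}

/-- The Hölder ball `𝓗^s_R(𝕋^d, ℝ^p)`: every component has Hölder norm at most `R`. -/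
def holderBallTorus (d p : ℕ) (s R : ℝ) : Set (E d → E p) :=
  {f | IsPeriodic f ∧ ∀ i : Fin p, (fun u => f u i) ∈ holderBall d s R}

/-- The Hölder norm of a function of one real variable. -/
def holderNormLine (s : ℝ) (f : ℝ → ℝ) : ℝ≥0∞ :=
  (∑ n ∈ Finset.range (⌊s⌋₊ + 1), ⨆ x, ‖iteratedDeriv n f x‖ₑ)
    + holderSemi (s - ⌊s⌋₊) (iteratedDeriv ⌊s⌋₊ f)

/-- The Hölder ball `𝓗^s_R(ℝ, ℝ)`. -/
def holderBallLine (s R : ℝ) : Set (ℝ → ℝ) :=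
  {f | ContDiff ℝ ⌊s⌋₊ f ∧ holderNormLine s f ≤ ENNReal.ofReal R}

/-- The Hölder space `𝓗^s(ℝ, ℝ)`. -/
def holderSpaceLine (s : ℝ) : Set (ℝ → ℝ) :=
  {f | ContDiff ℝ ⌊s⌋₊ f ∧ holderNormLine s f ≠ ⊤}

/-! ### The integral probability metric -/

/-- `d_{𝓗^γ_1}(μ, ν) = sup_{D ∈ 𝓗^γ_1(ℝ^p, ℝ)} ∫ D dμ - ∫ D dν`; the supremum is nonnegative
because `D = 0` is admissible. -/
def ipm {p : ℕ} (γ : ℝ) (μ ν : Measure (E p)) : ℝ≥0∞ :=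
  ⨆ D ∈ holderBall p γ 1, ENNReal.ofReal ((∫ x, D x ∂μ) - ∫ x, D x ∂ν)

/-! ### Daubechies wavelets -/

/-- The filter `h_k = 2 ∫ φ(y) φ(2y - k) dy` of a scaling function `φ`. -/
def filt (φ : ℝ → ℝ) (k : ℤ) : ℝ := 2 * ∫ y, φ y * φ (2 * y - k)

/-- `∑_{k = -N+1}^{1} λ_k g(2x - k)` with `λ_k = (-1)^{k+1} h_{1-k}`, where `h` is the filter
of `φ`. For `g = φ` this is the wavelet `ψ`; for `g = φ̂` it is the approximate wavelet `ψ̂`. -/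
def waveletOf (N : ℕ) (φ g : ℝ → ℝ) (x : ℝ) : ℝ :=
  ∑ k ∈ Finset.Icc (1 - (N : ℤ)) 1, (-1 : ℝ) ^ (k + 1) * filt φ (1 - k) * g (2 * x - k)

/-- `φ` is a Daubechies scaling function of order `M`: an orthonormal scaling function supported in
`[0, 2M - 1]`, with two-scale relation of length `2M`, whose wavelet has `M` vanishing moments. -/
structure IsDaubechies (M : ℕ) (φ : ℝ → ℝ) : Prop where
  one_le : 1 ≤ M
  support_subset : Function.support φ ⊆ Set.Icc 0 (2 * (M : ℝ) - 1)
  integral_eq_one : ∫ x, φ x = 1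
  orthonormal : ∀ k : ℤ, ∫ x, φ x * φ (x - k) = if k = 0 then 1 else 0
  two_scale : ∀ x, φ x = ∑ k ∈ Finset.range (2 * M), filt φ k * φ (2 * x - k)
  vanishing : ∀ m < M, ∫ x, x ^ m * waveletOf (2 * M - 1) φ φ x = 0

/-- The periodisation `2^{j/2} ∑_{k ∈ ℤ} g(2^j (s - k))`. -/
def periodise (g : ℝ → ℝ) (j : ℕ) (s : ℝ) : ℝ :=
  (2 : ℝ) ^ ((j : ℝ) / 2) * ∑' k : ℤ, g (2 ^ j * (s - k))

/-- The `d`-dimensional function with index `(j, l, z)`, `l ∈ {1, …, 2^d}`, built from the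
one-dimensional `a j` (scaling, binary digit `0`) and `b j` (wavelet, binary digit `1`):
`∏_i (a or b)_j (u_i - 2^{-j} z_i)` according to the binary digits of `l` if `l < 2^d`;
for `l = 2^d` it is `1` if `j = 0` and `z = 0`, and `0` otherwise. -/
def tensorWavelet {d : ℕ} (a b : ℕ → ℝ → ℝ) (j l : ℕ) (z : Fin d → ℕ) (u : E d) : ℝ :=
  if l = 2 ^ d then (if j = 0 ∧ z = 0 then 1 else 0)
  else ∏ i : Fin d, (if l.testBit i then b j else a j) (u i - (z i : ℝ) / 2 ^ j)

/-- The positions `{0, …, 2^j - 1}^d`. -/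
def positions (d j : ℕ) : Finset (Fin d → ℕ) :=
  Fintype.piFinset fun _ => Finset.range (2 ^ j)

/-- The periodised Daubechies wavelet `ψ^per_{jlz}` on `𝕋^d` (with support length `N`). -/
def perWavelet {d : ℕ} (N : ℕ) (φ : ℝ → ℝ) : ℕ → ℕ → (Fin d → ℕ) → E d → ℝ :=
  tensorWavelet (periodise φ) (periodise (waveletOf N φ φ))

/-- The wavelet coefficient `α_f(j, l, z) = ⟨f, ψ^per_{jlz}⟩` in `L²(𝕋^d)`. -/
def coeff {d : ℕ} (N : ℕ) (φ : ℝ → ℝ) (f : E d → ℝ) (j l : ℕ) (z : Fin d → ℕ) : ℝ :=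
  ∫ u, f u * perWavelet N φ j l z u ∂(uniformCube d)

/-- The Besov norm
`‖f‖_{𝓑^s_{∞,∞}(𝕋^d)} = sup_j 2^{j(s + d/2)} ∑_{l = 1}^{2^d} sup_z |α_f(j, l, z)|`. -/
def besovNorm {d : ℕ} (N : ℕ) (φ : ℝ → ℝ) (s : ℝ) (f : E d → ℝ) : ℝ≥0∞ :=
  ⨆ j : ℕ, ENNReal.ofReal (2 ^ ((j : ℝ) * (s + d / 2))) *
    ∑ l ∈ Finset.Icc 1 (2 ^ d), ⨆ z ∈ positions d j, ‖coeff N φ f j l z‖ₑ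

/-- `c` is a constant with `‖·‖_{𝓑^s_{∞,∞}} ≤ c ‖·‖_{𝓗^s}` for functions on `𝕋^d`. -/
def IsBesovHolderConst (d N : ℕ) (φ : ℝ → ℝ) (s c : ℝ) : Prop :=
  0 < c ∧ ∀ f : E d → ℝ, IsPeriodic f → ContDiff ℝ ⌊s⌋₊ f →
    besovNorm N φ s f ≤ ENNReal.ofReal c * holderNorm s f

/-! ### The approximate wavelets and the class of generators -/

/-- `φ̂^per_j(s) = 2^{j/2} ∑_{k = ⌈-1 - 2^{-j} N⌉}^{0} φ̂(2^j (s - k))`. -/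
def hatScalingPer (N : ℕ) (φhat : ℝ → ℝ) (j : ℕ) (s : ℝ) : ℝ :=
  (2 : ℝ) ^ ((j : ℝ) / 2) *
    ∑ k ∈ Finset.Icc ⌈-1 - (N : ℝ) / 2 ^ j⌉ 0, φhat (2 ^ j * (s - k))

/-- `ψ̂^per_j(s) = 2^{j/2} ∑_k ψ̂(2^j (s - k))`, with `k` ranging from
`⌈-1 - 2^{-(j+1)} (N+1)⌉` to `⌊1 + 2^{-(j+1)} (N-1)⌋`. -/
def hatWaveletPer (N : ℕ) (φ φhat : ℝ → ℝ) (j : ℕ) (s : ℝ) : ℝ :=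
  (2 : ℝ) ^ ((j : ℝ) / 2) *
    ∑ k ∈ Finset.Icc ⌈-1 - ((N : ℝ) + 1) / 2 ^ (j + 1)⌉ ⌊1 + ((N : ℝ) - 1) / 2 ^ (j + 1)⌋,
      waveletOf N φ φhat (2 ^ j * (s - k))

/-- The approximation `ψ̂^per_{jlz}`, evaluated at points `u` of `[0,1)^d`. -/
def hatPerWavelet {d : ℕ} (N : ℕ) (φ φhat : ℝ → ℝ) : ℕ → ℕ → (Fin d → ℕ) → E d → ℝ :=
  tensorWavelet (hatScalingPer N φhat) (hatWaveletPer N φ φhat)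

/-- The class `F̂_per^{η,δ}`: functions on `𝕋^d` whose `i`-th component is, on `[0,1)^d`,
`∑_{j = 0}^{⌊log₂ δ⁻¹⌋} ∑_{l = 1}^{2^d} ∑_z α̂(j,l,z)_i ψ̂^per_{jlz}` with
`|α̂(j,l,z)_i| ≤ c K 2^{-j(η + d/2)}`. -/
def hatF (d p N : ℕ) (φ φhat : ℝ → ℝ) (c K η δ : ℝ) : Set (E d → E p) :=
  {f | IsPeriodic f ∧ ∃ α : ℕ → ℕ → (Fin d → ℕ) → Fin p → ℝ,
    (∀ j ∈ Finset.range (⌊Real.logb 2 δ⁻¹⌋₊ + 1), ∀ l ∈ Finset.Icc 1 (2 ^ d),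
      ∀ z ∈ positions d j, ∀ i, |α j l z i| ≤ c * K * 2 ^ (-(j : ℝ) * (η + d / 2))) ∧
    ∀ u ∈ unitCube d, ∀ i, f u i =
      ∑ j ∈ Finset.range (⌊Real.logb 2 δ⁻¹⌋₊ + 1), ∑ l ∈ Finset.Icc 1 (2 ^ d),
        ∑ z ∈ positions d j, α j l z i * hatPerWavelet N φ φhat j l z u}

/-- The `ε`-covering number of `F` for the uniform norm: the least cardinality of a set `A` of
functions such that every `f ∈ F` is within `ε` of some element of `A`. -/
def coveringNumber {d p : ℕ} (F : Set (E d → E p)) (ε : ℝ) : ℕ∞ :=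
  ⨅ (A : Set (E d → E p)) (_ : ∀ f ∈ F, ∃ g ∈ A, ∀ u, ‖f u - g u‖ ≤ ε), A.encard

end HatPer

end

open HatPer

noncomputable section

namespace HatPer

/-! ### Finitely supported sums over `ℤ` -/

/-! Approximation. The generator chosen for a target f keeps the wavelet coefficients of f on the
levels j ≤ ⌊log₂ δ⁻¹⌋ and replaces the wavelets by their approximations; admissibility of the
constant says precisely that these coefficients are allowed in the class
(`IsBesovHolderConst.coeffDecay`, `hatSum_mem_hatF`). Let P be the same sum with exact wavelets.
Passing from the approximate sum to P costs, on level j, a constant times 2^j L⁻¹ 2^{-jη}, which the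
size of L makes at most δ^{η+γ-1}; the number of levels produces the logarithm
(`exists_norm_hatSum_sub_le`). Test functions D are Lipschitz because γ ≥ 1.

Passing from P to f in the uniform norm gains only δ^η. The missing δ^{γ-1} comes from D(P) - D(f) =
∇D(f)·(P - f) + remainder. The remainder is small because ∇D oscillates little between f and P. The
linear term is a duality pairing: ∇D∘f is (γ-1)-smooth, so its coefficients decay too, and pairing
it with the tail of the expansion of f adds the two smoothness exponents
(`exists_abs_integral_mul_le`, `exists_coeffDecay_comp`, `exists_integral_comp_sub_le`). For γ = 1
the uniform bound already suffices.

The wavelet theory behind this is derived from the two-scale relation. Filter identities give the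
telescoping of periodised kernels (`perKernel_succ`), so a partial sum is integration against a
product kernel of mass one, bounded L¹ norm and width 2^{-J}; this yields pointwise convergence for
continuous periodic functions (`tendsto_partialSum`) with no appeal to completeness in L². The
moments needed for coefficient decay follow from the smoothness of φ (`moment_eq_zero`), not from
the order M.

Entropy. An element of the class is determined by O(δ^{-d}) bounded coefficients. Rounding them to a
grid whose mesh is ε times a power of δ gives a finite cover, and the logarithm of the number of
grid values is O(log δ⁻¹ · log ε⁻¹) because both logarithms are bounded away from zero
(`exists_finite_cover`, `exists_log_coveringNumber_le`). -/

theorem summable_of_eq_zero_off {F : ℤ → ℝ} (a b : ℤ) (h : ∀ k, k ∉ Finset.Icc a b → F k = 0) :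
    Summable F :=
  summable_of_ne_finset_zero (s := Finset.Icc a b) h

theorem tsum_eq_sum_Icc {F : ℤ → ℝ} (a b : ℤ) (h : ∀ k, k ∉ Finset.Icc a b → F k = 0) :
    ∑' k, F k = ∑ k ∈ Finset.Icc a b, F k :=
  tsum_eq_sum h

/-- Summation over `ℤ` by residue classes modulo `n`. -/
theorem tsum_int_eq_sum_range (n : ℕ) (hn : n ≠ 0) {F : ℤ → ℝ} (hF : Summable F) :
    ∑' m, F m = ∑ z ∈ Finset.range n, ∑' k : ℤ, F (k * n + z) := by
  have : NeZero n := ⟨hn⟩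
  have h1 := (Int.divModEquiv n).symm.tsum_eq F
  have h2 : Summable fun q : ℤ × Fin n => F ((Int.divModEquiv n).symm q) :=
    (Int.divModEquiv n).symm.summable_iff.2 hF
  rw [← h1]
  have h3 : Summable fun q : Fin n × ℤ => F ((Int.divModEquiv n).symm q.swap) :=
    (Equiv.prodComm _ _).summable_iff.2 h2
  rw [← (Equiv.prodComm (Fin n) ℤ).tsum_eq]
  simp only [Equiv.prodComm_apply]
  rw [h3.tsum_prod, tsum_fintype, Finset.sum_range]
  refine Finset.sum_congr rfl fun z _ => tsum_congr fun k => ?_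
  simp [Int.divModEquiv]

theorem tsum_int_even_add_odd {F : ℤ → ℝ} (hF : Summable F) :
    ∑' m, F m = ∑' k, F (2 * k) + ∑' k, F (2 * k + 1) := by
  rw [tsum_int_eq_sum_range 2 two_ne_zero hF]
  simp [Finset.sum_range_succ, mul_comm]

/-! ### The filter of a scaling function -/

/-- The filter `λ_k = (-1)^{k+1} h_{1-k}` of the wavelet. -/
def wfilt (φ : ℝ → ℝ) (k : ℤ) : ℝ := (-1 : ℝ) ^ (k + 1) * filt φ (1 - k)

theorem waveletOf_eq (N : ℕ) (φ g : ℝ → ℝ) (x : ℝ) :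
    waveletOf N φ g x = ∑ k ∈ Finset.Icc (1 - (N : ℤ)) 1, wfilt φ k * g (2 * x - k) := rfl

section
variable {M : ℕ} {φ : ℝ → ℝ}

theorem IsDaubechies.cast_len (hφ : IsDaubechies M φ) : ((2 * M - 1 : ℕ) : ℝ) = 2 * M - 1 := by
  have := hφ.one_le
  rw [Nat.cast_sub (by omega)]; push_cast; ring

theorem IsDaubechies.eq_zero (hφ : IsDaubechies M φ) {x : ℝ}
    (hx : x < 0 ∨ ((2 * M - 1 : ℕ) : ℝ) < x) : φ x = 0 := by
  by_contra h
  have := hφ.support_subset (Function.mem_support.2 h)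
  rw [hφ.cast_len] at hx
  rcases hx with hx | hx
  · exact absurd this.1 (not_le.2 hx)
  · exact absurd this.2 (not_le.2 hx)

theorem IsDaubechies.hasCompactSupport (hφ : IsDaubechies M φ) : HasCompactSupport φ :=
  HasCompactSupport.of_support_subset_isCompact isCompact_Icc hφ.support_subset

/-- The function `x ↦ φ (c x - a)` has compact support. -/
theorem IsDaubechies.hasCompactSupport_comp (hφ : IsDaubechies M φ) {c : ℝ} (hc : c ≠ 0) (a : ℝ) :
    HasCompactSupport fun x => φ (c * x - a) := by
  have := hφ.hasCompactSupport.comp_homeomorph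
    ((Homeomorph.mulLeft₀ c hc).trans (Homeomorph.addRight (-a)))
  simpa [Function.comp_def, sub_eq_add_neg] using this

theorem integral_comp_two_mul (f : ℝ → ℝ) : ∫ x, f (2 * x) = 2⁻¹ * ∫ x, f x := by
  rw [Measure.integral_comp_mul_left]; norm_num

theorem IsDaubechies.integral_mul_shift (hφ : IsDaubechies M φ) (m k : ℤ) :
    ∫ x, φ (x - m) * φ (x - k) = if m = k then 1 else 0 := by
  have h := hφ.orthonormal (k - m)
  have h2 := integral_sub_right_eq_self (μ := volume)
    (fun x => φ x * φ (x - ((k - m : ℤ) : ℝ))) (m : ℝ)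
  rw [h] at h2
  have e : ∀ x : ℝ, x - m - ((k - m : ℤ) : ℝ) = x - k := fun x => by push_cast; ring
  simp only [e] at h2
  rw [h2]
  simp only [sub_eq_zero, eq_comm]

theorem IsDaubechies.integral_two_mul_shift (hφ : IsDaubechies M φ) (m k : ℤ) :
    ∫ x, φ (2 * x - m) * φ (2 * x - k) = if m = k then 2⁻¹ else 0 := by
  rw [integral_comp_two_mul fun x => φ (x - m) * φ (x - k), hφ.integral_mul_shift]
  split_ifs <;> simp

theorem IsDaubechies.integrable_two_mul_shift (hφ : IsDaubechies M φ) (hc : Continuous φ)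
    (m k : ℤ) : Integrable fun x => φ (2 * x - m) * φ (2 * x - k) :=
  Continuous.integrable_of_hasCompactSupport (by fun_prop)
    ((hφ.hasCompactSupport_comp two_ne_zero _).mul_right)

theorem IsDaubechies.two_scale_int (hφ : IsDaubechies M φ) (x : ℝ) :
    φ x = ∑ m ∈ Finset.range (2 * M), filt φ m * φ (2 * x - (m : ℤ)) := by
  simpa using hφ.two_scale x

/-- Inserting the two-scale relation for the first factor and using orthogonality of the functions
φ(2·-m) leaves no term when k is not one of the refinement indices. This lets filter sums run over
all of ℤ and be reindexed freely. -/
theorem IsDaubechies.filt_eq_zero (hφ : IsDaubechies M φ) (hc : Continuous φ) {k : ℤ}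
    (hk : k ∉ Finset.Icc (0 : ℤ) (2 * M - 1 : ℕ)) : filt φ k = 0 := by
  have h1 : ∀ y : ℝ, φ y * φ (2 * y - k) =
      ∑ m ∈ Finset.range (2 * M), filt φ m * (φ (2 * y - (m : ℤ)) * φ (2 * y - k)) := by
    intro y
    nth_rewrite 1 [hφ.two_scale_int y]
    rw [Finset.sum_mul]
    exact Finset.sum_congr rfl fun _ _ => by ring
  rw [filt]
  simp_rw [h1]
  have h2 : ∀ m ∈ Finset.range (2 * M), Integrable fun y : ℝ =>
      filt φ m * (φ (2 * y - (m : ℤ)) * φ (2 * y - k)) :=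
    fun m _ => (hφ.integrable_two_mul_shift hc m k).const_mul _
  rw [integral_finsetSum _ h2]
  simp_rw [integral_const_mul, hφ.integral_two_mul_shift]
  rw [Finset.sum_eq_zero, mul_zero]
  intro m hm
  rw [if_neg, mul_zero]
  rintro rfl
  apply hk
  have := Finset.mem_range.1 hm
  rw [Finset.mem_Icc]
  omega

theorem IsDaubechies.two_scale_Icc (hφ : IsDaubechies M φ) (x : ℝ) :
    φ x = ∑ m ∈ Finset.Icc (0 : ℤ) (2 * M - 1 : ℕ), filt φ m * φ (2 * x - m) := by
  rw [hφ.two_scale_int x]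
  have := hφ.one_le
  refine Finset.sum_bij (fun (m : ℕ) _ => (m : ℤ)) ?_ ?_ ?_ ?_
  · intro m hm; have := Finset.mem_range.1 hm; rw [Finset.mem_Icc]; omega
  · intro a _ b _ h; exact_mod_cast h
  · intro b hb
    rw [Finset.mem_Icc] at hb
    exact ⟨b.toNat, by rw [Finset.mem_range]; omega, by omega⟩
  · intros; rfl

theorem IsDaubechies.two_scale_tsum (hφ : IsDaubechies M φ) (hc : Continuous φ) (x : ℝ) :
    φ x = ∑' m : ℤ, filt φ m * φ (2 * x - m) := by
  rw [tsum_eq_sum_Icc 0 (2 * M - 1 : ℕ), ← hφ.two_scale_Icc]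
  intro k hk
  rw [hφ.filt_eq_zero hc hk, zero_mul]

theorem IsDaubechies.wfilt_eq_zero (hφ : IsDaubechies M φ) (hc : Continuous φ) {k : ℤ}
    (hk : k ∉ Finset.Icc (1 - ((2 * M - 1 : ℕ) : ℤ)) 1) : wfilt φ k = 0 := by
  rw [wfilt, hφ.filt_eq_zero hc, mul_zero]
  rw [Finset.mem_Icc] at hk ⊢
  omega

/-- A common window outside of which both filters vanish. -/
theorem IsDaubechies.exists_window (hφ : IsDaubechies M φ) (hc : Continuous φ) :
    ∃ B : ℕ, ∀ k : ℤ, (B : ℤ) < |k| → filt φ k = 0 ∧ wfilt φ k = 0 := by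
  refine ⟨2 * M + 2, fun k hk => ⟨hφ.filt_eq_zero hc ?_, hφ.wfilt_eq_zero hc ?_⟩⟩ <;>
  · rw [Finset.mem_Icc]
    rcases abs_cases k with ⟨h, _⟩ | ⟨h, _⟩ <;> omega

theorem summable_of_window {F : ℤ → ℝ} (B : ℕ) (h : ∀ k : ℤ, (B : ℤ) < |k| → F k = 0) :
    Summable F := by
  refine summable_of_eq_zero_off (-B) B fun k hk => h k ?_
  rw [Finset.mem_Icc, ← abs_le] at hk
  omega

theorem IsDaubechies.summable_filt (hφ : IsDaubechies M φ) (hc : Continuous φ) (g : ℤ → ℝ) :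
    Summable fun k => filt φ k * g k := by
  obtain ⟨B, hB⟩ := hφ.exists_window hc
  exact summable_of_window B fun k hk => by rw [(hB k hk).1, zero_mul]

/-- Orthonormality of the translates in terms of the filter. -/
theorem IsDaubechies.filt_autocorr (hφ : IsDaubechies M φ) (hc : Continuous φ) (k : ℤ) :
    ∑' m : ℤ, filt φ m * filt φ (m + 2 * k) = if k = 0 then 2 else 0 := by
  set S := Finset.Icc (0 : ℤ) (2 * M - 1 : ℕ) with hS
  -- Refining both factors turns orthonormality of integer translates into a double sum whose
  -- integrals survive only on the diagonal m = 2k + m'.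
  have h1 : ∀ x : ℝ, φ x * φ (x - k) = ∑ m ∈ S, ∑ m' ∈ S, filt φ m * filt φ m' *
      (φ (2 * x - m) * φ (2 * x - ((2 * k + m' : ℤ)))) := by
    intro x
    rw [hφ.two_scale_Icc x, hφ.two_scale_Icc (x - k), Finset.sum_mul_sum]
    refine Finset.sum_congr rfl fun m _ => Finset.sum_congr rfl fun m' _ => ?_
    have : 2 * (x - k) - (m' : ℝ) = 2 * x - ((2 * k + m' : ℤ) : ℝ) := by push_cast; ring
    rw [this]; ring
  have h2 := hφ.orthonormal k
  simp_rw [h1] at h2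
  rw [integral_finsetSum _ fun m _ => integrable_finsetSum _ fun m' _ =>
    (hφ.integrable_two_mul_shift hc m _).const_mul _] at h2
  simp_rw [integral_finsetSum S fun m' _ =>
    (hφ.integrable_two_mul_shift hc _ _).const_mul _, integral_const_mul,
    hφ.integral_two_mul_shift] at h2
  rw [Finset.sum_comm] at h2
  have h3 : ∀ m' ∈ S, ∑ m ∈ S, filt φ m * filt φ m' * (if m = 2 * k + m' then (2 : ℝ)⁻¹ else 0)
      = 2⁻¹ * (filt φ m' * filt φ (m' + 2 * k)) := by
    intro m' _
    simp_rw [mul_ite, mul_zero]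
    rw [Finset.sum_ite_eq' S]
    rw [add_comm (2 * k) m']
    split_ifs with h
    · ring
    · rw [hφ.filt_eq_zero hc h]; ring
  rw [Finset.sum_congr rfl h3, ← Finset.mul_sum] at h2
  rw [tsum_eq_sum_Icc 0 (2 * M - 1 : ℕ)]
  · rw [← hS]
    split_ifs at h2 ⊢ <;> linarith
  · intro m hm
    rw [hφ.filt_eq_zero hc hm, zero_mul]

theorem IsDaubechies.integrable_comp (hφ : IsDaubechies M φ) (hc : Continuous φ) {c : ℝ}
    (h0 : c ≠ 0) (a : ℝ) : Integrable fun x => φ (c * x - a) :=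
  Continuous.integrable_of_hasCompactSupport (by fun_prop) (hφ.hasCompactSupport_comp h0 _)

theorem IsDaubechies.tsum_filt (hφ : IsDaubechies M φ) (hc : Continuous φ) :
    ∑' m, filt φ m = 2 := by
  have h : ∫ x, ∑ m ∈ Finset.Icc (0 : ℤ) (2 * M - 1 : ℕ), filt φ m * φ (2 * x - m) = 1 := by
    rw [← hφ.integral_eq_one]
    exact congrArg _ (funext fun x => (hφ.two_scale_Icc x).symm)
  rw [integral_finsetSum _ fun m _ => (hφ.integrable_comp hc two_ne_zero _).const_mul _] at h
  have h1 : ∀ m : ℤ, ∫ x, φ (2 * x - m) = 2⁻¹ := by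
    intro m
    rw [integral_comp_two_mul fun x => φ (x - m), integral_sub_right_eq_self φ,
      hφ.integral_eq_one, mul_one]
  simp_rw [integral_const_mul, h1, ← Finset.sum_mul] at h
  rw [tsum_eq_sum_Icc 0 (2 * M - 1 : ℕ) fun m hm => hφ.filt_eq_zero hc hm]
  linarith

/-- The sum σ(q) depends only on the parity of q. Total mass gives σ(0) + σ(1) = 2, and summing the
autocorrelation identity over all lags gives σ(0)² + σ(1)² = 2. Hence (σ(0) - σ(1))² = 0. -/
theorem IsDaubechies.tsum_filt_two_mul_add (hφ : IsDaubechies M φ) (hc : Continuous φ) (q : ℤ) :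
    ∑' k : ℤ, filt φ (q + 2 * k) = 1 := by
  obtain ⟨B, hB⟩ := hφ.exists_window hc
  set σ : ℤ → ℝ := fun q => ∑' k : ℤ, filt φ (q + 2 * k) with hσ
  have per : ∀ q i, σ (2 * i + q) = σ q := by
    intro q i
    rw [hσ]
    simp only
    rw [← (Equiv.addLeft i).tsum_eq fun k => filt φ (q + 2 * k)]
    refine tsum_congr fun k => ?_
    simp only [Equiv.coe_addLeft]
    congr 1; ring
  have hs : Summable fun m => filt φ m := by simpa using hφ.summable_filt hc fun _ => 1
  have e1 : σ 0 + σ 1 = 2 := by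
    rw [← hφ.tsum_filt hc, tsum_int_even_add_odd hs]
    simp [hσ, add_comm]
  have e2 : ∑' m : ℤ, filt φ m * σ m = 2 := by
    have h1 : ∀ m : ℤ, filt φ m * σ m = ∑' k : ℤ, filt φ m * filt φ (m + 2 * k) :=
      fun m => by rw [tsum_mul_left]
    simp_rw [h1]
    rw [Summable.tsum_comm]
    · simp_rw [hφ.filt_autocorr hc]
      simp
    · refine summable_of_ne_finset_zero (s := Finset.Icc (-B : ℤ) B ×ˢ Finset.Icc (-B : ℤ) B) ?_
      rintro ⟨k, m⟩ hmk
      simp only [Function.uncurry]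
      by_cases h1 : (B : ℤ) < |m|
      · rw [(hB m h1).1, zero_mul]
      · by_cases h2 : (B : ℤ) < |m + 2 * k|
        · rw [(hB _ h2).1, mul_zero]
        · exfalso
          apply hmk
          rw [not_lt, abs_le] at h1 h2
          rw [Finset.mem_product, Finset.mem_Icc, Finset.mem_Icc]
          dsimp only
          omega
  rw [tsum_int_even_add_odd (hφ.summable_filt hc σ)] at e2
  have p0 : ∀ i, σ (2 * i) = σ 0 := fun i => by simpa using per 0 i
  simp_rw [per, p0] at e2
  rw [tsum_mul_right, tsum_mul_right] at e2
  have s0 : ∑' k : ℤ, filt φ (2 * k) = σ 0 := by simp [hσ]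
  have s1 : ∑' k : ℤ, filt φ (2 * k + 1) = σ 1 := by simp [hσ, add_comm]
  rw [s0, s1] at e2
  have h0 : σ 0 = 1 := by nlinarith [sq_nonneg (σ 0 - σ 1)]
  have h1 : σ 1 = 1 := by linarith
  change σ q = 1
  obtain ⟨i, hi | hi⟩ := Int.even_or_odd' q
  · rw [hi, p0, h0]
  · rw [hi, per, h1]

end

/-! ### Periodisation of compactly supported functions -/

/-- `g` vanishes outside of `[-R, R]`. -/
def VanishesOff (R : ℝ) (g : ℝ → ℝ) : Prop := ∀ x, R < |x| → g x = 0

/-- `∑_{k ∈ ℤ} g (s - k)`. -/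
def perSum (g : ℝ → ℝ) (s : ℝ) : ℝ := ∑' k : ℤ, g (s - k)

theorem VanishesOff.hasCompactSupport {R : ℝ} {g : ℝ → ℝ} (hg : VanishesOff R g) :
    HasCompactSupport g := by
  refine HasCompactSupport.of_support_subset_isCompact (isCompact_Icc (a := -R) (b := R)) ?_
  intro x hx
  rw [Set.mem_Icc, ← abs_le]
  by_contra h
  exact hx (hg x (not_le.1 h))

theorem VanishesOff.abs {R : ℝ} {g : ℝ → ℝ} (hg : VanishesOff R g) :
    VanishesOff R fun x => |g x| := fun x hx => by simp [hg x hx]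

theorem VanishesOff.comp_pow {R : ℝ} {g : ℝ → ℝ} (hg : VanishesOff R g) (j : ℕ) :
    VanishesOff R fun x => g (2 ^ j * x) := fun x hx => by
  refine hg _ (hx.trans_le ?_)
  rw [abs_mul, abs_of_pos (by positivity : (0 : ℝ) < 2 ^ j)]
  exact le_mul_of_one_le_left (abs_nonneg x) (one_le_pow₀ one_le_two)

theorem VanishesOff.mul_left {R : ℝ} {g : ℝ → ℝ} (hg : VanishesOff R g) (f : ℝ → ℝ) :
    VanishesOff R fun x => f x * g x := fun x hx => by simp [hg x hx]

theorem VanishesOff.shift_eq_zero {R X x : ℝ} {g : ℝ → ℝ} (hg : VanishesOff R g) (hx : |x| ≤ X)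
    {k : ℤ} (hk : k ∉ Finset.Icc (-⌈X + R⌉) ⌈X + R⌉) : g (x - k) = 0 := by
  apply hg
  by_contra h
  rw [not_lt] at h
  apply hk
  have h1 : |(k : ℝ)| ≤ X + R := by
    have : (k : ℝ) = x - (x - k) := by ring
    rw [this]
    exact (abs_sub _ _).trans (add_le_add hx h)
  rw [abs_le] at h1
  rw [Finset.mem_Icc]
  have h2 := Int.le_ceil (X + R)
  constructor
  · have : (-(⌈X + R⌉ : ℝ)) ≤ k := by linarith
    exact_mod_cast this
  · have : (k : ℝ) ≤ ⌈X + R⌉ := by linarith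
    exact_mod_cast this

theorem VanishesOff.perSum_eq {R X x : ℝ} {g : ℝ → ℝ} (hg : VanishesOff R g) (hx : |x| ≤ X) :
    perSum g x = ∑ k ∈ Finset.Icc (-⌈X + R⌉) ⌈X + R⌉, g (x - k) :=
  tsum_eq_sum fun _ hk => hg.shift_eq_zero hx hk

theorem VanishesOff.summable {R : ℝ} {g : ℝ → ℝ} (hg : VanishesOff R g) (x : ℝ) :
    Summable fun k : ℤ => g (x - k) :=
  summable_of_eq_zero_off _ _ fun _ hk => hg.shift_eq_zero le_rfl hk

theorem VanishesOff.continuous_perSum {R : ℝ} {g : ℝ → ℝ} (hg : VanishesOff R g)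
    (hc : Continuous g) : Continuous (perSum g) := by
  rw [continuous_iff_continuousAt]
  intro x
  have h1 : ContinuousAt
      (fun y : ℝ => ∑ k ∈ Finset.Icc (-⌈(|x| + 1) + R⌉) ⌈(|x| + 1) + R⌉, g (y - (k : ℤ))) x := by
    fun_prop
  refine h1.congr ?_
  filter_upwards [Metric.ball_mem_nhds x one_pos] with y hy
  refine (hg.perSum_eq ?_).symm
  rw [Metric.mem_ball, Real.dist_eq] at hy
  have : y = x + (y - x) := by ring
  rw [this]
  exact (abs_add_le _ _).trans (by linarith)

theorem perSum_add_one (g : ℝ → ℝ) (s : ℝ) : perSum g (s + 1) = perSum g s := by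
  unfold perSum
  rw [← (Equiv.addRight (1 : ℤ)).tsum_eq fun k : ℤ => g (s + 1 - k)]
  refine tsum_congr fun k => ?_
  simp only [Equiv.coe_addRight]
  congr 1; push_cast; ring

theorem VanishesOff.abs_perSum_le {R : ℝ} {g : ℝ → ℝ} (hg : VanishesOff R g) (s : ℝ) :
    |perSum g s| ≤ perSum (fun x => |g x|) s := by
  have := norm_tsum_le_tsum_norm (f := fun k : ℤ => g (s - k)) (hg.abs.summable s)
  simpa [perSum] using this

theorem VanishesOff.exists_perSum_le {R : ℝ} {g : ℝ → ℝ} (hg : VanishesOff R g)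
    (hc : Continuous g) : ∃ A, 0 < A ∧ ∀ s, perSum (fun x => |g x|) s ≤ A := by
  have h1 : Continuous (perSum fun x => |g x|) := hg.abs.continuous_perSum hc.abs
  obtain ⟨A, hA⟩ := (isCompact_Icc (a := (0 : ℝ)) (b := 1)).bddAbove_image h1.continuousOn
  refine ⟨max A 1, by positivity, fun s => ?_⟩
  have h2 : Function.Periodic (perSum fun x => |g x|) 1 := perSum_add_one _
  obtain ⟨t, ht, e⟩ := h2.exists_mem_Ico₀ one_pos s
  rw [e]
  exact le_max_of_le_left (hA ⟨t, ⟨ht.1, ht.2.le⟩, rfl⟩)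

/-- Unfolding of the integral of a periodisation. -/
theorem VanishesOff.integral_perSum {R : ℝ} {g : ℝ → ℝ} (hg : VanishesOff R g)
    (hc : Continuous g) : ∫ t in (0 : ℝ)..1, perSum g t = ∫ t, g t := by
  have hi : Integrable g := hc.integrable_of_hasCompactSupport hg.hasCompactSupport
  have h1 := hi.hasSum_intervalIntegral_comp_add_int
  rw [← h1.tsum_eq, ← (Equiv.neg ℤ).tsum_eq]
  have h2 : ∀ t ∈ Set.uIcc (0 : ℝ) 1, perSum g t =
      ∑ k ∈ Finset.Icc (-⌈1 + R⌉) ⌈1 + R⌉, g (t - k) := by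
    intro t ht
    rw [Set.uIcc_of_le zero_le_one] at ht
    exact hg.perSum_eq (abs_le.2 ⟨by linarith [ht.1], ht.2⟩)
  have h3 : ∀ k ∈ Finset.Icc (-⌈1 + R⌉) ⌈1 + R⌉,
      IntervalIntegrable (fun t : ℝ => g (t - (k : ℤ))) volume 0 1 :=
    fun k _ => (by fun_prop : Continuous fun t : ℝ => g (t - k)).intervalIntegrable _ _
  rw [intervalIntegral.integral_congr h2, intervalIntegral.integral_finsetSum h3]
  rw [tsum_eq_sum (s := Finset.Icc (-⌈1 + R⌉) ⌈1 + R⌉)]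
  · refine Finset.sum_congr rfl fun k _ => ?_
    simp [sub_eq_add_neg]
  · intro k hk
    rw [intervalIntegral.integral_congr (g := fun _ => 0)]
    · simp
    · intro t ht
      rw [Set.uIcc_of_le zero_le_one] at ht
      have := hg.shift_eq_zero (x := t) (X := 1) (abs_le.2 ⟨by linarith [ht.1], ht.2⟩) hk
      simpa [sub_eq_add_neg] using this

theorem periodise_eq (g : ℝ → ℝ) (j : ℕ) (s : ℝ) :
    periodise g j s = (2 : ℝ) ^ ((j : ℝ) / 2) * perSum (fun x => g (2 ^ j * x)) s := rfl

theorem VanishesOff.continuous_periodise {R : ℝ} {g : ℝ → ℝ} (hg : VanishesOff R g)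
    (hc : Continuous g) (j : ℕ) : Continuous (periodise g j) := by
  have : Continuous fun s : ℝ => perSum (fun x => g (2 ^ j * x)) s :=
    (hg.comp_pow j).continuous_perSum (by fun_prop)
  exact continuous_const.mul this

/-- Each integer is uniquely k·2^j + z with 0 ≤ z < 2^j, so the positions and the periods together
form one sum over ℤ at scale one. This is why a whole level costs no more than a single periodised
function, uniformly in j. -/
theorem VanishesOff.sum_perSum {R : ℝ} {g : ℝ → ℝ} (hg : VanishesOff R g) (j : ℕ) (s : ℝ) :
    ∑ z ∈ Finset.range (2 ^ j), perSum (fun x => g (2 ^ j * x)) (s - z / 2 ^ j) =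
      perSum g (2 ^ j * s) := by
  unfold perSum
  rw [tsum_int_eq_sum_range (2 ^ j) (by positivity) (hg.summable _)]
  refine Finset.sum_congr rfl fun z _ => tsum_congr fun k => congrArg g ?_
  push_cast
  field_simp
  ring

theorem VanishesOff.sum_periodise {R : ℝ} {g : ℝ → ℝ} (hg : VanishesOff R g) (j : ℕ) (s : ℝ) :
    ∑ z ∈ Finset.range (2 ^ j), periodise g j (s - z / 2 ^ j) =
      (2 : ℝ) ^ ((j : ℝ) / 2) * perSum g (2 ^ j * s) := by
  simp_rw [periodise_eq, ← Finset.mul_sum, hg.sum_perSum]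

theorem VanishesOff.abs_periodise_le {R : ℝ} {g : ℝ → ℝ} (hg : VanishesOff R g) (j : ℕ) (s : ℝ) :
    |periodise g j s| ≤ periodise (fun x => |g x|) j s := by
  rw [periodise_eq, periodise_eq, abs_mul, abs_of_pos (by positivity)]
  exact mul_le_mul_of_nonneg_left ((hg.comp_pow j).abs_perSum_le s) (by positivity)

theorem VanishesOff.exists_sum_abs_periodise_le {R : ℝ} {g : ℝ → ℝ} (hg : VanishesOff R g)
    (hc : Continuous g) : ∃ A, 0 < A ∧ ∀ (j : ℕ) (s : ℝ),
      ∑ z ∈ Finset.range (2 ^ j), |periodise g j (s - z / 2 ^ j)| ≤ A * (2 : ℝ) ^ ((j : ℝ) / 2) := by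
  obtain ⟨A, hA, h⟩ := hg.exists_perSum_le hc
  refine ⟨A, hA, fun j s => ?_⟩
  calc _ ≤ ∑ z ∈ Finset.range (2 ^ j), periodise (fun x => |g x|) j (s - z / 2 ^ j) :=
        Finset.sum_le_sum fun z _ => hg.abs_periodise_le j _
    _ = (2 : ℝ) ^ ((j : ℝ) / 2) * perSum (fun x => |g x|) (2 ^ j * s) := hg.abs.sum_periodise j s
    _ ≤ _ := by rw [mul_comm]; exact mul_le_mul_of_nonneg_right (h _) (by positivity)

theorem VanishesOff.comp_sub {R : ℝ} {g : ℝ → ℝ} (hg : VanishesOff R g) (a : ℝ) :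
    VanishesOff (R + |a|) fun x => g (x - a) := fun x hx => by
  refine hg _ ?_
  have := abs_sub_abs_le_abs_sub x a
  linarith

/-- The integral of a periodic function against a periodised function. -/
theorem VanishesOff.integral_mul_periodise {R : ℝ} {g : ℝ → ℝ} (hg : VanishesOff R g)
    (hc : Continuous g) {f : ℝ → ℝ} (hf : Continuous f) (hp : ∀ t, f (t + 1) = f t) (j : ℕ)
    (a : ℝ) : ∫ t in (0 : ℝ)..1, f t * periodise g j (t - a / 2 ^ j) =
      (2 : ℝ) ^ ((j : ℝ) / 2) * ∫ t, f t * g (2 ^ j * t - a) := by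
  have hp' : ∀ (k : ℤ) t, f (t - k) = f t := fun k t =>
    by simpa using (show Function.Periodic f 1 from hp).sub_zsmul_eq (x := t) k
  have hv : VanishesOff (R + |a|) fun t => f t * g (2 ^ j * t - a) :=
    ((hg.comp_sub a).comp_pow j).mul_left f
  rw [← hv.integral_perSum (by fun_prop), ← intervalIntegral.integral_const_mul]
  refine intervalIntegral.integral_congr fun t _ => ?_
  simp only [periodise_eq, perSum, hp']
  rw [tsum_mul_left, mul_left_comm]
  congr 2
  refine tsum_congr fun k => congrArg g ?_
  field_simp
  ring

theorem VanishesOff.integral_abs_periodise_le {R : ℝ} {g : ℝ → ℝ} (hg : VanishesOff R g)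
    (hc : Continuous g) (j : ℕ) (a : ℝ) :
    ∫ t in (0 : ℝ)..1, |periodise g j (t - a / 2 ^ j)| ≤
      (∫ t, |g t|) * (2 : ℝ) ^ (-(j : ℝ) / 2) := by
  have h1 := hg.abs.integral_mul_periodise hc.abs (f := fun _ => 1) continuous_const
    (fun _ => rfl) j a
  have h2 : ∫ t in (0 : ℝ)..1, |periodise g j (t - a / 2 ^ j)| ≤
      ∫ t in (0 : ℝ)..1, 1 * periodise (fun x => |g x|) j (t - a / 2 ^ j) := by
    refine intervalIntegral.integral_mono_on zero_le_one ?_ ?_ fun t _ => ?_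
    · have := hg.continuous_periodise hc j
      exact Continuous.intervalIntegrable (by fun_prop) _ _
    · have := hg.abs.continuous_periodise hc.abs j
      exact Continuous.intervalIntegrable (by fun_prop) _ _
    · rw [one_mul]; exact hg.abs_periodise_le j _
  refine h2.trans (h1.le.trans (le_of_eq ?_))
  simp only [one_mul]
  rw [Measure.integral_comp_mul_left (fun x => |g (x - a)|) (2 ^ j),
    integral_sub_right_eq_self (fun x => |g x|), abs_of_pos (by positivity), smul_eq_mul]
  have h3 : (2 : ℝ) ^ ((j : ℝ) / 2) * ((2 : ℝ) ^ j)⁻¹ = (2 : ℝ) ^ (-(j : ℝ) / 2) := by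
    rw [← Real.rpow_natCast, ← Real.rpow_neg zero_le_two, ← Real.rpow_add two_pos]
    congr 1; ring
  rw [← mul_assoc, h3, mul_comm]

section
variable {M : ℕ} {φ : ℝ → ℝ}

theorem IsDaubechies.vanishesOff (hφ : IsDaubechies M φ) :
    VanishesOff (2 * M - 1 : ℕ) φ := fun x hx => hφ.eq_zero (by
  have h0 : (0 : ℝ) ≤ (2 * M - 1 : ℕ) := Nat.cast_nonneg _
  rcases lt_abs.1 hx with h | h
  · exact Or.inr h
  · left; linarith)

theorem IsDaubechies.continuous_wavelet (hc : Continuous φ) (N : ℕ) :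
    Continuous (waveletOf N φ φ) := by
  unfold waveletOf
  fun_prop

theorem IsDaubechies.wavelet_eq_zero (hφ : IsDaubechies M φ) {x : ℝ}
    (hx : x < (1 - ((2 * M - 1 : ℕ) : ℝ)) / 2 ∨ (((2 * M - 1 : ℕ) : ℝ) + 1) / 2 < x) :
    waveletOf (2 * M - 1) φ φ x = 0 := by
  refine Finset.sum_eq_zero fun k hk => ?_
  rw [Finset.mem_Icc] at hk
  have h1 : (1 - ((2 * M - 1 : ℕ) : ℝ)) ≤ k := by exact_mod_cast hk.1
  have h2 : (k : ℝ) ≤ 1 := by exact_mod_cast hk.2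
  rw [hφ.eq_zero, mul_zero]
  rcases hx with h | h
  · left; linarith
  · right; linarith

theorem IsDaubechies.vanishesOff_wavelet (hφ : IsDaubechies M φ) :
    VanishesOff ((2 * M - 1 : ℕ) + 1) (waveletOf (2 * M - 1) φ φ) := fun x hx =>
  hφ.wavelet_eq_zero (by
    have h0 : (0 : ℝ) ≤ (2 * M - 1 : ℕ) := Nat.cast_nonneg _
    rcases lt_abs.1 hx with h | h
    · right; linarith
    · left; linarith)

/-- The integer translates of a scaling function form a partition of unity. -/
theorem IsDaubechies.perSum_eq_one (hφ : IsDaubechies M φ) (hc : Continuous φ) (x : ℝ) :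
    perSum φ x = 1 := by
  have hv := hφ.vanishesOff
  have hcont := hv.continuous_perSum hc
  -- After refinement each φ(2x - q) carries the weight ∑_k h_{q-2k} = 1, so the periodised sum is
  -- unchanged by doubling its argument.
  have dbl : ∀ x, perSum φ x = perSum φ (2 * x) := by
    intro x
    obtain ⟨B, hB⟩ := hφ.exists_window hc
    have h1 : perSum φ x = ∑' k : ℤ, ∑' q : ℤ, filt φ (q - 2 * k) * φ (2 * x - q) := by
      refine tsum_congr fun k => ?_
      rw [hφ.two_scale_tsum hc, ← (Equiv.subRight (2 * k)).tsum_eq]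
      refine tsum_congr fun q => ?_
      simp only [Equiv.subRight_apply]
      congr 2; push_cast; ring
    rw [h1, Summable.tsum_comm]
    · refine tsum_congr fun q => ?_
      rw [tsum_mul_right]
      have : ∑' k : ℤ, filt φ (q - 2 * k) = 1 := by
        rw [← hφ.tsum_filt_two_mul_add hc q, ← (Equiv.neg ℤ).tsum_eq]
        refine tsum_congr fun k => ?_
        simp
      rw [this, one_mul]
    · obtain ⟨D, hD⟩ : ∃ D : ℕ, ∀ q : ℤ, (D : ℤ) < |q| → φ (2 * x - q) = 0 := by
        refine ⟨⌈|2 * x| + (2 * M - 1 : ℕ)⌉.toNat, fun q hq =>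
          hv.shift_eq_zero (X := |2 * x|) le_rfl fun h => ?_⟩
        rw [Finset.mem_Icc, ← abs_le] at h
        omega
      refine summable_of_ne_finset_zero
        (s := Finset.Icc (-(B + D : ℤ)) (B + D) ×ˢ Finset.Icc (-(B + D : ℤ)) (B + D)) ?_
      rintro ⟨q, k⟩ hqk
      simp only [Function.uncurry]
      by_cases h1 : (D : ℤ) < |q|
      · rw [hD q h1, mul_zero]
      · by_cases h2 : (B : ℤ) < |q - 2 * k|
        · rw [(hB _ h2).1, zero_mul]
        · exfalso
          apply hqk
          rw [not_lt, abs_le] at h1 h2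
          rw [Finset.mem_product, Finset.mem_Icc, Finset.mem_Icc]
          dsimp only
          omega
  -- Halving repeatedly drives the argument to 0, and continuity there forces a constant; its value
  -- is the integral over a period, namely ∫φ = 1.
  have hconst : ∀ x, perSum φ x = perSum φ 0 := by
    intro x
    have h1 : ∀ n : ℕ, perSum φ (x * (1 / 2) ^ n) = perSum φ x := by
      intro n
      induction n with
      | zero => simp
      | succ n ih => rw [dbl, ← ih]; congr 1; ring
    have h2 : Filter.Tendsto (fun n : ℕ => x * (1 / 2 : ℝ) ^ n) Filter.atTop (nhds (x * 0)) :=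
      (tendsto_pow_atTop_nhds_zero_of_lt_one (by norm_num) (by norm_num)).const_mul x
    have h3 := (hcont.tendsto (x * 0)).comp h2
    simp only [Function.comp_def, h1, mul_zero] at h3
    exact tendsto_nhds_unique tendsto_const_nhds h3
  have h := hv.integral_perSum hc
  rw [hφ.integral_eq_one] at h
  simp_rw [hconst] at h
  rw [hconst]
  simpa using h

/-! ### Vanishing moments of a smooth wavelet -/

/-- The reflection m ↦ 1 - 2k - m exchanges the two filters and flips the sign, so the sum equals
its own negative. -/
theorem IsDaubechies.tsum_wfilt_mul_filt (k : ℤ) :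
    ∑' m : ℤ, wfilt φ m * filt φ (m + 2 * k) = 0 := by
  have h : ∑' m : ℤ, wfilt φ m * filt φ (m + 2 * k) =
      -∑' m : ℤ, wfilt φ m * filt φ (m + 2 * k) := by
    nth_rewrite 1 [← (Equiv.subLeft (1 - 2 * k)).tsum_eq]
    rw [← tsum_neg]
    refine tsum_congr fun m => ?_
    simp only [Equiv.subLeft_apply, wfilt]
    have e1 : (1 : ℤ) - (1 - 2 * k - m) = m + 2 * k := by ring
    have e2 : (1 : ℤ) - 2 * k - m + 2 * k = 1 - m := by ring
    have e3 : (-1 : ℝ) ^ ((1 : ℤ) - 2 * k - m + 1) = -(-1) ^ (m + 1) := by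
      have : (1 : ℤ) - 2 * k - m + 1 = (m + 1) + (2 * (-k - m) + 1) := by ring
      rw [this, zpow_add₀ (by norm_num), zpow_add₀ (by norm_num) (2 * (-k - m)), zpow_mul]
      norm_num
    rw [e1, e2, e3]; ring
  linarith

/-- At j = 0 this is the vanishing cross-correlation of the filters. Refining φ alone reduces level
j + 1 to level j. Orthogonality of φ to all finer wavelets is the input of the moment argument
below. -/
theorem IsDaubechies.integral_mul_wavelet (hφ : IsDaubechies M φ) (hc : Continuous φ) (j : ℕ) :
    ∀ k : ℤ, ∫ x, φ x * waveletOf (2 * M - 1) φ φ (2 ^ j * x - k) = 0 := by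
  induction j with
  | zero =>
    intro k
    set S := Finset.Icc (0 : ℤ) (2 * M - 1 : ℕ) with hS
    set W := Finset.Icc (1 - ((2 * M - 1 : ℕ) : ℤ)) 1 with hW
    have h1 : ∀ x : ℝ, φ x * waveletOf (2 * M - 1) φ φ (2 ^ 0 * x - k) =
        ∑ m ∈ W, ∑ m' ∈ S, wfilt φ m * filt φ m' *
          (φ (2 * x - m') * φ (2 * x - ((m + 2 * k : ℤ)))) := by
      intro x
      rw [hφ.two_scale_Icc x, waveletOf_eq, mul_comm, Finset.sum_mul_sum]
      refine Finset.sum_congr rfl fun m _ => Finset.sum_congr rfl fun m' _ => ?_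
      have : 2 * (2 ^ 0 * x - k) - (m : ℝ) = 2 * x - ((m + 2 * k : ℤ) : ℝ) := by push_cast; ring
      rw [this]; ring
    simp_rw [h1]
    rw [integral_finsetSum _ fun m _ => integrable_finsetSum _ fun m' _ =>
      (hφ.integrable_two_mul_shift hc m' _).const_mul _]
    simp_rw [integral_finsetSum S fun m' _ =>
      (hφ.integrable_two_mul_shift hc _ _).const_mul _, integral_const_mul,
      hφ.integral_two_mul_shift]
    have h3 : ∀ m ∈ W,
        ∑ m' ∈ S, wfilt φ m * filt φ m' * (if m' = m + 2 * k then (2 : ℝ)⁻¹ else 0)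
        = 2⁻¹ * (wfilt φ m * filt φ (m + 2 * k)) := by
      intro m _
      simp_rw [mul_ite, mul_zero]
      rw [Finset.sum_ite_eq' S]
      split_ifs with h
      · ring
      · rw [hφ.filt_eq_zero hc h]; ring
    rw [Finset.sum_congr rfl h3, ← Finset.mul_sum,
      ← tsum_eq_sum_Icc (F := fun m => wfilt φ m * filt φ (m + 2 * k)) _ _
        fun m hm => by rw [hφ.wfilt_eq_zero hc hm, zero_mul],
      IsDaubechies.tsum_wfilt_mul_filt, mul_zero]
  | succ j ih =>
    intro k
    have hcw := IsDaubechies.continuous_wavelet hc (2 * M - 1)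
    have h1 : ∀ x : ℝ, φ x * waveletOf (2 * M - 1) φ φ (2 ^ (j + 1) * x - k) =
        ∑ m ∈ Finset.Icc (0 : ℤ) (2 * M - 1 : ℕ), filt φ m *
          (φ (2 * x - m) * waveletOf (2 * M - 1) φ φ (2 ^ j * (2 * x) - k)) := by
      intro x
      nth_rewrite 1 [hφ.two_scale_Icc x]
      rw [Finset.sum_mul]
      refine Finset.sum_congr rfl fun m _ => ?_
      rw [← mul_assoc (2 ^ j : ℝ) 2 x, ← pow_succ, mul_assoc]
    simp_rw [h1]
    have h2 : ∀ m ∈ Finset.Icc (0 : ℤ) (2 * M - 1 : ℕ), Integrable fun x : ℝ => filt φ m *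
        (φ (2 * x - m) * waveletOf (2 * M - 1) φ φ (2 ^ j * (2 * x) - k)) := fun m _ =>
      Integrable.const_mul (Continuous.integrable_of_hasCompactSupport (by fun_prop)
        ((hφ.hasCompactSupport_comp two_ne_zero _).mul_right)) _
    rw [integral_finsetSum _ h2]
    refine Finset.sum_eq_zero fun m _ => ?_
    rw [integral_const_mul,
      integral_comp_two_mul fun x => φ (x - m) * waveletOf (2 * M - 1) φ φ (2 ^ j * x - k),
      ← integral_add_right_eq_self _ (m : ℝ)]
    have h2 := ih (k - 2 ^ j * m)
    have e : ∀ x : ℝ, 2 ^ j * (x + m) - (k : ℝ) = 2 ^ j * x - ((k - 2 ^ j * m : ℤ) : ℝ) := by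
      intro x; push_cast; ring
    simp_rw [e, add_sub_cancel_right]
    rw [h2]; simp

/-- Taylor's theorem for functions whose top derivative is Hölder continuous. -/
theorem taylor_bound (n : ℕ) : ∀ (F : ℕ → ℝ → ℝ)
    (_ : ∀ m < n, ∀ x, HasDerivAt (F m) (F (m + 1) x) x) {C α : ℝ} (_ : 0 ≤ C) (_ : 0 ≤ α)
    (_ : ∀ x y, |F n x - F n y| ≤ C * |x - y| ^ α) (s₀ s : ℝ),
    |F 0 s - ∑ m ∈ Finset.range (n + 1), F m s₀ * (s - s₀) ^ m / m.factorial| ≤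
      C * |s - s₀| ^ (n + α) := by
  induction n with
  | zero =>
    intro F _ C α _ _ h s₀ s
    simpa using h s s₀
  | succ n ih =>
    intro F hF C α hC hα h s₀ s
    set R : ℝ → ℝ := fun s => F 0 s -
      ∑ m ∈ Finset.range (n + 1 + 1), F m s₀ * (s - s₀) ^ m / m.factorial with hR
    have hR0 : R s₀ = 0 := by
      simp only [hR, sub_self]
      rw [Finset.sum_eq_single 0]
      · simp
      · intro b _ hb; simp [hb]
      · simp
    have hd : ∀ t, HasDerivAt R (F 1 t -
        ∑ m ∈ Finset.range (n + 1), F (m + 1) s₀ * (t - s₀) ^ m / m.factorial) t := by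
      intro t
      refine (hF 0 (Nat.succ_pos n) t).sub ?_
      have h1 : ∀ m ∈ Finset.range (n + 1 + 1),
          HasDerivAt (fun t => F m s₀ * (t - s₀) ^ m / m.factorial)
            (F m s₀ * (m * (t - s₀) ^ (m - 1)) / m.factorial) t := by
        intro m _
        have := (((hasDerivAt_id t).sub_const s₀).pow m).const_mul (F m s₀)
        simpa using this.div_const _
      have h2 := HasDerivAt.fun_sum h1
      rw [Finset.sum_range_succ'] at h2
      convert h2 using 1
      simp only [Nat.cast_zero, zero_mul, mul_zero, zero_div, add_zero]
      refine Finset.sum_congr rfl fun m _ => ?_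
      rw [Nat.factorial_succ, Nat.add_sub_cancel]
      push_cast
      have : ((m : ℝ) + 1) ≠ 0 := by positivity
      have h3 : (m.factorial : ℝ) ≠ 0 := by positivity
      field_simp
    -- The derivative of the remainder is the order-n remainder of `F 1`, so the mean value
    -- inequality on the segment gains one power of |s - s₀|. The factorial in the constant is given
    -- up.
    have key := Convex.norm_image_sub_le_of_norm_hasDerivWithin_le (f := R)
      (s := Set.uIcc s₀ s) (x := s₀) (y := s) (C := C * |s - s₀| ^ (n + α))
      (fun t _ => (hd t).hasDerivWithinAt) (fun t ht => by
        have h1 := ih (fun m => F (m + 1)) (fun m hm x => hF (m + 1) (by omega) x) hC hα h s₀ t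
        rw [Real.norm_eq_abs]
        refine h1.trans (mul_le_mul_of_nonneg_left ?_ hC)
        refine Real.rpow_le_rpow (abs_nonneg _) ?_ (by positivity)
        exact Set.abs_sub_left_of_mem_uIcc ht) (convex_uIcc _ _)
      Set.left_mem_uIcc Set.right_mem_uIcc
    rw [hR0, sub_zero, Real.norm_eq_abs, Real.norm_eq_abs, mul_assoc] at key
    refine key.trans (mul_le_mul_of_nonneg_left (le_of_eq ?_) hC)
    nth_rewrite 2 [← Real.rpow_one |s - s₀|]
    rw [← Real.rpow_add_of_nonneg (abs_nonneg _) (by positivity) zero_le_one]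
    congr 1; push_cast; ring

/-- A constant function with compact support on the line vanishes. Applied to φ, it provides a point
where a prescribed derivative is nonzero. -/
theorem eq_zero_of_iteratedDeriv_eq_zero (m : ℕ) : ∀ f : ℝ → ℝ, ContDiff ℝ m f →
    HasCompactSupport f → iteratedDeriv m f = 0 → f = 0 := by
  induction m with
  | zero => intro f _ _ h; simpa using h
  | succ m ih =>
    intro f hf hs h
    rw [iteratedDeriv_succ'] at h
    have hf' : ContDiff ℝ m (deriv f) :=
      (contDiff_succ_iff_deriv.1 (by exact_mod_cast hf : ContDiff ℝ (m + 1) f)).2.2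
    have h1 := ih _ hf' hs.deriv h
    have hd : Differentiable ℝ f := hf.differentiable (by simp)
    have h2 := is_const_of_deriv_eq_zero hd fun x => congrFun h1 x
    obtain ⟨y, hy⟩ : ∃ y, f y = 0 := by
      obtain ⟨R, hR⟩ := hs.isCompact.isBounded.subset_closedBall 0
      refine ⟨|R| + 1, image_eq_zero_of_notMem_tsupport fun hm => ?_⟩
      have := hR hm
      rw [Metric.mem_closedBall, dist_zero_right, Real.norm_eq_abs] at this
      have h3 := le_abs_self (|R| + 1)
      have h4 := le_abs_self R
      linarith
    funext x
    rw [h2 x y, hy]; rfl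

theorem hasCompactSupport_iteratedDeriv {f : ℝ → ℝ} (hf : HasCompactSupport f) (m : ℕ) :
    HasCompactSupport (iteratedDeriv m f) := by
  induction m with
  | zero => simpa using hf
  | succ m ih => rw [iteratedDeriv_succ]; exact ih.deriv

/-- The expansion point must be dyadic, since orthogonality is known only for wavelets centred at
dyadic points. -/
theorem exists_dyadic_ne_zero {f : ℝ → ℝ} (hc : Continuous f) (h : f ≠ 0) :
    ∃ (j : ℕ) (k : ℤ), f (k / 2 ^ j) ≠ 0 := by
  obtain ⟨x, hx⟩ := Function.ne_iff.1 h
  have h1 : Filter.Tendsto (fun j : ℕ => (⌊x * 2 ^ j⌋ : ℝ) / 2 ^ j) Filter.atTop (nhds x) := by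
    have h2 : Filter.Tendsto (fun j : ℕ => x - (1 / 2 : ℝ) ^ j) Filter.atTop (nhds (x - 0)) :=
      (tendsto_pow_atTop_nhds_zero_of_lt_one (by norm_num) (by norm_num)).const_sub x
    rw [sub_zero] at h2
    refine tendsto_of_tendsto_of_tendsto_of_le_of_le h2 tendsto_const_nhds (fun j => ?_)
      fun j => ?_
    · have h3 := Int.lt_floor_add_one (x * 2 ^ j)
      have h4 : (0 : ℝ) < 2 ^ j := by positivity
      simp only
      rw [le_div_iff₀ h4, sub_mul, ← mul_pow]
      norm_num
      linarith
    · have h3 := Int.floor_le (x * 2 ^ j)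
      simp only
      rwa [div_le_iff₀ (by positivity)]
  have h2 := ((hc.tendsto x).comp h1).eventually_ne hx
  obtain ⟨j, hj⟩ := h2.exists
  exact ⟨j, _, hj⟩

theorem VanishesOff.integrable_mul {R : ℝ} {g : ℝ → ℝ} (hg : VanishesOff R g) (hc : Continuous g)
    {f : ℝ → ℝ} (hf : Continuous f) : Integrable fun x => f x * g x :=
  (hf.mul hc).integrable_of_hasCompactSupport hg.hasCompactSupport.mul_left

/-- The wavelet of a scaling function of class `C^{n+1}` has `n + 1` vanishing moments. -/
theorem IsDaubechies.moment_eq_zero (hφ : IsDaubechies M φ) {n : ℕ} (hn : ContDiff ℝ (n + 1) φ) :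
    ∀ m ≤ n, ∫ x, x ^ m * waveletOf (2 * M - 1) φ φ x = 0 := by
  have hc : Continuous φ := hn.continuous
  set ψ := waveletOf (2 * M - 1) φ φ with hψ
  have hψc : Continuous ψ := IsDaubechies.continuous_wavelet hc _
  have hψv := hφ.vanishesOff_wavelet
  intro m
  induction m using Nat.strong_induction_on with
  | _ m ih =>
  intro hmn
  have hm1 : ContDiff ℝ (m + 1 : ℕ) φ := hn.of_le (by exact_mod_cast Nat.succ_le_succ hmn)
  have hm0 : ContDiff ℝ m φ := hm1.of_le (by exact_mod_cast Nat.le_succ m)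
  set F : ℕ → ℝ → ℝ := fun i => iteratedDeriv i φ with hF
  have hFd : ∀ i ≤ m, ∀ x, HasDerivAt (F i) (F (i + 1) x) x := by
    intro i hi x
    have : Differentiable ℝ (iteratedDeriv i φ) :=
      hm1.differentiable_iteratedDeriv i (by exact_mod_cast Nat.lt_succ_of_le hi)
    simp only [hF]
    rw [iteratedDeriv_succ]
    exact (this x).hasDerivAt
  obtain ⟨C, hC⟩ : ∃ C, ∀ x, ‖F (m + 1) x‖ ≤ C :=
    (hm1.continuous_iteratedDeriv (m + 1) le_rfl).bounded_above_of_compact_support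
      (hasCompactSupport_iteratedDeriv hφ.hasCompactSupport _)
  have hC0 : 0 ≤ C := (norm_nonneg _).trans (hC 0)
  have hlip : ∀ x y, |F m x - F m y| ≤ C * |x - y| ^ (1 : ℝ) := by
    intro x y
    rw [Real.rpow_one]
    exact Convex.norm_image_sub_le_of_norm_hasDerivWithin_le (s := Set.univ)
      (fun t _ => (hFd m le_rfl t).hasDerivWithinAt) (fun t _ => hC t) convex_univ
      (Set.mem_univ _) (Set.mem_univ _)
  have hne : F m ≠ 0 := by
    intro h
    have h1 := eq_zero_of_iteratedDeriv_eq_zero m φ hm0 hφ.hasCompactSupport h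
    have h2 := hφ.integral_eq_one
    rw [h1] at h2
    simp at h2
  obtain ⟨j₀, k₀, ha⟩ := exists_dyadic_ne_zero (hm0.continuous_iteratedDeriv m le_rfl) hne
  set a : ℝ := k₀ / 2 ^ j₀ with ha_def
  set μ := ∫ x, x ^ m * ψ x with hμ
  have htaylor := taylor_bound m F (fun i hi => hFd i hi.le) hC0 zero_le_one hlip a
  set c := F m a / m.factorial with hcdef
  have hcne : c ≠ 0 := div_ne_zero ha (by positivity)
  set D := ∫ x, |x| ^ (m + 1) * |ψ x| with hD
  -- Expand φ(a + hy) to order m and integrate against ψ: the left side is zero by orthogonality and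
  -- the lower moments vanish by induction. So cμh^m is minus the Taylor remainder, of order
  -- h^{m+1}; dividing by h^m and letting h → 0 gives cμ = 0.
  have key : ∀ j : ℕ, |c * μ| ≤ C * D * (1 / 2) ^ (j₀ + j) := by
    intro j
    set h : ℝ := (1 / 2) ^ (j₀ + j) with hh
    have hhpos : 0 < h := by positivity
    have h1 : ∫ y, φ (a + h * y) * ψ y = 0 := by
      -- The dyadic point a = k₀/2^{j₀} equals k₀2^j/2^{j₀+j}, hence is a wavelet centre on every
      -- finer level.
      have h2 := hφ.integral_mul_wavelet hc (j₀ + j) (k₀ * 2 ^ j)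
      rw [← hψ] at h2
      have h3 := Measure.integral_comp_mul_left
        (fun y => φ (a + h * y) * ψ y) ((2 : ℝ) ^ (j₀ + j))
      have h4 := integral_sub_right_eq_self (μ := volume)
        (fun y : ℝ => φ (a + h * (2 ^ (j₀ + j) * y)) * ψ (2 ^ (j₀ + j) * y)) a
      have hinv : h * 2 ^ (j₀ + j) = 1 := by rw [hh, ← mul_pow]; norm_num
      have e1 : ∀ y : ℝ, a + h * (2 ^ (j₀ + j) * (y - a)) = y := by
        intro y; rw [← mul_assoc, hinv]; ring
      have e2 : ∀ y : ℝ, (2 : ℝ) ^ (j₀ + j) * (y - a) =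
          2 ^ (j₀ + j) * y - ((k₀ * 2 ^ j : ℤ) : ℝ) := by
        intro y
        rw [ha_def, pow_add]; push_cast; field_simp
      simp_rw [e1, e2] at h4
      rw [h2, h3, smul_eq_mul] at h4
      have h5 : |((2 : ℝ) ^ (j₀ + j))⁻¹| ≠ 0 := by positivity
      exact (mul_eq_zero.1 h4.symm).resolve_left h5
    have h2 : ∀ y : ℝ, φ (a + h * y) * ψ y =
        (φ (a + h * y) - ∑ i ∈ Finset.range (m + 1), F i a * (h * y) ^ i / i.factorial) * ψ y +
        ∑ i ∈ Finset.range (m + 1), F i a * h ^ i / i.factorial * (y ^ i * ψ y) := by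
      intro y
      rw [sub_mul, Finset.sum_mul]
      have : ∀ i ∈ Finset.range (m + 1), F i a * (h * y) ^ i / i.factorial * ψ y =
          F i a * h ^ i / i.factorial * (y ^ i * ψ y) := fun i _ => by rw [mul_pow]; ring
      rw [Finset.sum_congr rfl this]; ring
    have i1 : Integrable fun y : ℝ => (φ (a + h * y) -
        ∑ i ∈ Finset.range (m + 1), F i a * (h * y) ^ i / i.factorial) * ψ y :=
      hψv.integrable_mul hψc (by fun_prop)
    have i2 : ∀ i ∈ Finset.range (m + 1), Integrable fun y : ℝ =>
        F i a * h ^ i / i.factorial * (y ^ i * ψ y) := fun i _ =>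
      (hψv.integrable_mul hψc (by fun_prop)).const_mul _
    simp_rw [h2] at h1
    rw [integral_add i1 (integrable_finsetSum _ i2), integral_finsetSum _ i2,
      Finset.sum_range_succ, Finset.sum_eq_zero] at h1
    · rw [integral_const_mul, ← hμ, zero_add] at h1
      have h3 : c * μ * h ^ m = -∫ y : ℝ, (φ (a + h * y) -
          ∑ i ∈ Finset.range (m + 1), F i a * (h * y) ^ i / i.factorial) * ψ y := by
        rw [hcdef]; linear_combination h1
      have h4 : |c * μ * h ^ m| ≤ C * h ^ (m + 1) * D := by
        rw [h3, abs_neg, hD, ← integral_const_mul, ← Real.norm_eq_abs]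
        refine norm_integral_le_of_norm_le
          ((hψv.abs.integrable_mul hψc.abs (by fun_prop)).const_mul _)
          (Filter.Eventually.of_forall fun y => ?_)
        have h5 := htaylor (a + h * y)
        simp only [add_sub_cancel_left] at h5
        have h6 : (m : ℝ) + 1 = ((m + 1 : ℕ) : ℝ) := by push_cast; ring
        rw [h6, Real.rpow_natCast, abs_mul, abs_of_pos hhpos, mul_pow] at h5
        rw [norm_mul, Real.norm_eq_abs, Real.norm_eq_abs]
        have h7 : F 0 (a + h * y) = φ (a + h * y) := by simp [hF]
        rw [h7] at h5
        calc _ ≤ C * (h ^ (m + 1) * |y| ^ (m + 1)) * |ψ y| :=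
              mul_le_mul_of_nonneg_right h5 (abs_nonneg _)
          _ = _ := by ring
      rw [abs_mul, abs_of_pos (pow_pos hhpos m)] at h4
      have h5 : |c * μ| * h ^ m ≤ (C * D * h) * h ^ m := h4.trans (le_of_eq (by ring))
      exact le_of_mul_le_mul_right h5 (pow_pos hhpos m)
    · intro i hi
      have hi' := Finset.mem_range.1 hi
      rw [integral_const_mul, ih i hi' (hi'.le.trans hmn), mul_zero]
  have hlim : Filter.Tendsto (fun j : ℕ => C * D * (1 / 2 : ℝ) ^ (j₀ + j)) Filter.atTop
      (nhds (C * D * 0)) := by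
    refine Filter.Tendsto.const_mul _ ?_
    simp_rw [add_comm j₀]
    exact (Filter.tendsto_add_atTop_iff_nat j₀).2
      (tendsto_pow_atTop_nhds_zero_of_lt_one (by norm_num) (by norm_num))
  rw [mul_zero] at hlim
  have h0 : |c * μ| ≤ 0 := ge_of_tendsto' hlim key
  exact (mul_eq_zero.1 (abs_eq_zero.1 (le_antisymm h0 (abs_nonneg _)))).resolve_left hcne

end

/-! ### Perfect reconstruction -/

theorem sum_range_two_mul (f : ℕ → ℝ) (P : ℕ) :
    ∑ q ∈ Finset.range (2 * P), f q = ∑ n ∈ Finset.range P, (f (2 * n) + f (2 * n + 1)) := by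
  induction P with
  | zero => simp
  | succ P ih =>
    rw [Finset.sum_range_succ, ← ih, show 2 * (P + 1) = 2 * P + 1 + 1 by ring,
      Finset.sum_range_succ, Finset.sum_range_succ, add_assoc]

/-- The correlation `∑_{n < P} A(2n + m) A'(2n + m + r)`. -/
def polyCorr (A A' : ℤ → ℝ) (P : ℕ) (r m : ℤ) : ℝ :=
  ∑ n ∈ Finset.range P, A (2 * n + m) * A' (2 * n + m + r)

/-- Moving m by 2 rotates the summation over one full period 2P, so the correlation depends only on
the parity of m. -/
theorem polyCorr_add_two_mul {A A' : ℤ → ℝ} {P : ℕ} (hA : ∀ q, A (q + 2 * P) = A q)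
    (hA' : ∀ q, A' (q + 2 * P) = A' q) (r m i : ℤ) :
    polyCorr A A' P r (m + 2 * i) = polyCorr A A' P r m := by
  have h1 : Function.Periodic (polyCorr A A' P r) 2 := by
    intro m
    unfold polyCorr
    rcases P with _ | P
    · simp
    rw [Finset.sum_range_succ, Finset.sum_range_succ']
    congr 1
    · refine Finset.sum_congr rfl fun n _ => ?_
      push_cast
      congr 2 <;> ring
    · rw [← hA (2 * ((0 : ℕ) : ℤ) + m), ← hA' (2 * ((0 : ℕ) : ℤ) + m + r)]
      push_cast
      congr 2 <;> ring
  have := h1.zsmul i m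
  rw [smul_eq_mul, mul_comm] at this
  exact this

/-- Expansion of the product of two filtered sequences by lags. -/
theorem sum_filter_mul {c : ℤ → ℝ} {B : ℕ} (hc : ∀ k : ℤ, (B : ℤ) < |k| → c k = 0)
    (A A' : ℤ → ℝ) (P : ℕ) :
    ∑ n ∈ Finset.range P, (∑' m : ℤ, c m * A (2 * n + m)) * ∑' m : ℤ, c m * A' (2 * n + m) =
      ∑ r ∈ Finset.Icc (-(2 * B : ℤ)) (2 * B),
        ∑' m : ℤ, c m * c (m + r) * polyCorr A A' P r m := by
  have hc' : ∀ k : ℤ, k ∉ Finset.Icc (-B : ℤ) B → c k = 0 := fun k hk => hc k (by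
    rw [Finset.mem_Icc, ← abs_le] at hk; omega)
  have h1 : ∀ n ∈ Finset.range P,
      (∑' m : ℤ, c m * A (2 * n + m)) * ∑' m : ℤ, c m * A' (2 * n + m) =
      ∑ r ∈ Finset.Icc (-(2 * B : ℤ)) (2 * B), ∑ m ∈ Finset.Icc (-B : ℤ) B,
        c m * c (m + r) * (A (2 * n + m) * A' (2 * n + m + r)) := by
    intro n _
    rw [tsum_eq_sum_Icc (-B) B fun m hm => by rw [hc' m hm, zero_mul], Finset.sum_mul,
      Finset.sum_comm]
    refine Finset.sum_congr rfl fun m hm => ?_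
    rw [← (Equiv.addLeft m).tsum_eq, tsum_eq_sum_Icc (-(2 * B)) (2 * B), Finset.mul_sum]
    · refine Finset.sum_congr rfl fun r _ => ?_
      simp only [Equiv.coe_addLeft, ← add_assoc]
      ring
    · intro r hr
      simp only [Equiv.coe_addLeft]
      rw [hc', zero_mul]
      rw [Finset.mem_Icc] at hr hm ⊢
      omega
  rw [Finset.sum_congr rfl h1, Finset.sum_comm]
  refine Finset.sum_congr rfl fun r _ => ?_
  rw [Finset.sum_comm, tsum_eq_sum_Icc (-B) B fun m hm => by rw [hc' m hm, zero_mul, zero_mul]]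
  refine Finset.sum_congr rfl fun m _ => ?_
  rw [polyCorr, Finset.mul_sum]

section
variable {M : ℕ} {φ : ℝ → ℝ}

/-- Under the reflection m ↦ 1 - r - m the lag-r products of the wavelet filter become those of the
scaling filter, up to the sign (-1)^r. -/
theorem wfilt_mul_wfilt (m r : ℤ) :
    wfilt φ (1 - r - m) * wfilt φ (1 - r - m + r) = (-1) ^ r * (filt φ m * filt φ (m + r)) := by
  have e1 : (1 : ℤ) - (1 - r - m) = m + r := by ring
  have e2 : (1 : ℤ) - (1 - r - m + r) = m := by ring
  have e3 : (-1 : ℝ) ^ (1 - r - m + 1) * (-1) ^ (1 - r - m + r + 1) = (-1) ^ r := by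
    rw [← zpow_add₀ (by norm_num),
      show (1 - r - m + 1) + (1 - r - m + r + 1) = r + 2 * (2 - r - m) by ring,
      zpow_add₀ (by norm_num), zpow_mul (-1 : ℝ) 2]
    norm_num
  rw [wfilt, wfilt, e1, e2, ← e3]
  ring

/-- Reflect the second sum. For odd r the sign makes the two sums cancel. For even r the reflection
replaces X(m) by X(m + 1), the weights add up to X(0) + X(1), and the autocorrelation identity
remains. -/
theorem IsDaubechies.lag_sum (hφ : IsDaubechies M φ) (hc : Continuous φ) {X : ℤ → ℝ}
    (hX : ∀ m i, X (m + 2 * i) = X m) (r : ℤ) :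
    ∑' m : ℤ, filt φ m * filt φ (m + r) * X m + ∑' m : ℤ, wfilt φ m * wfilt φ (m + r) * X m =
      if r = 0 then 2 * (X 0 + X 1) else 0 := by
  have hs : ∀ Y : ℤ → ℝ, Summable fun m => filt φ m * filt φ (m + r) * Y m := fun Y => by
    simpa only [mul_assoc] using hφ.summable_filt hc fun m => filt φ (m + r) * Y m
  rw [← (Equiv.subLeft (1 - r)).tsum_eq fun m => wfilt φ m * wfilt φ (m + r) * X m]
  simp only [Equiv.subLeft_apply, wfilt_mul_wfilt]
  obtain ⟨i, rfl | rfl⟩ := Int.even_or_odd' r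
  · have h1 : ∀ m, (-1 : ℝ) ^ (2 * i) * (filt φ m * filt φ (m + 2 * i)) * X (1 - 2 * i - m) =
        filt φ m * filt φ (m + 2 * i) * X (m + 1) := by
      intro m
      rw [show (1 - 2 * i - m) = m + 1 + 2 * (-i - m) by ring, hX, zpow_mul]
      norm_num
    simp_rw [h1]
    rw [← (hs _).tsum_add (hs _)]
    have h2 : ∀ m, X m + X (m + 1) = X 0 + X 1 := by
      intro m
      obtain ⟨k, rfl | rfl⟩ := Int.even_or_odd' m
      · have := hX 0 k; have h3 := hX 1 k
        rw [zero_add] at this; rw [add_comm 1] at h3; rw [this, h3]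
      · have := hX 1 k; have h3 := hX 0 (k + 1)
        rw [zero_add] at h3; rw [add_comm 1] at this
        rw [show 2 * k + 1 + 1 = 2 * (k + 1) by ring, this, h3, add_comm]
    simp_rw [← mul_add, h2]
    rw [tsum_mul_right, hφ.filt_autocorr hc]
    by_cases hi : i = 0 <;> simp [hi]
  · have h1 : ∀ m, (-1 : ℝ) ^ (2 * i + 1) * (filt φ m * filt φ (m + (2 * i + 1))) *
        X (1 - (2 * i + 1) - m) = -(filt φ m * filt φ (m + (2 * i + 1)) * X m) := by
      intro m
      rw [show (1 - (2 * i + 1) - m) = m + 2 * (-i - m) by ring, hX, zpow_add₀ (by norm_num),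
        zpow_mul]
      norm_num
    simp_rw [h1]
    rw [tsum_neg, add_neg_cancel, if_neg (by omega)]

/-- The energy identity of a two-channel orthonormal filter bank, polarised and stated for sequences
of period 2P. Expanding by lags, `lag_sum` annihilates every lag except zero. -/
theorem IsDaubechies.reconstruction (hφ : IsDaubechies M φ) (hc : Continuous φ) {A A' : ℤ → ℝ}
    {P : ℕ} (hA : ∀ q, A (q + 2 * P) = A q) (hA' : ∀ q, A' (q + 2 * P) = A' q) :
    ∑ n ∈ Finset.range P, (∑' m : ℤ, filt φ m * A (2 * n + m)) * ∑' m : ℤ, filt φ m * A' (2 * n + m)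
    + ∑ n ∈ Finset.range P,
      (∑' m : ℤ, wfilt φ m * A (2 * n + m)) * ∑' m : ℤ, wfilt φ m * A' (2 * n + m) =
    2 * ∑ q ∈ Finset.range (2 * P), A q * A' q := by
  obtain ⟨B, hB⟩ := hφ.exists_window hc
  rw [sum_filter_mul (fun k hk => (hB k hk).1), sum_filter_mul (fun k hk => (hB k hk).2),
    ← Finset.sum_add_distrib]
  have h1 : ∀ r ∈ Finset.Icc (-(2 * B : ℤ)) (2 * B), _ = _ := fun r _ =>
    hφ.lag_sum hc (polyCorr_add_two_mul hA hA' r) r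
  rw [Finset.sum_congr rfl h1, Finset.sum_ite_eq' _ (0 : ℤ), if_pos (by simp),
    sum_range_two_mul, polyCorr, polyCorr, ← Finset.sum_add_distrib]
  simp

theorem two_rpow_half_succ (j : ℕ) :
    (2 : ℝ) ^ ((j : ℝ) / 2) = (2 : ℝ) ^ (-(1 / 2 : ℝ)) * 2 ^ (((j + 1 : ℕ) : ℝ) / 2) := by
  rw [← Real.rpow_add two_pos]
  congr 1; push_cast; ring

theorem VanishesOff.periodise_two_scale {R : ℝ} {g : ℝ → ℝ} (hg : VanishesOff R g)
    {W : Finset ℤ} {c : ℤ → ℝ} (hcW : ∀ m, m ∉ W → c m = 0) {f : ℝ → ℝ}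
    (hf : ∀ x, f x = ∑ m ∈ W, c m * g (2 * x - m)) (j : ℕ) (s : ℝ) (n : ℤ) :
    periodise f j (s - n / 2 ^ j) = (2 : ℝ) ^ (-(1 / 2 : ℝ)) *
      ∑' m : ℤ, c m * periodise g (j + 1) (s - ((2 * n + m : ℤ) : ℝ) / 2 ^ (j + 1)) := by
  rw [tsum_eq_sum (s := W) fun m hm => by rw [hcW m hm, zero_mul]]
  simp only [periodise_eq, perSum]
  simp_rw [hf]
  rw [Summable.tsum_finsetSum, two_rpow_half_succ, mul_assoc, Finset.mul_sum]
  · congr 1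
    refine Finset.sum_congr rfl fun m _ => ?_
    rw [tsum_mul_left, mul_left_comm]
    congr 2
    refine tsum_congr fun k => congrArg g ?_
    push_cast
    rw [pow_succ]
    field_simp
    ring
  · intro m _
    refine Summable.mul_left _ ?_
    have := (hg.comp_pow (j + 1)).summable (s - (2 * n + m) / 2 ^ (j + 1))
    refine this.congr fun k => congrArg g ?_
    rw [pow_succ]
    field_simp
    ring

/-- The periodised kernel `∑_{z < 2^j} g_j(s - z/2^j) g_j(t - z/2^j)`. -/
def perKernel (g : ℝ → ℝ) (j : ℕ) (s t : ℝ) : ℝ :=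
  ∑ z ∈ Finset.range (2 ^ j), periodise g j (s - z / 2 ^ j) * periodise g j (t - z / 2 ^ j)

theorem periodise_sub_one (g : ℝ → ℝ) (j : ℕ) (s : ℝ) : periodise g j (s - 1) = periodise g j s := by
  rw [periodise_eq, periodise_eq, ← perSum_add_one _ (s - 1), sub_add_cancel]

/-- The kernel form of V_{j+1} = V_j ⊕ W_j. The values of level j + 1 at its positions form
sequences of period 2·2^j, to which `reconstruction` applies; the two normalisations 2^{-1/2} cancel
its factor 2. -/
theorem IsDaubechies.perKernel_succ (hφ : IsDaubechies M φ) (hc : Continuous φ) (j : ℕ)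
    (s t : ℝ) : perKernel φ (j + 1) s t =
      perKernel φ j s t + perKernel (waveletOf (2 * M - 1) φ φ) j s t := by
  have hp : ∀ (s : ℝ) (q : ℤ),
      periodise φ (j + 1) (s - ((q + 2 * (2 ^ j : ℕ) : ℤ) : ℝ) / 2 ^ (j + 1)) =
        periodise φ (j + 1) (s - (q : ℝ) / 2 ^ (j + 1)) := by
    intro s q
    rw [← periodise_sub_one φ (j + 1) (s - (q : ℝ) / 2 ^ (j + 1))]
    congr 1
    push_cast
    rw [pow_succ]
    field_simp
    ring
  have h := hφ.reconstruction hc (P := 2 ^ j)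
    (A := fun q => periodise φ (j + 1) (s - (q : ℝ) / 2 ^ (j + 1)))
    (A' := fun q => periodise φ (j + 1) (t - (q : ℝ) / 2 ^ (j + 1))) (hp s) (hp t)
  have hv := hφ.vanishesOff
  have hs := hv.periodise_two_scale (fun m hm => hφ.filt_eq_zero hc hm) hφ.two_scale_Icc j
  have hw := hv.periodise_two_scale (fun m hm => hφ.wfilt_eq_zero hc hm)
    (waveletOf_eq (2 * M - 1) φ φ) j
  have hhalf : (2 : ℝ) ^ (-(1 / 2 : ℝ)) * (2 : ℝ) ^ (-(1 / 2 : ℝ)) = 1 / 2 := by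
    rw [← Real.rpow_add two_pos, show (-(1 / 2 : ℝ)) + -(1 / 2) = -1 by norm_num,
      Real.rpow_neg_one, one_div]
  have e1 : perKernel φ j s t = 1 / 2 * ∑ n ∈ Finset.range (2 ^ j),
      (∑' m : ℤ, filt φ m * periodise φ (j + 1) (s - ((2 * n + m : ℤ) : ℝ) / 2 ^ (j + 1))) *
      ∑' m : ℤ, filt φ m * periodise φ (j + 1) (t - ((2 * n + m : ℤ) : ℝ) / 2 ^ (j + 1)) := by
    rw [Finset.mul_sum]
    refine Finset.sum_congr rfl fun z _ => ?_
    have a1 := hs s z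
    have a2 := hs t z
    rw [Int.cast_natCast] at a1 a2
    rw [a1, a2, mul_mul_mul_comm, hhalf]
  have e2 : perKernel (waveletOf (2 * M - 1) φ φ) j s t = 1 / 2 * ∑ n ∈ Finset.range (2 ^ j),
      (∑' m : ℤ, wfilt φ m * periodise φ (j + 1) (s - ((2 * n + m : ℤ) : ℝ) / 2 ^ (j + 1))) *
      ∑' m : ℤ, wfilt φ m * periodise φ (j + 1) (t - ((2 * n + m : ℤ) : ℝ) / 2 ^ (j + 1)) := by
    rw [Finset.mul_sum]
    refine Finset.sum_congr rfl fun z _ => ?_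
    have a1 := hw s z
    have a2 := hw t z
    rw [Int.cast_natCast] at a1 a2
    rw [a1, a2, mul_mul_mul_comm, hhalf]
  rw [e1, e2, ← mul_add, h, perKernel, pow_succ, mul_comm (2 ^ j) 2]
  simp

theorem IsDaubechies.periodise_zero (hφ : IsDaubechies M φ) (hc : Continuous φ) (s : ℝ) :
    periodise φ 0 s = 1 := by
  rw [periodise_eq]
  simpa using hφ.perSum_eq_one hc s

theorem IsDaubechies.perKernel_zero (hφ : IsDaubechies M φ) (hc : Continuous φ) (s t : ℝ) :
    perKernel φ 0 s t = 1 := by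
  simp [perKernel, hφ.periodise_zero hc]

/-! ### Perturbation of the scaling function -/

theorem card_Icc_le {a b : ℤ} {n : ℕ} (h : b - a + 1 ≤ n) : (Finset.Icc a b).card ≤ n := by
  rw [Int.card_Icc]; omega

/-- For -1 < s < 1, the range of u_i - 2^{-j}z_i on the unit cube, the finite window in
`hatScalingPer` contains every translate that meets the support of φ. So truncation causes no error,
and only replacing φ by φ̂ does. -/
theorem IsDaubechies.periodise_eq_sum (hφ : IsDaubechies M φ) (j : ℕ) {s : ℝ}
    (h1 : -1 < s) (h2 : s < 1) : periodise φ j s = (2 : ℝ) ^ ((j : ℝ) / 2) *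
      ∑ k ∈ Finset.Icc ⌈-1 - ((2 * M - 1 : ℕ) : ℝ) / 2 ^ j⌉ 0, φ (2 ^ j * (s - k)) := by
  have hpos : (0 : ℝ) < 2 ^ j := by positivity
  rw [periodise]
  congr 1
  refine tsum_eq_sum fun k hk => hφ.eq_zero ?_
  by_contra h
  push Not at h
  apply hk
  rw [Finset.mem_Icc, Int.ceil_le]
  have h3 : 0 ≤ s - k := nonneg_of_mul_nonneg_right h.1 hpos
  have h4 : s - k ≤ ((2 * M - 1 : ℕ) : ℝ) / 2 ^ j := by
    rw [le_div_iff₀ hpos, mul_comm]; exact h.2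
  constructor
  · linarith
  · have : (k : ℝ) < 1 := by linarith
    have : k < 1 := by exact_mod_cast this
    omega

theorem IsDaubechies.periodise_wavelet_eq_sum (hφ : IsDaubechies M φ) (j : ℕ) {s : ℝ}
    (h1 : -1 < s) (h2 : s < 1) :
    periodise (waveletOf (2 * M - 1) φ φ) j s = (2 : ℝ) ^ ((j : ℝ) / 2) *
      ∑ k ∈ Finset.Icc ⌈-1 - (((2 * M - 1 : ℕ) : ℝ) + 1) / 2 ^ (j + 1)⌉
        ⌊1 + (((2 * M - 1 : ℕ) : ℝ) - 1) / 2 ^ (j + 1)⌋,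
        waveletOf (2 * M - 1) φ φ (2 ^ j * (s - k)) := by
  have hpos : (0 : ℝ) < 2 ^ j := by positivity
  rw [periodise]
  congr 1
  refine tsum_eq_sum fun k hk => hφ.wavelet_eq_zero ?_
  by_contra h
  push Not at h
  apply hk
  rw [Finset.mem_Icc, Int.ceil_le, Int.le_floor]
  have h3 : -((((2 * M - 1 : ℕ) : ℝ) - 1) / 2 ^ (j + 1)) ≤ s - k := by
    rw [← neg_div, div_le_iff₀ (by positivity), pow_succ]
    nlinarith [h.1]
  have h4 : s - k ≤ (((2 * M - 1 : ℕ) : ℝ) + 1) / 2 ^ (j + 1) := by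
    rw [le_div_iff₀ (by positivity), pow_succ]
    nlinarith [h.2]
  constructor <;> linarith

theorem abs_sum_sub_sum_le (S : Finset ℤ) {n : ℕ} (hS : S.card ≤ n) (F G : ℤ → ℝ) {D : ℝ}
    (hD : 0 ≤ D) (h : ∀ k, |F k - G k| ≤ D) : |∑ k ∈ S, F k - ∑ k ∈ S, G k| ≤ n * D := by
  rw [← Finset.sum_sub_distrib]
  refine (Finset.abs_sum_le_sum_abs _ _).trans ((Finset.sum_le_card_nsmul S _ D fun k _ => h k).trans ?_)
  rw [nsmul_eq_mul]
  exact mul_le_mul_of_nonneg_right (by exact_mod_cast hS) hD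

theorem abs_waveletOf_sub_le (N : ℕ) {φhat : ℝ → ℝ} {D : ℝ} (h : ∀ x, |φ x - φhat x| ≤ D)
    (x : ℝ) : |waveletOf N φ φ x - waveletOf N φ φhat x| ≤
      (∑ k ∈ Finset.Icc (1 - (N : ℤ)) 1, |wfilt φ k|) * D := by
  rw [waveletOf_eq, waveletOf_eq, ← Finset.sum_sub_distrib, Finset.sum_mul]
  refine (Finset.abs_sum_le_sum_abs _ _).trans (Finset.sum_le_sum fun k _ => ?_)
  rw [← mul_sub, abs_mul]
  exact mul_le_mul_of_nonneg_left (h _) (abs_nonneg _)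

/-- The approximate periodised functions are close to the exact ones. -/
theorem IsDaubechies.exists_hat_close (hφ : IsDaubechies M φ) :
    ∃ A, 0 < A ∧ ∀ (φhat : ℝ → ℝ) (D : ℝ), (∀ x, |φ x - φhat x| ≤ D) → ∀ (j : ℕ) (s : ℝ),
      -1 < s → s < 1 →
      |hatScalingPer (2 * M - 1) φhat j s - periodise φ j s| ≤ A * D * (2 : ℝ) ^ ((j : ℝ) / 2) ∧
      |hatWaveletPer (2 * M - 1) φ φhat j s - periodise (waveletOf (2 * M - 1) φ φ) j s| ≤
        A * D * (2 : ℝ) ^ ((j : ℝ) / 2) := by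
  set N := 2 * M - 1 with hN
  set Λ := ∑ k ∈ Finset.Icc (1 - (N : ℤ)) 1, |wfilt φ k| with hΛ
  have hΛ0 : 0 ≤ Λ := Finset.sum_nonneg fun _ _ => abs_nonneg _
  -- Both windows contain at most 2N + 4 translates at every level; Λ is the ℓ¹ norm of the wavelet
  -- filter, by which the error of φ̂ is amplified in ψ̂.
  refine ⟨((2 * N + 4 : ℕ) : ℝ) * (1 + Λ), by positivity, fun φhat D hD j s h1 h2 => ?_⟩
  have hD0 : 0 ≤ D := (abs_nonneg _).trans (hD 0)
  have hpow : (1 : ℝ) ≤ 2 ^ j := one_le_pow₀ one_le_two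
  have hpow' : (1 : ℝ) ≤ 2 ^ (j + 1) := one_le_pow₀ one_le_two
  have hN0 : (0 : ℝ) ≤ N := Nat.cast_nonneg N
  constructor
  · rw [hφ.periodise_eq_sum j h1 h2, ← hN, hatScalingPer, ← mul_sub, abs_mul,
      abs_of_pos (by positivity), mul_comm]
    refine mul_le_mul_of_nonneg_right ?_ (by positivity)
    rw [abs_sub_comm]
    refine (abs_sum_sub_sum_le _ (n := 2 * N + 4) (card_Icc_le ?_) _ _ hD0 fun k => hD _).trans ?_
    · have : (-1 - (N : ℤ)) ≤ ⌈-1 - (N : ℝ) / 2 ^ j⌉ := by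
        have h3 : ((-1 - (N : ℤ) : ℤ) : ℝ) ≤ ⌈-1 - (N : ℝ) / 2 ^ j⌉ := by
          refine le_trans ?_ (Int.le_ceil _)
          push_cast
          have := div_le_self hN0 hpow
          linarith
        exact_mod_cast h3
      push_cast; omega
    · rw [mul_assoc]
      exact mul_le_mul_of_nonneg_left (by nlinarith) (by positivity)
  · rw [hφ.periodise_wavelet_eq_sum j h1 h2, ← hN, hatWaveletPer, ← mul_sub, abs_mul,
      abs_of_pos (by positivity), mul_comm]
    refine mul_le_mul_of_nonneg_right ?_ (by positivity)
    rw [abs_sub_comm]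
    refine (abs_sum_sub_sum_le _ (n := 2 * N + 4) (card_Icc_le ?_) _ _ (by positivity)
      fun k => abs_waveletOf_sub_le N hD _).trans ?_
    · have h5 : (-1 - ((N : ℤ) + 1)) ≤ ⌈-1 - ((N : ℝ) + 1) / 2 ^ (j + 1)⌉ := by
        have h3 : ((-1 - ((N : ℤ) + 1) : ℤ) : ℝ) ≤ ⌈-1 - ((N : ℝ) + 1) / 2 ^ (j + 1)⌉ := by
          refine le_trans ?_ (Int.le_ceil _)
          push_cast
          have := div_le_self (by positivity : (0 : ℝ) ≤ N + 1) hpow'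
          linarith
        exact_mod_cast h3
      have h6 : ⌊1 + ((N : ℝ) - 1) / 2 ^ (j + 1)⌋ ≤ 1 + (N : ℤ) := by
        have h3 : (⌊1 + ((N : ℝ) - 1) / 2 ^ (j + 1)⌋ : ℝ) ≤ ((1 + (N : ℤ) : ℤ) : ℝ) := by
          refine (Int.floor_le _).trans ?_
          push_cast
          have h7 : ((N : ℝ) - 1) / 2 ^ (j + 1) ≤ N / 2 ^ (j + 1) :=
            div_le_div_of_nonneg_right (by linarith) (by positivity)
          have := div_le_self hN0 hpow'
          linarith
        exact_mod_cast h3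
      push_cast; omega
    · rw [mul_assoc, ← hΛ]
      exact mul_le_mul_of_nonneg_left (by nlinarith) (by positivity)

end

/-! ### Quantitative Hölder classes -/

/-- `f : ℝ → ℝ` has `n` derivatives bounded by `C`, the last one `α`-Hölder with constant `C`. -/
def HolN : ℕ → ℝ → ℝ → (ℝ → ℝ) → Prop
  | 0, α, C, f => Continuous f ∧ (∀ x, |f x| ≤ C) ∧ ∀ x y, |f x - f y| ≤ C * |x - y| ^ α
  | n + 1, α, C, f => (∀ x, |f x| ≤ C) ∧ ∃ f' : ℝ → ℝ, (∀ x, HasDerivAt f (f' x) x) ∧ HolN n α C f'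

/-- `f` has partial derivatives of order up to `n` bounded by `C`, those of order `n` being
`α`-Hölder with constant `C`. -/
def HolE {d : ℕ} : ℕ → ℝ → ℝ → (E d → ℝ) → Prop
  | 0, α, C, f => Continuous f ∧ (∀ x, |f x| ≤ C) ∧ ∀ x y, |f x - f y| ≤ C * ‖x - y‖ ^ α
  | n + 1, α, C, f => (∀ x, |f x| ≤ C) ∧ Differentiable ℝ f ∧ ∀ i, HolE n α C (partialD i f)

theorem HolN.abs_le {n : ℕ} {α C : ℝ} {f : ℝ → ℝ} (h : HolN n α C f) (x : ℝ) : |f x| ≤ C := by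
  cases n with
  | zero => exact h.2.1 x
  | succ n => exact h.1 x

theorem HolN.nonneg {n : ℕ} {α C : ℝ} {f : ℝ → ℝ} (h : HolN n α C f) : 0 ≤ C :=
  (abs_nonneg _).trans (h.abs_le 0)

theorem HolN.continuous {n : ℕ} {α C : ℝ} {f : ℝ → ℝ} (h : HolN n α C f) : Continuous f := by
  cases n with
  | zero => exact h.1
  | succ n =>
    obtain ⟨-, f', hf', -⟩ := h
    exact continuous_iff_continuousAt.2 fun x => (hf' x).continuousAt

theorem HolE.abs_le {d n : ℕ} {α C : ℝ} {f : E d → ℝ} (h : HolE n α C f) (x : E d) :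
    |f x| ≤ C := by
  cases n with
  | zero => exact h.2.1 x
  | succ n => exact h.1 x

theorem HolE.nonneg {d n : ℕ} {α C : ℝ} {f : E d → ℝ} (h : HolE n α C f) : 0 ≤ C :=
  (abs_nonneg _).trans (h.abs_le 0)

theorem HolE.continuous {d n : ℕ} {α C : ℝ} {f : E d → ℝ} (h : HolE n α C f) :
    Continuous f := by
  cases n with
  | zero => exact h.1
  | succ n => exact h.2.1.continuous

theorem HolN.mono_const {n : ℕ} {α C D : ℝ} {f : ℝ → ℝ} (h : HolN n α C f) (hCD : C ≤ D) :
    HolN n α D f := by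
  induction n generalizing f with
  | zero =>
    exact ⟨h.1, fun x => (h.2.1 x).trans hCD, fun x y => (h.2.2 x y).trans
      (mul_le_mul_of_nonneg_right hCD (Real.rpow_nonneg (abs_nonneg _) _))⟩
  | succ n ih =>
    obtain ⟨h1, f', h2, h3⟩ := h
    exact ⟨fun x => (h1 x).trans hCD, f', h2, ih h3⟩

theorem HolN.add {n : ℕ} {α C D : ℝ} {f g : ℝ → ℝ} (hf : HolN n α C f) (hg : HolN n α D g) :
    HolN n α (C + D) fun x => f x + g x := by
  induction n generalizing f g with
  | zero =>
    refine ⟨hf.1.add hg.1, fun x => (abs_add_le _ _).trans (add_le_add (hf.2.1 x) (hg.2.1 x)),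
      fun x y => ?_⟩
    rw [add_sub_add_comm, add_mul]
    exact (abs_add_le _ _).trans (add_le_add (hf.2.2 x y) (hg.2.2 x y))
  | succ n ih =>
    obtain ⟨h1, f', h2, h3⟩ := hf
    obtain ⟨k1, g', k2, k3⟩ := hg
    exact ⟨fun x => (abs_add_le _ _).trans (add_le_add (h1 x) (k1 x)), _,
      fun x => (h2 x).add (k2 x), ih h3 k3⟩

theorem HolN.zero (n : ℕ) (α : ℝ) : HolN n α 0 fun _ => 0 := by
  induction n with
  | zero => exact ⟨continuous_const, by simp, by simp⟩
  | succ n ih => exact ⟨by simp, _, fun x => hasDerivAt_const x 0, ih⟩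

theorem HolN.sum {ι : Type*} (S : Finset ι) {n : ℕ} {α : ℝ} {C : ι → ℝ} {f : ι → ℝ → ℝ}
    (h : ∀ i ∈ S, HolN n α (C i) (f i)) : HolN n α (∑ i ∈ S, C i) fun x => ∑ i ∈ S, f i x := by
  classical
  induction S using Finset.induction_on with
  | empty => simpa using HolN.zero n α
  | insert a S ha ih =>
    simp_rw [Finset.sum_insert ha]
    exact (h a (Finset.mem_insert_self a S)).add
      (ih fun i hi => h i (Finset.mem_insert_of_mem hi))

/-- For t ≥ 1 the trivial bound 2C wins and for t ≤ 1 the power bound does. The point t = 0 is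
separate because 0^0 = 1. -/
theorem le_two_mul_rpow {C t α : ℝ} (hC : 0 ≤ C) (ht : 0 ≤ t) (h0 : 0 ≤ α) {a v : ℝ} (ha : α ≤ a)
    (h1 : v ≤ 2 * C) (h2 : v ≤ C * t ^ a) : v ≤ 2 * C * t ^ α := by
  have hp : 0 ≤ t ^ α := Real.rpow_nonneg ht _
  rcases le_total 1 t with h | h
  · have : 1 ≤ t ^ α := Real.one_le_rpow h h0
    nlinarith
  · rcases ht.eq_or_lt with rfl | ht'
    · rcases h0.eq_or_lt with rfl | h0'
      · simpa using h1
      · rw [Real.zero_rpow (h0'.trans_le ha).ne'] at h2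
        linarith [mul_nonneg (mul_nonneg zero_le_two hC) hp]
    · have : t ^ a ≤ t ^ α := Real.rpow_le_rpow_of_exponent_ge ht' h ha
      nlinarith

theorem abs_sub_le_of_hasDerivAt {f f' : ℝ → ℝ} {C : ℝ} (hf : ∀ x, HasDerivAt f (f' x) x)
    (hC : ∀ x, |f' x| ≤ C) (x y : ℝ) : |f x - f y| ≤ C * |x - y| :=
  Convex.norm_image_sub_le_of_norm_hasDerivWithin_le (s := Set.univ)
    (fun t _ => (hf t).hasDerivWithinAt) (fun t _ => hC t) convex_univ
    (Set.mem_univ _) (Set.mem_univ _)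

theorem HolN.lower_exponent {n : ℕ} {a α C : ℝ} {f : ℝ → ℝ} (h : HolN n a C f) (h0 : 0 ≤ α)
    (ha : α ≤ a) : HolN n α (2 * C) f := by
  have hC := h.nonneg
  induction n generalizing f with
  | zero =>
    refine ⟨h.1, fun x => (h.2.1 x).trans (by linarith), fun x y => ?_⟩
    refine le_two_mul_rpow hC (abs_nonneg _) h0 ha ?_ (h.2.2 x y)
    exact (abs_sub _ _).trans (by linarith [h.2.1 x, h.2.1 y])
  | succ n ih =>
    obtain ⟨h1, f', h2, h3⟩ := h
    exact ⟨fun x => (h1 x).trans (by linarith), f', h2, ih h3⟩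

/-- The derivative that becomes the top one is bounded and Lipschitz, hence α-Hölder for every α ≤
1. -/
theorem HolN.lower_order {n : ℕ} {a α C : ℝ} {f : ℝ → ℝ} (h : HolN (n + 1) a C f) (h0 : 0 ≤ α)
    (h1 : α ≤ 1) (h2 : n = 0 ∨ α = a) : HolN n α (2 * C) f := by
  have hC := h.nonneg
  induction n generalizing f with
  | zero =>
    obtain ⟨k1, f', k2, k3⟩ := h
    have hc : Continuous f := continuous_iff_continuousAt.2 fun x => (k2 x).continuousAt
    refine ⟨hc, fun x => (k1 x).trans (by linarith), fun x y => ?_⟩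
    have e1 : |f x - f y| ≤ 2 * C := (abs_sub _ _).trans (by linarith [k1 x, k1 y])
    have e2 := abs_sub_le_of_hasDerivAt k2 k3.2.1 x y
    exact le_two_mul_rpow hC (abs_nonneg _) h0 h1 e1 (by rwa [Real.rpow_one])
  | succ n ih =>
    obtain ⟨k1, f', k2, k3⟩ := h
    have : α = a := by simpa using h2
    exact ⟨fun x => (k1 x).trans (by linarith), f', k2, ih k3 (Or.inr this)⟩

/-- Hölder classes decrease with the regularity. -/
theorem HolN.mono {n k : ℕ} {a α C : ℝ} {f : ℝ → ℝ} (h : HolN n a C f) (ha0 : 0 ≤ a) (ha : a < 1)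
    (h0 : 0 ≤ α) (h1 : α < 1) (hk : (k : ℝ) + α ≤ n + a) : HolN k α (2 ^ (n + 1) * C) f := by
  have hC := h.nonneg
  induction n generalizing f C with
  | zero =>
    have hk0 : k = 0 := by
      have : (k : ℝ) < 1 := by push_cast at hk; linarith
      have : k < 1 := by exact_mod_cast this
      omega
    subst hk0
    refine (h.lower_exponent h0 (by simpa using hk)).mono_const (by simp)
  | succ n ih =>
    have hp : (1 : ℝ) ≤ 2 ^ (n + 1) := one_le_pow₀ one_le_two
    have hp2 : 2 * C ≤ 2 ^ (n + 1 + 1) * C := by rw [pow_succ]; nlinarith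
    rcases lt_trichotomy k (n + 1) with hlt | heq | hgt
    · rcases (Nat.lt_succ_iff.1 hlt).eq_or_lt with heq | hlt'
      · have h3 : HolN n (if n = 0 then α else a) (2 * C) f := by
          refine h.lower_order ?_ ?_ ?_ <;> split_ifs <;> first | linarith | tauto
        subst heq
        by_cases hk0 : k = 0
        · rw [if_pos hk0] at h3
          exact h3.mono_const hp2
        · obtain ⟨m, rfl⟩ := Nat.exists_eq_succ_of_ne_zero hk0
          clear h3 ih
          -- The orders differ by one and α may exceed a, so lowering the exponent is not enough;
          -- the Lipschitz bound on the new top derivative is used instead.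
          have key : ∀ (m : ℕ) (f : ℝ → ℝ), HolN (m + 1) a C f → HolN m α (2 * C) f := by
            intro m
            induction m with
            | zero => exact fun f hf => hf.lower_order h0 h1.le (Or.inl rfl)
            | succ m ihm =>
              rintro f ⟨k1, f', k2, k3⟩
              exact ⟨fun x => (k1 x).trans (by linarith), f', k2, ihm f' k3⟩
          exact (key _ f h).mono_const hp2
      · have h3 : HolN n a (2 * C) f := h.lower_order ha0 ha.le (Or.inr rfl)
        have hk' : (k : ℝ) + α ≤ n + a := by
          have : (k : ℝ) + 1 ≤ n := by exact_mod_cast hlt'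
          linarith
        refine (ih h3 hk' (by linarith)).mono_const (le_of_eq ?_)
        rw [pow_succ 2 (n + 1)]; ring
    · subst heq
      exact (h.lower_exponent h0 (by linarith)).mono_const hp2
    · exfalso
      have : ((n + 1 : ℕ) : ℝ) + 1 ≤ k := by exact_mod_cast hgt
      linarith

/-- In the product rule each of the two terms pairs a derivative with a factor lowered by one order,
which doubles its constant; this accounts for the 4 per derivative. -/
theorem HolN.mul {n : ℕ} {α C D : ℝ} {f g : ℝ → ℝ} (h0 : 0 ≤ α) (h1 : α ≤ 1)
    (hf : HolN n α C f) (hg : HolN n α D g) :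
    HolN n α (2 * 4 ^ n * (C * D)) fun x => f x * g x := by
  have hC := hf.nonneg
  have hD := hg.nonneg
  induction n generalizing f g C D with
  | zero =>
    refine ⟨hf.1.mul hg.1, fun x => ?_, fun x y => ?_⟩
    · rw [abs_mul]
      have := mul_le_mul (hf.2.1 x) (hg.2.1 x) (abs_nonneg _) hC
      nlinarith [mul_nonneg hC hD]
    · have e : f x * g x - f y * g y = (f x - f y) * g x + f y * (g x - g y) := by ring
      have e1 := mul_le_mul (hf.2.2 x y) (hg.2.1 x) (abs_nonneg _)
        (mul_nonneg hC (Real.rpow_nonneg (abs_nonneg (x - y)) α))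
      have e2 := mul_le_mul (hf.2.1 y) (hg.2.2 x y) (abs_nonneg _) hC
      rw [e]
      refine (abs_add_le _ _).trans ?_
      rw [abs_mul, abs_mul]
      refine (add_le_add e1 e2).trans (le_of_eq (by ring))
  | succ n ih =>
    have hp : (1 : ℝ) ≤ 4 ^ (n + 1) := one_le_pow₀ (by norm_num)
    have lower : ∀ {f : ℝ → ℝ} {C : ℝ}, HolN (n + 1) α C f → HolN n α (2 * C) f :=
      fun h => h.lower_order h0 h1 (Or.inr rfl)
    have hf' := lower hf
    have hg' := lower hg
    obtain ⟨a1, f', a2, a3⟩ := hf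
    obtain ⟨b1, g', b2, b3⟩ := hg
    refine ⟨fun x => ?_, fun x => f' x * g x + f x * g' x, fun x => (a2 x).mul (b2 x), ?_⟩
    · rw [abs_mul]
      have := mul_le_mul (a1 x) (b1 x) (abs_nonneg _) hC
      nlinarith [mul_nonneg hC hD]
    · refine ((ih a3 hg' hC (by linarith)).add (ih hf' b3 (by linarith) hD)).mono_const
        (le_of_eq ?_)
      rw [pow_succ]; ring

/-! ### Composition with curves -/

theorem eq_sum_single {p : ℕ} (v : E p) : v = ∑ i, v i • (EuclideanSpace.single i 1 : E p) := by
  ext k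
  simp [Pi.single_apply]

theorem norm_le_sum_abs {p : ℕ} (v : E p) : ‖v‖ ≤ ∑ i, |v i| := by
  conv_lhs => rw [eq_sum_single v]
  refine (norm_sum_le _ _).trans (Finset.sum_le_sum fun i _ => ?_)
  rw [norm_smul]
  simp

theorem fderiv_apply_eq_sum {p : ℕ} (f : E p → ℝ) (x v : E p) :
    fderiv ℝ f x v = ∑ i, partialD i f x * v i := by
  conv_lhs => rw [eq_sum_single v]
  rw [map_sum]
  refine Finset.sum_congr rfl fun i _ => ?_
  rw [map_smul, smul_eq_mul, mul_comm]; rfl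

/-- By the chain rule (g∘c)' = ∑ ∂_i g(c) c_i', so induction applies to each ∂_i g. The Lipschitz
bound on c is a separate hypothesis because at order zero an α-Hölder curve would only give the
exponent α². -/
theorem HolE.exists_comp {p : ℕ} (k : ℕ) : ∀ {α C B : ℝ}, 0 ≤ α → α ≤ 1 → 0 ≤ B →
    ∃ Γ, ∀ (g : E p → ℝ) (c : ℝ → E p), HolE k α C g → (∀ i, HolN k α B fun s => c s i) →
      (∀ i x y, |c x i - c y i| ≤ B * |x - y|) → HolN k α Γ fun s => g (c s) := by
  induction k with
  | zero =>
    intro α C B h0 h1 hB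
    refine ⟨max C (C * (p * B) ^ α), fun g c hg hc hl => ?_⟩
    have hcc : Continuous c := by
      have : Continuous fun s => WithLp.toLp 2 fun i => c s i :=
        (PiLp.continuous_toLp 2 _).comp (continuous_pi fun i => (hc i).continuous)
      simpa using this
    refine ⟨hg.continuous.comp hcc, fun x => (hg.abs_le _).trans (le_max_left _ _), fun x y => ?_⟩
    have e1 : ‖c x - c y‖ ≤ p * B * |x - y| := by
      refine (norm_le_sum_abs _).trans ?_
      refine (Finset.sum_le_card_nsmul _ _ (B * |x - y|) fun i _ => ?_).trans (le_of_eq ?_)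
      · simpa using hl i x y
      · simp [mul_assoc]
    refine (hg.2.2 _ _).trans ?_
    have e2 : ‖c x - c y‖ ^ α ≤ (p * B) ^ α * |x - y| ^ α := by
      rw [← Real.mul_rpow (by positivity) (abs_nonneg _)]
      exact Real.rpow_le_rpow (norm_nonneg _) e1 h0
    calc C * ‖c x - c y‖ ^ α ≤ C * ((p * B) ^ α * |x - y| ^ α) :=
          mul_le_mul_of_nonneg_left e2 hg.nonneg
      _ = C * (p * B) ^ α * |x - y| ^ α := by ring
      _ ≤ _ := mul_le_mul_of_nonneg_right (le_max_right _ _) (Real.rpow_nonneg (abs_nonneg _) _)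
  | succ k ih =>
    intro α C B h0 h1 hB
    obtain ⟨Γ, hΓ⟩ := ih (C := C) (B := 2 * B) h0 h1 (by linarith)
    refine ⟨max C (∑ _i : Fin p, 2 * 4 ^ k * (Γ * B)), fun g c hg hc hl => ?_⟩
    have hc' : ∀ i, HolN k α (2 * B) fun s => c s i :=
      fun i => (hc i).lower_order h0 h1 (Or.inr rfl)
    have hl' : ∀ i x y, |c x i - c y i| ≤ 2 * B * |x - y| := fun i x y =>
      (hl i x y).trans (by nlinarith [mul_nonneg hB (abs_nonneg (x - y))])
    choose hb dc hd hcd using hc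
    have hcder : ∀ s, HasDerivAt c (WithLp.toLp 2 fun i => dc i s) s := by
      intro s
      have h := (hasDerivAt_pi (φ := fun s i => c s i) (φ' := fun i => dc i s)).2
        fun i => hd i s
      have h2 := (PiLp.continuousLinearEquiv 2 ℝ fun _ : Fin p => ℝ).symm.hasFDerivAt
        (x := fun i => c s i) |>.comp_hasDerivAt s h
      simpa [Function.comp_def] using h2
    refine ⟨fun x => (hg.abs_le _).trans (le_max_left _ _),
      fun s => ∑ i, partialD i g (c s) * dc i s, fun s => ?_, ?_⟩
    · have h := (hg.2.1 (c s)).hasFDerivAt.comp_hasDerivAt s (hcder s)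
      rw [fderiv_apply_eq_sum] at h
      exact h
    · refine HolN.mono_const (HolN.sum Finset.univ fun i _ => ?_) (le_max_right _ _)
      exact (hΓ _ c (hg.2.2 i) hc' hl').mul h0 h1 (hcd i)

/-- Restriction of a function to a line parallel to a coordinate axis. -/
theorem HolE.slice {d n : ℕ} {α C : ℝ} {f : E d → ℝ} (h : HolE n α C f) (u : E d) (i : Fin d) :
    HolN n α C fun s => f (u + s • EuclideanSpace.single i 1) := by
  induction n generalizing f with
  | zero =>
    refine ⟨h.1.comp (by fun_prop), fun x => h.2.1 _, fun x y => (h.2.2 _ _).trans (le_of_eq ?_)⟩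
    rw [add_sub_add_left_eq_sub, ← sub_smul, norm_smul]
    simp
  | succ n ih =>
    refine ⟨fun x => h.1 _, fun s => partialD i f (u + s • EuclideanSpace.single i 1),
      fun s => ?_, ih (h.2.2 i)⟩
    have h1 : HasDerivAt (fun s : ℝ => u + s • (EuclideanSpace.single i 1 : E d))
        (EuclideanSpace.single i 1) s := by
      simpa using ((hasDerivAt_id s).smul_const (EuclideanSpace.single i 1 : E d)).const_add u
    exact (h.2.1 _).hasFDerivAt.comp_hasDerivAt s h1

theorem HolE.abs_sub_le {p n : ℕ} {α C : ℝ} {f : E p → ℝ} (h : HolE (n + 1) α C f) (x y : E p) :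
    |f x - f y| ≤ p * C * ‖x - y‖ := by
  refine Convex.norm_image_sub_le_of_norm_hasFDerivWithin_le (𝕜 := ℝ) (s := Set.univ)
    (fun z _ => (h.2.1 z).hasFDerivAt.hasFDerivWithinAt) (fun z _ => ?_) convex_univ
    (Set.mem_univ _) (Set.mem_univ _)
  have hC := h.nonneg
  refine ContinuousLinearMap.opNorm_le_bound _ (by positivity) fun v => ?_
  rw [fderiv_apply_eq_sum]
  refine (norm_sum_le _ _).trans ?_
  refine (Finset.sum_le_card_nsmul _ _ (C * ‖v‖) fun i _ => ?_).trans (le_of_eq ?_)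
  · rw [norm_mul]
    exact mul_le_mul ((h.2.2 i).abs_le z) (PiLp.norm_apply_le v i) (norm_nonneg _) hC
  · simp [mul_assoc]

/-! ### Words of partial derivatives -/

/-- The iterated partial derivative along a word of coordinates. -/
def wordD {d : ℕ} (w : List (Fin d)) (f : E d → ℝ) : E d → ℝ := w.foldr partialD f

theorem ContDiff.partialD {d : ℕ} {n : ℕ} {f : E d → ℝ} (hf : ContDiff ℝ (n + 1 : ℕ) f)
    (i : Fin d) : ContDiff ℝ n (partialD i f) := by
  have : ContDiff ℝ n (fderiv ℝ f) := hf.fderiv_right (by norm_cast)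
  exact this.clm_apply contDiff_const

theorem ContDiff.wordD {d : ℕ} (w : List (Fin d)) {n : ℕ} {f : E d → ℝ}
    (hf : ContDiff ℝ (n + w.length : ℕ) f) : ContDiff ℝ n (wordD w f) := by
  induction w generalizing n with
  | nil => simpa [HatPer.wordD] using hf
  | cons a w ih =>
    have : ContDiff ℝ (n + 1 : ℕ) (HatPer.wordD w f) := ih (n := n + 1) (by
      simpa [add_assoc, add_comm, add_left_comm] using hf)
    exact ContDiff.partialD this a

theorem partialD_comm {d : ℕ} {f : E d → ℝ} (hf : ContDiff ℝ 2 f) (i j : Fin d) :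
    partialD i (partialD j f) = partialD j (partialD i f) := by
  funext x
  have h1 : Differentiable ℝ (fderiv ℝ f) :=
    (hf.fderiv_right (m := 1) (by norm_num)).differentiable (by norm_num)
  have h2 : ∀ v w : E d, fderiv ℝ (fun y => fderiv ℝ f y v) x w = fderiv ℝ (fderiv ℝ f) x w v := by
    intro v w
    rw [fderiv_clm_apply (h1 x) (differentiableAt_const v)]
    simp
  have h3 : IsSymmSndFDerivAt ℝ f x := hf.contDiffAt.isSymmSndFDerivAt (by simp)
  change fderiv ℝ (fun y => fderiv ℝ f y _) x _ = fderiv ℝ (fun y => fderiv ℝ f y _) x _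
  rw [h2, h2]
  exact h3 _ _

/-- Symmetry of second derivatives handles a transposition. `holderNorm` sees partial derivatives in
sorted order only, whereas `HolE` takes them in any order; this lemma bridges the two. -/
theorem wordD_perm {d : ℕ} {w w' : List (Fin d)} (h : w.Perm w') {f : E d → ℝ}
    (hf : ContDiff ℝ (w.length : ℕ) f) : wordD w f = wordD w' f := by
  induction h with
  | nil => rfl
  | cons a h ih =>
    have : wordD _ f = wordD _ f := ih (hf.of_le (by simp))
    exact congrArg (partialD a) this
  | swap a b l =>
    have : ContDiff ℝ (2 : ℕ) (wordD l f) := ContDiff.wordD l (by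
      simpa [add_comm, add_left_comm, one_add_one_eq_two] using hf)
    exact partialD_comm this b a
  | trans h1 h2 ih1 ih2 => rw [ih1 hf, ih2 (by rwa [← h1.length_eq])]

/-- The sorted word of a multi-index. -/
def multiWord {d : ℕ} (ν : Fin d → ℕ) : List (Fin d) :=
  (List.finRange d).flatMap fun i => List.replicate (ν i) i

theorem foldr_replicate_partialD {d : ℕ} (i : Fin d) (n : ℕ) (f : E d → ℝ) :
    (List.replicate n i).foldr partialD f = (partialD i)^[n] f := by
  induction n with
  | zero => rfl
  | succ n ih => rw [List.replicate_succ, List.foldr_cons, ih, Function.iterate_succ_apply']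

theorem multiD_eq {d : ℕ} (ν : Fin d → ℕ) (f : E d → ℝ) : multiD ν f = wordD (multiWord ν) f := by
  rw [multiD, wordD, multiWord, List.foldr_flatMap]
  simp_rw [foldr_replicate_partialD]

theorem count_multiWord {d : ℕ} (ν : Fin d → ℕ) (i : Fin d) : (multiWord ν).count i = ν i := by
  rw [multiWord, List.count_flatMap]
  have : (List.count i ∘ fun j : Fin d => List.replicate (ν j) j) =
      fun j => if j = i then ν i else 0 := by
    funext j
    simp only [Function.comp_apply, List.count_replicate, beq_iff_eq]
    split_ifs with h
    · rw [h]
    · rfl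
  rw [this, ← List.ofFn_eq_map, List.sum_ofFn]
  simp

theorem exists_multi_of_word {d : ℕ} (w : List (Fin d)) :
    ∃ ν ∈ Finset.piAntidiag (Finset.univ : Finset (Fin d)) w.length, w.Perm (multiWord ν) := by
  have hp : w.Perm (multiWord fun i => w.count i) :=
    List.perm_iff_count.2 fun i => (count_multiWord (fun i => w.count i) i).symm
  refine ⟨fun i => w.count i, ?_, hp⟩
  rw [Finset.mem_piAntidiag]
  refine ⟨?_, fun i _ => Finset.mem_univ i⟩
  have h := hp.length_eq
  rw [multiWord, List.length_flatMap] at h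
  rw [h, ← List.ofFn_eq_map, List.sum_ofFn]
  simp

theorem HolE.of_words {d n : ℕ} {α C : ℝ} {f : E d → ℝ} (hf : ContDiff ℝ n f)
    (h1 : ∀ w : List (Fin d), w.length ≤ n → ∀ x, |wordD w f x| ≤ C)
    (h2 : ∀ w : List (Fin d), w.length = n → ∀ x y,
      |wordD w f x - wordD w f y| ≤ C * ‖x - y‖ ^ α) : HolE n α C f := by
  induction n generalizing f with
  | zero => exact ⟨hf.continuous, h1 [] le_rfl, h2 [] rfl⟩
  | succ n ih =>
    refine ⟨h1 [] (Nat.zero_le _), hf.differentiable (by simp), fun i =>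
      ih (ContDiff.partialD hf i) (fun w hw x => ?_) fun w hw x y => ?_⟩
    · have := h1 (w ++ [i]) (by simpa using hw) x
      rwa [wordD, List.foldr_append] at this
    · have := h2 (w ++ [i]) (by simpa using hw) x y
      rwa [wordD, List.foldr_append] at this

/-- Functions with finite Hölder norm belong to the quantitative Hölder class. -/
theorem HolE.of_holderNorm {d : ℕ} {s R : ℝ} (hs : 0 ≤ s) (hR : 0 ≤ R) {f : E d → ℝ}
    (hf : ContDiff ℝ ⌊s⌋₊ f) (h : holderNorm s f ≤ ENNReal.ofReal R) :
    HolE ⌊s⌋₊ (s - ⌊s⌋₊) R f := by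
  have hα : 0 ≤ s - ⌊s⌋₊ := sub_nonneg.2 (Nat.floor_le hs)
  refine HolE.of_words hf (fun w hw x => ?_) fun w hw x y => ?_
  · obtain ⟨ν, hν, hp⟩ := exists_multi_of_word w
    rw [wordD_perm hp (hf.of_le (by exact_mod_cast hw)), ← multiD_eq]
    have h3 : ‖multiD ν f x‖ₑ ≤ ENNReal.ofReal R := by
      refine le_trans ?_ (le_trans le_self_add h)
      refine le_trans ?_ (Finset.single_le_sum (f := fun n =>
        ∑ ν ∈ Finset.piAntidiag (Finset.univ : Finset (Fin d)) n, ⨆ x, ‖multiD ν f x‖ₑ)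
        (fun _ _ => zero_le) (Finset.mem_range.2 (Nat.lt_succ_of_le hw)))
      refine le_trans ?_ (Finset.single_le_sum (f := fun ν => ⨆ x, ‖multiD ν f x‖ₑ)
        (fun _ _ => zero_le) hν)
      exact le_iSup (fun x => ‖multiD ν f x‖ₑ) x
    rwa [Real.enorm_eq_ofReal_abs, ENNReal.ofReal_le_ofReal_iff hR] at h3
  · obtain ⟨ν, hν, hp⟩ := exists_multi_of_word w
    rw [wordD_perm hp (hf.of_le (by exact_mod_cast hw.le)), ← multiD_eq]
    by_cases hxy : x = y
    · subst hxy
      simp only [sub_self, abs_zero]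
      exact mul_nonneg hR (Real.rpow_nonneg (norm_nonneg _) _)
    rw [hw] at hν
    have h3 : ENNReal.ofReal (|multiD ν f x - multiD ν f y| / min 1 (‖x - y‖ ^ (s - ⌊s⌋₊))) ≤
        ENNReal.ofReal R := by
      refine le_trans ?_ (le_trans le_add_self h)
      refine le_trans ?_ (Finset.single_le_sum
        (f := fun ν => holderSemi (s - ⌊s⌋₊) (multiD ν f)) (fun _ _ => zero_le) hν)
      rw [holderSemi]
      exact le_iSup_of_le x (le_iSup_of_le y (le_iSup_of_le hxy le_rfl))
    rw [ENNReal.ofReal_le_ofReal_iff hR] at h3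
    have hpos : 0 < ‖x - y‖ ^ (s - ⌊s⌋₊) :=
      Real.rpow_pos_of_pos (norm_pos_iff.2 (sub_ne_zero.2 hxy)) _
    rw [div_le_iff₀ (lt_min one_pos hpos)] at h3
    exact h3.trans (mul_le_mul_of_nonneg_left (min_le_right _ _) hR)

/-! ### Wavelet coefficients of functions of one variable -/

theorem HolN.exists_derivs {n : ℕ} {α C : ℝ} {f : ℝ → ℝ} (h : HolN n α C f) :
    ∃ F : ℕ → ℝ → ℝ, F 0 = f ∧ (∀ m < n, ∀ x, HasDerivAt (F m) (F (m + 1) x) x) ∧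
      ∀ x y, |F n x - F n y| ≤ C * |x - y| ^ α := by
  induction n generalizing f with
  | zero => exact ⟨fun _ => f, rfl, by simp, h.2.2⟩
  | succ n ih =>
    obtain ⟨h1, f', h2, h3⟩ := h
    obtain ⟨F, rfl, hF1, hF2⟩ := ih h3
    refine ⟨fun m => Nat.casesOn m f F, rfl, ?_, hF2⟩
    rintro (_ | m) hm x
    · exact h2 x
    · exact hF1 m (by omega) x

/-- Decay of the coefficients of a Hölder function against a function with vanishing moments. -/
theorem VanishesOff.abs_coeff_le {R : ℝ} {ψ : ℝ → ℝ} (hv : VanishesOff R ψ) (hc : Continuous ψ)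
    {n : ℕ} (hm : ∀ m ≤ n, ∫ x, x ^ m * ψ x = 0) {α C : ℝ} (hα : 0 ≤ α) {g : ℝ → ℝ}
    (hg : HolN n α C g) (hp : ∀ t, g (t + 1) = g t) (j : ℕ) (a : ℝ) :
    |∫ t in (0 : ℝ)..1, g t * periodise ψ j (t - a / 2 ^ j)| ≤
      C * (∫ y, |y| ^ (n + α) * |ψ y|) * (2 : ℝ) ^ (-(j : ℝ) * (n + α + 1 / 2)) := by
  have hgc := hg.continuous
  rw [hv.integral_mul_periodise hc hgc hp]
  set h : ℝ := (2 ^ j)⁻¹ with hh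
  have hhpos : 0 < h := by positivity
  have hinv : (2 : ℝ) ^ j * h = 1 := mul_inv_cancel₀ (by positivity)
  set s₀ := a * h with hs₀
  -- Rescaling to unit size about the wavelet centre: t = s₀ + h y with h = 2^{-j}.
  have e1 : ∫ t, g t * ψ (2 ^ j * t - a) = h * ∫ y, g (s₀ + h * y) * ψ y := by
    have h3 := Measure.integral_comp_mul_left (fun y => g (h * y) * ψ (y - a)) ((2 : ℝ) ^ j)
    have h4 := integral_sub_right_eq_self (μ := volume) (fun y => g (s₀ + h * y) * ψ y) a
    rw [← h4]
    have : ∀ y, s₀ + h * (y - a) = h * y := fun y => by rw [hs₀]; ring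
    simp_rw [this]
    have h5 : ∀ x : ℝ, h * (2 ^ j * x) = x := fun x => by rw [← mul_assoc, mul_comm h, hinv, one_mul]
    simp_rw [h5] at h3
    rw [h3, smul_eq_mul, abs_of_pos hhpos]
  obtain ⟨F, rfl, hF1, hF2⟩ := hg.exists_derivs
  have hT := taylor_bound n F hF1 hg.nonneg hα hF2 s₀
  have e2 : ∀ y, F 0 (s₀ + h * y) * ψ y =
      (F 0 (s₀ + h * y) - ∑ i ∈ Finset.range (n + 1), F i s₀ * (h * y) ^ i / i.factorial) * ψ y +
      ∑ i ∈ Finset.range (n + 1), F i s₀ * h ^ i / i.factorial * (y ^ i * ψ y) := by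
    intro y
    rw [sub_mul, Finset.sum_mul]
    have : ∀ i ∈ Finset.range (n + 1), F i s₀ * (h * y) ^ i / i.factorial * ψ y =
        F i s₀ * h ^ i / i.factorial * (y ^ i * ψ y) := fun i _ => by rw [mul_pow]; ring
    rw [Finset.sum_congr rfl this]; ring
  have i1 : Integrable fun y : ℝ => (F 0 (s₀ + h * y) -
      ∑ i ∈ Finset.range (n + 1), F i s₀ * (h * y) ^ i / i.factorial) * ψ y :=
    hv.integrable_mul hc (by fun_prop)
  have i2 : ∀ i ∈ Finset.range (n + 1), Integrable fun y : ℝ =>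
      F i s₀ * h ^ i / i.factorial * (y ^ i * ψ y) := fun i _ =>
    (hv.integrable_mul hc (by fun_prop)).const_mul _
  -- The vanishing moments remove the whole Taylor polynomial.
  have e3 : ∫ y, F 0 (s₀ + h * y) * ψ y = ∫ y, (F 0 (s₀ + h * y) -
      ∑ i ∈ Finset.range (n + 1), F i s₀ * (h * y) ^ i / i.factorial) * ψ y := by
    simp_rw [e2]
    rw [integral_add i1 (integrable_finsetSum _ i2), integral_finsetSum _ i2, Finset.sum_eq_zero,
      add_zero]
    intro i hi
    rw [integral_const_mul, hm i (Nat.lt_succ_iff.1 (Finset.mem_range.1 hi)), mul_zero]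
  have e4 : |∫ y, F 0 (s₀ + h * y) * ψ y| ≤
      C * h ^ (n + α) * ∫ y, |y| ^ (n + α) * |ψ y| := by
    rw [e3, ← integral_const_mul, ← Real.norm_eq_abs]
    have hcont : Continuous fun y : ℝ => |y| ^ (n + α) :=
      continuous_abs.rpow_const fun _ => Or.inr (by positivity)
    refine norm_integral_le_of_norm_le ((hv.abs.integrable_mul hc.abs hcont).const_mul _)
      (Filter.Eventually.of_forall fun y => ?_)
    have h5 := hT (s₀ + h * y)
    simp only [add_sub_cancel_left] at h5
    rw [abs_mul, abs_of_pos hhpos, Real.mul_rpow hhpos.le (abs_nonneg _)] at h5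
    rw [norm_mul, Real.norm_eq_abs, Real.norm_eq_abs]
    calc _ ≤ C * (h ^ (n + α) * |y| ^ (n + α)) * |ψ y| :=
          mul_le_mul_of_nonneg_right h5 (abs_nonneg _)
      _ = _ := by ring
  -- The factors are the L² normalisation 2^{j/2}, the Jacobian h and the Taylor gain h^{n+α}.
  have e5 : (2 : ℝ) ^ ((j : ℝ) / 2) * h * h ^ (n + α) =
      (2 : ℝ) ^ (-(j : ℝ) * (n + α + 1 / 2)) := by
    rw [hh, ← Real.rpow_natCast, ← Real.rpow_neg zero_le_two, ← Real.rpow_mul zero_le_two,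
      ← Real.rpow_add two_pos, ← Real.rpow_add two_pos]
    congr 1; ring
  rw [e1, abs_mul, abs_mul, abs_of_pos hhpos, abs_of_pos (by positivity), ← e5]
  calc _ ≤ (2 : ℝ) ^ ((j : ℝ) / 2) * (h * (C * h ^ (n + α) * ∫ y, |y| ^ (n + α) * |ψ y|)) := by
        gcongr
    _ = _ := by ring

/-! ### Integration over the unit cube -/

/-- The uniform distribution on `[0,1)`. -/
def unifI : Measure ℝ := volume.restrict (Set.Ico 0 1)

instance : IsProbabilityMeasure unifI := ⟨by simp [unifI]⟩

/-- The uniform distribution on `[0,1)^d` in coordinates. -/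
def unifPi (d : ℕ) : Measure (Fin d → ℝ) := Measure.pi fun _ => unifI

instance (d : ℕ) : IsProbabilityMeasure (unifPi d) := by unfold unifPi; infer_instance

theorem unifPi_eq (d : ℕ) :
    unifPi d = (volume : Measure (Fin d → ℝ)).restrict (Set.pi Set.univ fun _ => Set.Ico 0 1) := by
  rw [volume_pi, Measure.restrict_pi_pi]; rfl

theorem measurePreserving_toLp_cube (d : ℕ) :
    MeasurePreserving (WithLp.toLp 2) (unifPi d) (uniformCube d) := by
  have h := (PiLp.volume_preserving_toLp (Fin d)).restrict_preimage (s := unitCube d) ?_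
  · rw [unifPi_eq]
    have e : WithLp.toLp 2 ⁻¹' unitCube d = Set.pi Set.univ fun _ => Set.Ico (0 : ℝ) 1 := by
      ext x
      simp [unitCube, Set.mem_pi]
    rw [e] at h
    exact h
  · have : unitCube d = ⋂ i, {u : E d | u i ∈ Set.Ico (0 : ℝ) 1} := by
      ext u; simp [unitCube]
    rw [this]
    exact MeasurableSet.iInter fun i =>
      measurableSet_Ico.preimage (by fun_prop : Continuous fun u : E d => u i).measurable

instance (d : ℕ) : IsProbabilityMeasure (uniformCube d) := by
  have h := measurePreserving_toLp_cube d
  rw [← h.map_eq]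
  exact Measure.isProbabilityMeasure_map h.measurable.aemeasurable

theorem integral_uniformCube {d : ℕ} (F : E d → ℝ) :
    ∫ u, F u ∂(uniformCube d) = ∫ x, F (WithLp.toLp 2 x) ∂(unifPi d) :=
  ((measurePreserving_toLp_cube d).integral_comp
    (MeasurableEquiv.toLp 2 (Fin d → ℝ)).measurableEmbedding F).symm

theorem integral_uniformCube_prod {d : ℕ} (F : Fin d → ℝ → ℝ) :
    ∫ v : E d, ∏ i, F i (v i) ∂(uniformCube d) = ∏ i, ∫ t, F i t ∂unifI := by
  rw [integral_uniformCube]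
  exact integral_fintype_prod_eq_prod F

theorem integrable_unifPi {d : ℕ} {F : (Fin d → ℝ) → ℝ} (hF : Continuous F) :
    Integrable F (unifPi d) := by
  have h1 : IntegrableOn F (Set.pi Set.univ fun _ : Fin d => Set.Icc (0 : ℝ) 1) volume :=
    hF.continuousOn.integrableOn_compact (isCompact_univ_pi fun _ => isCompact_Icc)
  rw [unifPi_eq]
  exact h1.mono_set (Set.pi_mono fun _ _ => Set.Ico_subset_Icc_self)

theorem integrable_unifI {F : ℝ → ℝ} (hF : Continuous F) : Integrable F unifI :=
  (hF.continuousOn.integrableOn_compact isCompact_Icc).mono_set Set.Ico_subset_Icc_self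

theorem integrable_uniformCube {d : ℕ} {F : E d → ℝ} (hF : Continuous F) :
    Integrable F (uniformCube d) :=
  ((measurePreserving_toLp_cube d).integrable_comp_emb
    (MeasurableEquiv.toLp 2 (Fin d → ℝ)).measurableEmbedding).1
    (integrable_unifPi (F := F ∘ WithLp.toLp 2) (hF.comp (PiLp.continuous_toLp 2 _)))

theorem integral_unifI (F : ℝ → ℝ) : ∫ t, F t ∂unifI = ∫ t in (0 : ℝ)..1, F t := by
  rw [unifI, integral_Ico_eq_integral_Ioc, intervalIntegral.integral_of_le zero_le_one]

/-- Resampling one coordinate independently preserves the product law. This is Fubini for a single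
coordinate without splitting the index set. -/
theorem measurePreserving_update {d : ℕ} (i : Fin d) :
    MeasurePreserving (fun q : (Fin d → ℝ) × ℝ => Function.update q.1 i q.2)
      ((unifPi d).prod unifI) (unifPi d) := by
  classical
  have hm : Measurable fun q : (Fin d → ℝ) × ℝ => Function.update q.1 i q.2 :=
    (continuous_fst.update i continuous_snd).measurable
  refine ⟨hm, ?_⟩
  refine (Measure.pi_eq fun s hs => ?_).symm
  rw [Measure.map_apply hm (MeasurableSet.univ_pi hs)]
  have h1 : (fun q : (Fin d → ℝ) × ℝ => Function.update q.1 i q.2) ⁻¹' Set.pi Set.univ s =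
      (Set.pi Set.univ (Function.update s i Set.univ)) ×ˢ s i := by
    ext ⟨v, t⟩
    simp only [Set.mem_preimage, Set.mem_pi, Set.mem_univ, true_implies, Set.mem_prod]
    constructor
    · intro h
      refine ⟨fun k => ?_, by simpa using h i⟩
      by_cases hk : k = i
      · subst hk; simp
      · simpa [hk] using h k
    · rintro ⟨h2, h3⟩ k
      by_cases hk : k = i
      · subst hk; simpa using h3
      · simpa [hk] using h2 k
  rw [h1, Measure.prod_prod, unifPi, Measure.pi_pi,
    ← Finset.mul_prod_erase _ _ (Finset.mem_univ i),
    ← Finset.mul_prod_erase _ (fun k => unifI (s k)) (Finset.mem_univ i)]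
  rw [Function.update_self, measure_univ, one_mul, mul_comm]
  congr 1
  refine Finset.prod_congr rfl fun k hk => ?_
  rw [Function.update_of_ne (Finset.ne_of_mem_erase hk)]

/-- Integration of one coordinate first. -/
theorem integral_unifPi_update {d : ℕ} (i : Fin d) {F : (Fin d → ℝ) → ℝ} (hF : Continuous F) :
    ∫ v, F v ∂(unifPi d) = ∫ v, ∫ t, F (Function.update v i t) ∂unifI ∂(unifPi d) := by
  have h := measurePreserving_update i
  have hi : Integrable (fun q : (Fin d → ℝ) × ℝ => F (Function.update q.1 i q.2))
      ((unifPi d).prod unifI) := h.integrable_comp_of_integrable (integrable_unifPi hF)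
  rw [← integral_prod (f := fun q : (Fin d → ℝ) × ℝ => F (Function.update q.1 i q.2)) hi]
  conv_lhs => rw [← h.map_eq]
  exact integral_map h.measurable.aemeasurable hF.aestronglyMeasurable

/-- Integrate coordinate i first: that slice is at most ε, and the remaining factors enter through
their L¹ norms. Thus oscillation in a single direction suffices for the decay of a tensor wavelet
coefficient. -/
theorem abs_integral_prod_mul_le {d : ℕ} (i : Fin d) {a : Fin d → ℝ → ℝ}
    (ha : ∀ m, Continuous (a m)) {H : (Fin d → ℝ) → ℝ} (hH : Continuous H) {ε : ℝ}
    (hε : ∀ v, |∫ t, a i t * H (Function.update v i t) ∂unifI| ≤ ε) :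
    |∫ v, (∏ m, a m (v m)) * H v ∂(unifPi d)| ≤
      ε * ∏ m ∈ Finset.univ.erase i, ∫ t, |a m t| ∂unifI := by
  classical
  have hc : Continuous fun v : Fin d → ℝ => (∏ m, a m (v m)) * H v := by fun_prop
  rw [integral_unifPi_update i hc]
  -- The factor at i is replaced by 1, whose integral is 1, so the product formula can still run
  -- over all coordinates.
  set b : Fin d → ℝ → ℝ := fun m => if m = i then fun _ => 1 else fun t => |a m t| with hb
  have hbc : ∀ m, Continuous (b m) := fun m => by
    simp only [hb]; split_ifs
    · exact continuous_const
    · exact (ha m).abs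
  have e1 : ∀ v : Fin d → ℝ,
      ∫ t, (∏ m, a m (Function.update v i t m)) * H (Function.update v i t) ∂unifI =
      (∏ m ∈ Finset.univ.erase i, a m (v m)) * ∫ t, a i t * H (Function.update v i t) ∂unifI := by
    intro v
    rw [← integral_const_mul]
    refine integral_congr_ae (Filter.Eventually.of_forall fun t => ?_)
    simp only
    rw [← Finset.mul_prod_erase _ _ (Finset.mem_univ i), Function.update_self]
    have : ∏ m ∈ Finset.univ.erase i, a m (Function.update v i t m) =
        ∏ m ∈ Finset.univ.erase i, a m (v m) :=
      Finset.prod_congr rfl fun k hk => by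
        rw [Function.update_of_ne (Finset.ne_of_mem_erase hk)]
    rw [this]; ring
  have e2 : ∀ v : Fin d → ℝ, ∏ m, b m (v m) = ∏ m ∈ Finset.univ.erase i, |a m (v m)| := by
    intro v
    rw [← Finset.mul_prod_erase _ _ (Finset.mem_univ i)]
    simp only [hb, if_true, one_mul]
    exact Finset.prod_congr rfl fun k hk => by rw [if_neg (Finset.ne_of_mem_erase hk)]
  have e3 : ∏ m, ∫ t, b m t ∂unifI = ∏ m ∈ Finset.univ.erase i, ∫ t, |a m t| ∂unifI := by
    rw [← Finset.mul_prod_erase _ _ (Finset.mem_univ i)]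
    have : ∫ t, b i t ∂unifI = 1 := by simp [hb]
    rw [this, one_mul]
    exact Finset.prod_congr rfl fun k hk => by simp only [hb, if_neg (Finset.ne_of_mem_erase hk)]
  rw [← e3, ← integral_fintype_prod_eq_prod, ← integral_const_mul, ← Real.norm_eq_abs]
  refine norm_integral_le_of_norm_le
    ((integrable_unifPi (F := fun v => ∏ m, b m (v m)) (by fun_prop)).const_mul ε)
    (Filter.Eventually.of_forall fun v => ?_)
  rw [e1, e2, norm_mul, Real.norm_eq_abs, Finset.abs_prod, mul_comm]
  exact mul_le_mul_of_nonneg_right (hε v) (Finset.prod_nonneg fun _ _ => abs_nonneg _)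

/-! ### Periodic functions -/

theorem IsPeriodic.add_int {d : ℕ} {Y : Type*} {f : E d → Y} (hf : IsPeriodic f)
    (K : Fin d → ℤ) (u : E d) : f (u + WithLp.toLp 2 fun i => (K i : ℝ)) = f u := by
  have h1 : ∀ (S : Finset (Fin d)) (u : E d),
      f (u + ∑ i ∈ S, K i • (EuclideanSpace.single i 1 : E d)) = f u := by
    classical
    intro S
    induction S using Finset.induction_on with
    | empty => simp
    | insert a S ha ih =>
      intro u
      rw [Finset.sum_insert ha, ← add_assoc, ih]
      exact (show Function.Periodic f (EuclideanSpace.single a 1) from fun u => hf u a).zsmul (K a) u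
  rw [← h1 Finset.univ u]
  congr 2
  rw [eq_sum_single (WithLp.toLp 2 fun i => (K i : ℝ))]
  exact Finset.sum_congr rfl fun _ _ => Int.cast_smul_eq_zsmul ℝ _ _

/-- The representative in `[0,1)^d` of a point of the torus. -/
def fractE {d : ℕ} (u : E d) : E d := WithLp.toLp 2 fun i => Int.fract (u i)

theorem fractE_mem {d : ℕ} (u : E d) : fractE u ∈ unitCube d := fun _ =>
  ⟨Int.fract_nonneg _, Int.fract_lt_one _⟩

theorem fractE_eq {d : ℕ} {u : E d} (hu : u ∈ unitCube d) : fractE u = u := by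
  ext i
  exact Int.fract_eq_self.2 (hu i)

theorem IsPeriodic.apply_fractE {d : ℕ} {Y : Type*} {f : E d → Y} (hf : IsPeriodic f) (u : E d) :
    f (fractE u) = f u := by
  rw [← hf.add_int (fun i => ⌊u i⌋) (fractE u)]
  congr 1
  ext i
  simp [fractE]

theorem isPeriodic_comp_fractE {d : ℕ} {Y : Type*} (g : E d → Y) :
    IsPeriodic fun u => g (fractE u) := by
  intro u i
  simp only
  congr 1
  ext k
  by_cases hk : k = i
  · subst hk; simp [fractE]
  · simp [fractE, hk]

theorem measurable_fractE {d : ℕ} : Measurable (fractE : E d → E d) := by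
  refine (PiLp.continuous_toLp 2 _).measurable.comp (measurable_pi_lambda _ fun i => ?_)
  exact measurable_fract.comp (by fun_prop : Continuous fun u : E d => u i).measurable

theorem ae_mem_unitCube (d : ℕ) : ∀ᵐ u ∂(uniformCube d), u ∈ unitCube d := by
  have : unitCube d = ⋂ i, {u : E d | u i ∈ Set.Ico (0 : ℝ) 1} := by
    ext u; simp [unitCube]
  refine ae_restrict_mem ?_
  rw [this]
  exact MeasurableSet.iInter fun i =>
    measurableSet_Ico.preimage (by fun_prop : Continuous fun u : E d => u i).measurable

/-! ### Tensor products -/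

/-- Expanding ∏(a_i + b_i) gives one term per subset of coordinates, encoded by the binary digits of
l; the induction splits off the lowest digit. -/
theorem sum_testBit_prod {d : ℕ} (a b : Fin d → ℝ) :
    ∑ l ∈ Finset.range (2 ^ d), ∏ i : Fin d, (if l.testBit i then b i else a i) =
      ∏ i, (a i + b i) := by
  induction d with
  | zero => simp
  | succ d ih =>
    rw [pow_succ, mul_comm, sum_range_two_mul, Fin.prod_univ_succ, ← ih, Finset.mul_sum]
    refine Finset.sum_congr rfl fun n _ => ?_
    rw [Fin.prod_univ_succ, Fin.prod_univ_succ]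
    have h1 : ∀ i : Fin d, (2 * n).testBit (i.succ : Fin (d + 1)) = n.testBit i := fun i => by
      rw [Fin.val_succ, Nat.testBit_succ]; congr 1; omega
    have h2 : ∀ i : Fin d, (2 * n + 1).testBit (i.succ : Fin (d + 1)) = n.testBit i := fun i => by
      rw [Fin.val_succ, Nat.testBit_succ]; congr 1; omega
    simp only [h1, h2]
    have h3 : (2 * n).testBit ((0 : Fin (d + 1)) : ℕ) = false := by simp
    have h4 : (2 * n + 1).testBit ((0 : Fin (d + 1)) : ℕ) = true := by simp
    rw [h3, h4]
    simp only [Bool.false_eq_true, if_false, if_true]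
    ring

theorem tensorWavelet_of_lt {d : ℕ} (a b : ℕ → ℝ → ℝ) (j : ℕ) {l : ℕ} (hl : l < 2 ^ d)
    (z : Fin d → ℕ) (u : E d) : tensorWavelet a b j l z u =
      ∏ i : Fin d, (if l.testBit i then b j else a j) (u i - (z i : ℝ) / 2 ^ j) := by
  rw [tensorWavelet, if_neg hl.ne]

theorem tensorWavelet_top {d : ℕ} (a b : ℕ → ℝ → ℝ) (j : ℕ)
    (z : Fin d → ℕ) (u : E d) : tensorWavelet a b j (2 ^ d) z u = if j = 0 ∧ z = 0 then 1 else 0 := by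
  rw [tensorWavelet, if_pos rfl]

theorem zero_mem_positions (d : ℕ) : (0 : Fin d → ℕ) ∈ positions d 0 := by
  simp [positions]
  rfl

theorem sum_positions_ite {d : ℕ} (j : ℕ) (c : ℝ) :
    ∑ z ∈ positions d j, (if j = 0 ∧ z = 0 then c else 0) = if j = 0 then c else 0 := by
  by_cases hj : j = 0
  · subst hj
    simp only [true_and, if_true]
    rw [Finset.sum_ite_eq' (positions d 0) 0, if_pos (zero_mem_positions d)]
  · simp [hj]

theorem card_positions (d j : ℕ) : (positions d j).card = (2 ^ j) ^ d := by
  simp [positions]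

/-- Used with n = 2^d, to exchange the pure scaling index l = 0 for the index l = 2^d of the
constant function. -/
theorem sum_Icc_add_zero (F : ℕ → ℝ) (n : ℕ) :
    ∑ l ∈ Finset.Icc 1 n, F l + F 0 = ∑ l ∈ Finset.range n, F l + F n := by
  rw [← Finset.sum_range_succ, Finset.sum_range_succ']
  congr 1
  rw [Finset.range_eq_Ico, Finset.sum_Ico_add' F 0 n 1]
  congr 1

/-! ### The periodised wavelet system on the torus -/

section
variable {M : ℕ} {φ : ℝ → ℝ} {d : ℕ}

/-- The one-dimensional factors of the tensor wavelets are continuous. -/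
theorem IsDaubechies.continuous_factor (hφ : IsDaubechies M φ) (hc : Continuous φ) (j : ℕ)
    (b : Bool) :
    Continuous (if b then periodise (waveletOf (2 * M - 1) φ φ) j else periodise φ j) := by
  cases b
  · exact hφ.vanishesOff.continuous_periodise hc j
  · exact hφ.vanishesOff_wavelet.continuous_periodise (IsDaubechies.continuous_wavelet hc _) j

theorem IsDaubechies.continuous_perWavelet (hφ : IsDaubechies M φ) (hc : Continuous φ)
    (j l : ℕ) (z : Fin d → ℕ) : Continuous (perWavelet (2 * M - 1) φ j l z) := by
  unfold perWavelet tensorWavelet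
  by_cases hl : l = 2 ^ d
  · simp only [hl, if_true]; exact continuous_const
  · simp only [hl, if_false]
    refine continuous_finsetProd _ fun i _ => ?_
    exact (hφ.continuous_factor hc j (l.testBit i)).comp (by fun_prop)

theorem IsDaubechies.exists_sum_factor_le (hφ : IsDaubechies M φ) (hc : Continuous φ) :
    ∃ A, 0 < A ∧ ∀ (b : Bool) (j : ℕ) (s : ℝ), ∑ z ∈ Finset.range (2 ^ j),
      |(if b then periodise (waveletOf (2 * M - 1) φ φ) j else periodise φ j) (s - z / 2 ^ j)| ≤
        A * (2 : ℝ) ^ ((j : ℝ) / 2) := by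
  obtain ⟨A, hA, h1⟩ := hφ.vanishesOff.exists_sum_abs_periodise_le hc
  obtain ⟨B, hB, h2⟩ := hφ.vanishesOff_wavelet.exists_sum_abs_periodise_le
    (IsDaubechies.continuous_wavelet hc _)
  refine ⟨max A B, by positivity, fun b j s => ?_⟩
  cases b
  · exact (h1 j s).trans (mul_le_mul_of_nonneg_right (le_max_left _ _) (by positivity))
  · exact (h2 j s).trans (mul_le_mul_of_nonneg_right (le_max_right _ _) (by positivity))

theorem rpow_half_pow (j d : ℕ) :
    ((2 : ℝ) ^ ((j : ℝ) / 2)) ^ d = (2 : ℝ) ^ ((j : ℝ) * (d / 2)) := by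
  rw [← Real.rpow_natCast, ← Real.rpow_mul zero_le_two]
  congr 1; ring

/-- The sum over positions factorises into d one-dimensional sums, each O(2^{j/2}). -/
theorem IsDaubechies.exists_sum_perWavelet_le (hφ : IsDaubechies M φ) (hc : Continuous φ) (d : ℕ) :
    ∃ A, 0 < A ∧ ∀ (j l : ℕ), l ∈ Finset.Icc 1 (2 ^ d) → ∀ u : E d,
      ∑ z ∈ positions d j, |perWavelet (2 * M - 1) φ j l z u| ≤
        A * (2 : ℝ) ^ ((j : ℝ) * (d / 2)) := by
  obtain ⟨A, hA, h⟩ := hφ.exists_sum_factor_le hc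
  refine ⟨max 1 (A ^ d), by positivity, fun j l hl u => ?_⟩
  have hp : (1 : ℝ) ≤ (2 : ℝ) ^ ((j : ℝ) * (d / 2)) :=
    Real.one_le_rpow one_le_two (by positivity)
  rcases (Finset.mem_Icc.1 hl).2.eq_or_lt with rfl | hlt
  · have e : ∀ z ∈ positions d j, |perWavelet (2 * M - 1) φ j (2 ^ d) z u| =
        if j = 0 ∧ z = 0 then 1 else 0 := fun z _ => by
      rw [perWavelet, tensorWavelet_top]; split_ifs <;> simp
    rw [Finset.sum_congr rfl e, sum_positions_ite]
    have h1 : (1 : ℝ) ≤ max 1 (A ^ d) := le_max_left _ _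
    split_ifs <;> nlinarith
  · have e : ∀ z ∈ positions d j, |perWavelet (2 * M - 1) φ j l z u| =
        ∏ i : Fin d, |(if l.testBit i then periodise (waveletOf (2 * M - 1) φ φ) j
          else periodise φ j) (u i - (z i : ℝ) / 2 ^ j)| := fun z _ => by
      rw [perWavelet, tensorWavelet_of_lt _ _ _ hlt, Finset.abs_prod]
    rw [Finset.sum_congr rfl e, positions, ← Finset.prod_univ_sum (fun _ => Finset.range (2 ^ j))
      fun (i : Fin d) (z : ℕ) => |(if l.testBit i then periodise (waveletOf (2 * M - 1) φ φ) j
          else periodise φ j) (u i - (z : ℝ) / 2 ^ j)|]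
    calc _ ≤ ∏ _i : Fin d, A * (2 : ℝ) ^ ((j : ℝ) / 2) :=
          Finset.prod_le_prod (fun i _ => Finset.sum_nonneg fun _ _ => abs_nonneg _)
            fun i _ => h _ j _
      _ = A ^ d * (2 : ℝ) ^ ((j : ℝ) * (d / 2)) := by
          rw [Finset.prod_const, Finset.card_univ, Fintype.card_fin, mul_pow, rpow_half_pow]
      _ ≤ _ := mul_le_mul_of_nonneg_right (le_max_right _ _) (by positivity)

theorem IsDaubechies.integral_abs_factor_le (hφ : IsDaubechies M φ) (hc : Continuous φ) :
    ∃ B, 0 < B ∧ ∀ (b : Bool) (j : ℕ) (a : ℝ), ∫ t,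
      |(if b then periodise (waveletOf (2 * M - 1) φ φ) j else periodise φ j) (t - a / 2 ^ j)|
        ∂unifI ≤ B * (2 : ℝ) ^ (-(j : ℝ) / 2) := by
  have h1 := hφ.vanishesOff.integral_abs_periodise_le hc
  have h2 := hφ.vanishesOff_wavelet.integral_abs_periodise_le (IsDaubechies.continuous_wavelet hc _)
  have n1 : 0 ≤ ∫ t, |φ t| := integral_nonneg fun _ => abs_nonneg _
  have n2 : 0 ≤ ∫ t, |waveletOf (2 * M - 1) φ φ t| := integral_nonneg fun _ => abs_nonneg _
  refine ⟨(∫ t, |φ t|) + (∫ t, |waveletOf (2 * M - 1) φ φ t|) + 1, by positivity,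
    fun b j a => ?_⟩
  rw [integral_unifI]
  cases b
  · exact (h1 j a).trans (mul_le_mul_of_nonneg_right (by linarith) (by positivity))
  · exact (h2 j a).trans (mul_le_mul_of_nonneg_right (by linarith) (by positivity))

theorem toLp_update {d : ℕ} (v : Fin d → ℝ) (i : Fin d) (t : ℝ) :
    (WithLp.toLp 2 (Function.update v i t) : E d) =
      WithLp.toLp 2 (Function.update v i 0) + t • EuclideanSpace.single i 1 := by
  ext k
  by_cases hk : k = i
  · subst hk; simp
  · simp [hk]

theorem exists_testBit {l d : ℕ} (h0 : l ≠ 0) (h1 : l < 2 ^ d) :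
    ∃ i : Fin d, l.testBit i = true := by
  by_contra h
  push Not at h
  apply h0
  refine Nat.eq_of_testBit_eq fun k => ?_
  rw [Nat.zero_testBit]
  by_cases hk : k < d
  · simpa using h ⟨k, hk⟩
  · exact Nat.testBit_lt_two_pow (h1.trans_le (Nat.pow_le_pow_right two_pos (not_lt.1 hk)))

/-- Decay of the wavelet coefficients of Hölder functions. -/
theorem IsDaubechies.exists_coeff_le (hφ : IsDaubechies M φ) (hc : Continuous φ) (d : ℕ) {n : ℕ}
    (hm : ∀ m ≤ n, ∫ x, x ^ m * waveletOf (2 * M - 1) φ φ x = 0) {α : ℝ} (hα : 0 ≤ α) :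
    ∃ A, 0 < A ∧ ∀ (f : E d → ℝ) (C : ℝ), IsPeriodic f → Continuous f → (∀ u, |f u| ≤ C) →
      (∀ u i, HolN n α C fun s => f (u + s • EuclideanSpace.single i 1)) →
      ∀ j, ∀ l ∈ Finset.Icc 1 (2 ^ d), ∀ z, |coeff (2 * M - 1) φ f j l z| ≤
        A * C * (2 : ℝ) ^ (-(j : ℝ) * (n + α + d / 2)) := by
  obtain ⟨B, hB, hBi⟩ := hφ.integral_abs_factor_le hc
  set I := ∫ y, |y| ^ (n + α) * |waveletOf (2 * M - 1) φ φ y| with hI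
  have hI0 : 0 ≤ I := integral_nonneg fun y => by positivity
  refine ⟨max 1 (I * B ^ (d - 1)), by positivity, fun f C hper hf hfC hsl j l hl z => ?_⟩
  have hC : 0 ≤ C := (abs_nonneg _).trans (hfC 0)
  rcases (Finset.mem_Icc.1 hl).2.eq_or_lt with rfl | hlt
  · rw [coeff]
    simp only [perWavelet, tensorWavelet_top]
    split_ifs with h
    · rw [h.1]
      simp only [mul_one, Nat.cast_zero, neg_zero, zero_mul, Real.rpow_zero]
      have h1 : |∫ u, f u ∂(uniformCube d)| ≤ C := by
        have := norm_integral_le_of_norm_le_const (μ := uniformCube d) (f := f) (C := C)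
          (Filter.Eventually.of_forall hfC)
        simpa using this
      exact h1.trans (le_mul_of_one_le_left hC (le_max_left _ _))
    · simp only [mul_zero, integral_zero, abs_zero]
      positivity
  -- As 1 ≤ l < 2^d, some coordinate carries a wavelet. It supplies the decay 2^{-j(n+α+1/2)}, and
  -- each of the other d - 1 factors supplies 2^{-j/2}.
  · obtain ⟨i, hi⟩ := exists_testBit (by have := (Finset.mem_Icc.1 hl).1; omega) hlt
    set a : Fin d → ℝ → ℝ := fun m t => (if l.testBit m then
      periodise (waveletOf (2 * M - 1) φ φ) j else periodise φ j) (t - (z m : ℝ) / 2 ^ j) with ha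
    have hac : ∀ m, Continuous (a m) := fun m =>
      (hφ.continuous_factor hc j (l.testBit m)).comp (by fun_prop)
    have e1 : coeff (2 * M - 1) φ f j l z =
        ∫ v, (∏ m, a m (v m)) * f (WithLp.toLp 2 v) ∂(unifPi d) := by
      rw [coeff, integral_uniformCube]
      refine integral_congr_ae (Filter.Eventually.of_forall fun v => ?_)
      simp only [perWavelet]
      rw [tensorWavelet_of_lt _ _ _ hlt, mul_comm]
    have hslice : ∀ v : Fin d → ℝ, |∫ t, a i t * f (WithLp.toLp 2 (Function.update v i t)) ∂unifI| ≤
        C * I * (2 : ℝ) ^ (-(j : ℝ) * (n + α + 1 / 2)) := by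
      intro v
      rw [integral_unifI]
      have h2 := hφ.vanishesOff_wavelet.abs_coeff_le (IsDaubechies.continuous_wavelet hc _) hm hα
        (hsl (WithLp.toLp 2 (Function.update v i 0)) i) (fun t => by
          rw [add_smul, one_smul, ← add_assoc]; exact hper _ i) j (z i)
      refine le_trans (le_of_eq ?_) h2
      congr 1
      refine intervalIntegral.integral_congr fun t _ => ?_
      simp only [ha, hi, if_true]
      rw [← toLp_update, mul_comm]
    have h3 := abs_integral_prod_mul_le i hac (H := fun v => f (WithLp.toLp 2 v))
      (hf.comp (PiLp.continuous_toLp 2 _)) hslice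
    rw [← e1] at h3
    refine h3.trans ?_
    have h4 : ∏ m ∈ Finset.univ.erase i, ∫ t, |a m t| ∂unifI ≤
        (B * (2 : ℝ) ^ (-(j : ℝ) / 2)) ^ (d - 1) := by
      calc _ ≤ ∏ m ∈ Finset.univ.erase i, B * (2 : ℝ) ^ (-(j : ℝ) / 2) :=
            Finset.prod_le_prod (fun m _ => integral_nonneg fun _ => abs_nonneg _)
              fun m _ => hBi _ j _
        _ = _ := by
            rw [Finset.prod_const, Finset.card_erase_of_mem (Finset.mem_univ i),
              Finset.card_univ, Fintype.card_fin]
    have hd : 1 ≤ d := by have := i.2; omega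
    have e2 : (2 : ℝ) ^ (-(j : ℝ) * (n + α + 1 / 2)) * ((2 : ℝ) ^ (-(j : ℝ) / 2)) ^ (d - 1) =
        (2 : ℝ) ^ (-(j : ℝ) * (n + α + d / 2)) := by
      rw [← Real.rpow_natCast, ← Real.rpow_mul zero_le_two, ← Real.rpow_add two_pos,
        Nat.cast_sub hd]
      congr 1; push_cast; ring
    calc _ ≤ C * I * (2 : ℝ) ^ (-(j : ℝ) * (n + α + 1 / 2)) *
          (B * (2 : ℝ) ^ (-(j : ℝ) / 2)) ^ (d - 1) :=
          mul_le_mul_of_nonneg_left h4 (by positivity)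
      _ = I * B ^ (d - 1) * C * (2 : ℝ) ^ (-(j : ℝ) * (n + α + d / 2)) := by
          rw [← e2, mul_pow]; ring
      _ ≤ _ := by
          refine mul_le_mul_of_nonneg_right ?_ (by positivity)
          exact mul_le_mul_of_nonneg_right (le_max_right _ _) hC

/-! ### Wavelet expansions -/

/-- Write K_j for the scaling kernel and W_j for the wavelet kernel. Summing over all 0 ≤ l < 2^d
gives ∏(K_j + W_j) = ∏ K_{j+1}; leaving out l = 0 subtracts ∏ K_j, and l = 2^d contributes 1 on
level 0 only. -/
theorem IsDaubechies.sum_level (hφ : IsDaubechies M φ) (hc : Continuous φ) (j : ℕ) (u v : E d) :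
    ∑ l ∈ Finset.Icc 1 (2 ^ d), ∑ z ∈ positions d j,
      perWavelet (2 * M - 1) φ j l z u * perWavelet (2 * M - 1) φ j l z v =
    (if j = 0 then 1 else 0) + ∏ i, perKernel φ (j + 1) (u i) (v i) -
      ∏ i, perKernel φ j (u i) (v i) := by
  set F : ℕ → ℝ := fun l => ∑ z ∈ positions d j,
      perWavelet (2 * M - 1) φ j l z u * perWavelet (2 * M - 1) φ j l z v with hF
  have h1 : ∀ l < 2 ^ d, F l = ∏ i : Fin d, (if l.testBit i then
      perKernel (waveletOf (2 * M - 1) φ φ) j (u i) (v i) else perKernel φ j (u i) (v i)) := by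
    intro l hl
    simp only [hF, perWavelet, tensorWavelet_of_lt _ _ _ hl, ← Finset.prod_mul_distrib]
    rw [positions, ← Finset.prod_univ_sum (fun _ => Finset.range (2 ^ j))
      fun (i : Fin d) (z : ℕ) => (if l.testBit i then periodise (waveletOf (2 * M - 1) φ φ) j
          else periodise φ j) (u i - (z : ℝ) / 2 ^ j) *
        (if l.testBit i then periodise (waveletOf (2 * M - 1) φ φ) j
          else periodise φ j) (v i - (z : ℝ) / 2 ^ j)]
    refine Finset.prod_congr rfl fun i _ => ?_
    split_ifs <;> rfl
  have h2 : F (2 ^ d) = if j = 0 then 1 else 0 := by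
    simp only [hF, perWavelet, tensorWavelet_top]
    rw [← sum_positions_ite (d := d) j 1]
    refine Finset.sum_congr rfl fun z _ => ?_
    split_ifs <;> simp
  have h3 : F 0 = ∏ i, perKernel φ j (u i) (v i) := by
    rw [h1 0 (by positivity)]
    simp
  have h4 : ∑ l ∈ Finset.range (2 ^ d), F l = ∏ i, perKernel φ (j + 1) (u i) (v i) := by
    rw [Finset.sum_congr rfl fun l hl => h1 l (Finset.mem_range.1 hl), sum_testBit_prod]
    exact Finset.prod_congr rfl fun i _ => (hφ.perKernel_succ hc j _ _).symm
  have h5 := sum_Icc_add_zero F (2 ^ d)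
  rw [h2, h3, h4] at h5
  linarith

/-- The levels telescope, and the initial term ∏ K_0 = 1 is balanced by the constant function with
index l = 2^d. -/
theorem IsDaubechies.sum_levels (hφ : IsDaubechies M φ) (hc : Continuous φ) (J : ℕ) (u v : E d) :
    ∑ j ∈ Finset.range (J + 1), ∑ l ∈ Finset.Icc 1 (2 ^ d), ∑ z ∈ positions d j,
      perWavelet (2 * M - 1) φ j l z u * perWavelet (2 * M - 1) φ j l z v =
    ∏ i, perKernel φ (J + 1) (u i) (v i) := by
  induction J with
  | zero =>
    rw [Finset.sum_range_one, hφ.sum_level hc]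
    simp [hφ.perKernel_zero hc]
  | succ J ih =>
    rw [Finset.sum_range_succ, ih, hφ.sum_level hc]
    simp

/-- The partial sum of the wavelet expansion over the levels `j < J`. -/
def partialSum (N : ℕ) (φ : ℝ → ℝ) (f : E d → ℝ) (J : ℕ) (u : E d) : ℝ :=
  ∑ j ∈ Finset.range J, ∑ l ∈ Finset.Icc 1 (2 ^ d), ∑ z ∈ positions d j,
    coeff N φ f j l z * perWavelet N φ j l z u

theorem IsDaubechies.continuous_partialSum (hφ : IsDaubechies M φ) (hc : Continuous φ)
    (f : E d → ℝ) (J : ℕ) : Continuous (partialSum (2 * M - 1) φ f J) := by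
  have := fun j l z => hφ.continuous_perWavelet (d := d) hc j l z
  unfold partialSum
  fun_prop

theorem IsDaubechies.continuous_perKernel (hφ : IsDaubechies M φ) (hc : Continuous φ) (J : ℕ)
    (s : ℝ) : Continuous (perKernel φ J s) := by
  have := hφ.vanishesOff.continuous_periodise hc J
  unfold perKernel
  fun_prop

theorem IsDaubechies.partialSum_eq (hφ : IsDaubechies M φ) (hc : Continuous φ) {f : E d → ℝ}
    (hf : Continuous f) (J : ℕ) (u : E d) : partialSum (2 * M - 1) φ f (J + 1) u =
      ∫ v, f v * ∏ i, perKernel φ (J + 1) (u i) (v i) ∂(uniformCube d) := by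
  have hw := fun j l z => hφ.continuous_perWavelet (d := d) hc j l z
  simp_rw [← hφ.sum_levels hc J u, Finset.mul_sum]
  rw [integral_finsetSum _ fun j _ => integrable_uniformCube (by fun_prop)]
  refine Finset.sum_congr rfl fun j _ => ?_
  rw [integral_finsetSum _ fun j _ => integrable_uniformCube (by fun_prop)]
  refine Finset.sum_congr rfl fun l _ => ?_
  rw [integral_finsetSum _ fun j _ => integrable_uniformCube (by fun_prop)]
  refine Finset.sum_congr rfl fun z _ => ?_
  rw [coeff, ← integral_mul_const]
  congr 1
  funext v
  ring

theorem IsDaubechies.integral_perKernel (hφ : IsDaubechies M φ) (hc : Continuous φ) (J : ℕ)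
    (s : ℝ) : ∫ t, perKernel φ J s t ∂unifI = 1 := by
  have hcp := hφ.vanishesOff.continuous_periodise hc J
  have h1 : ∀ z : ℕ, ∫ t, periodise φ J (t - z / 2 ^ J) ∂unifI = (2 : ℝ) ^ (-(J : ℝ) / 2) := by
    intro z
    have h := hφ.vanishesOff.integral_mul_periodise hc (f := fun _ => 1) continuous_const
      (fun _ => rfl) J z
    simp only [one_mul] at h
    rw [integral_unifI, h, Measure.integral_comp_mul_left (fun x => φ (x - z)) (2 ^ J),
      integral_sub_right_eq_self φ, hφ.integral_eq_one, abs_of_pos (by positivity), smul_eq_mul,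
      mul_one, ← Real.rpow_natCast, ← Real.rpow_neg zero_le_two, ← Real.rpow_add two_pos]
    congr 1; ring
  unfold perKernel
  rw [integral_finsetSum _ fun z _ => integrable_unifI (by fun_prop)]
  simp_rw [integral_const_mul, h1]
  rw [← Finset.sum_mul, hφ.vanishesOff.sum_periodise, hφ.perSum_eq_one hc, mul_one,
    ← Real.rpow_add two_pos]
  simp [neg_div]

/-- An absolute version of the periodised kernel. -/
def absKernel (g : ℝ → ℝ) (j : ℕ) (s t : ℝ) : ℝ :=
  ∑ z ∈ Finset.range (2 ^ j), |periodise g j (s - z / 2 ^ j)| * |periodise g j (t - z / 2 ^ j)|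

theorem abs_perKernel_le (g : ℝ → ℝ) (j : ℕ) (s t : ℝ) : |perKernel g j s t| ≤ absKernel g j s t :=
  (Finset.abs_sum_le_sum_abs _ _).trans (le_of_eq (by simp [absKernel, abs_mul]))

theorem IsDaubechies.exists_integral_absKernel_le (hφ : IsDaubechies M φ) (hc : Continuous φ) :
    ∃ A, 0 < A ∧ ∀ (J : ℕ) (s : ℝ), ∫ t, absKernel φ J s t ∂unifI ≤ A := by
  obtain ⟨A, hA, h1⟩ := hφ.exists_sum_factor_le hc
  obtain ⟨B, hB, h2⟩ := hφ.integral_abs_factor_le hc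
  refine ⟨A * B, by positivity, fun J s => ?_⟩
  have hcp := hφ.vanishesOff.continuous_periodise hc J
  unfold absKernel
  rw [integral_finsetSum _ fun z _ => integrable_unifI (by fun_prop)]
  simp_rw [integral_const_mul]
  calc _ ≤ ∑ z ∈ Finset.range (2 ^ J), |periodise φ J (s - z / 2 ^ J)| *
        (B * (2 : ℝ) ^ (-(J : ℝ) / 2)) :=
        Finset.sum_le_sum fun z _ => mul_le_mul_of_nonneg_left (h2 false J z) (abs_nonneg _)
    _ ≤ A * (2 : ℝ) ^ ((J : ℝ) / 2) * (B * (2 : ℝ) ^ (-(J : ℝ) / 2)) := by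
        rw [← Finset.sum_mul]
        exact mul_le_mul_of_nonneg_right (h1 false J s) (by positivity)
    _ = A * B := by
        rw [mul_mul_mul_comm, ← Real.rpow_add two_pos, neg_div, add_neg_cancel, Real.rpow_zero,
          mul_one]

/-- If both factors are nonzero for one z, then s and t lie modulo 1 within the support length
N2^{-J} to the right of the same point. -/
theorem IsDaubechies.near_of_perKernel_ne_zero (hφ : IsDaubechies M φ) {J : ℕ} {s t : ℝ}
    (h : perKernel φ J s t ≠ 0) :
    ∃ k : ℤ, |s - (t + k)| ≤ ((2 * M - 1 : ℕ) : ℝ) * (1 / 2) ^ J := by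
  obtain ⟨z, -, hz⟩ := Finset.exists_ne_zero_of_sum_ne_zero h
  have key : ∀ x : ℝ, periodise φ J x ≠ 0 →
      ∃ k : ℤ, 0 ≤ x - k ∧ x - k ≤ ((2 * M - 1 : ℕ) : ℝ) * (1 / 2) ^ J := by
    intro x hx
    have h1 : ∑' k : ℤ, φ (2 ^ J * (x - k)) ≠ 0 := right_ne_zero_of_mul hx
    have h2 : ∃ k : ℤ, φ (2 ^ J * (x - k)) ≠ 0 := by
      by_contra hcon
      push Not at hcon
      simp [hcon] at h1
    obtain ⟨k, hk⟩ := h2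
    have hpos : (0 : ℝ) < 2 ^ J := by positivity
    have h3 : ¬(2 ^ J * (x - k) < 0 ∨ ((2 * M - 1 : ℕ) : ℝ) < 2 ^ J * (x - k)) :=
      fun hcon => hk (hφ.eq_zero hcon)
    push Not at h3
    refine ⟨k, nonneg_of_mul_nonneg_right h3.1 hpos, ?_⟩
    rw [one_div, inv_pow, ← div_eq_mul_inv, le_div_iff₀ hpos, mul_comm]
    exact h3.2
  obtain ⟨k, hk1, hk2⟩ := key _ (left_ne_zero_of_mul hz)
  obtain ⟨k', hk1', hk2'⟩ := key _ (right_ne_zero_of_mul hz)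
  refine ⟨k - k', ?_⟩
  rw [abs_le]
  push_cast
  constructor <;> linarith

/-- The product kernel is an approximate identity on the torus: total mass one, bounded L¹ norm, and
concentration at scale 2^{-J}. Continuity of f at u does the rest. -/
theorem IsDaubechies.tendsto_partialSum (hφ : IsDaubechies M φ) (hc : Continuous φ) {f : E d → ℝ}
    (hper : IsPeriodic f) (hf : Continuous f) (u : E d) :
    Filter.Tendsto (fun J => partialSum (2 * M - 1) φ f J u) Filter.atTop (nhds (f u)) := by
  obtain ⟨A, hA, hAi⟩ := hφ.exists_integral_absKernel_le hc
  rw [← Filter.tendsto_add_atTop_iff_nat 1, Metric.tendsto_atTop]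
  intro ε hε
  set ε' := ε / (2 * A ^ d) with hε'
  have hε'pos : 0 < ε' := by positivity
  obtain ⟨ρ, hρ, hρf⟩ := Metric.continuous_iff.1 hf u ε' hε'pos
  have hlim : Filter.Tendsto (fun J : ℕ => (d : ℝ) * (((2 * M - 1 : ℕ) : ℝ) * (1 / 2) ^ (J + 1)))
      Filter.atTop (nhds (d * (((2 * M - 1 : ℕ) : ℝ) * 0))) :=
    (((Filter.tendsto_add_atTop_iff_nat 1).2
      (tendsto_pow_atTop_nhds_zero_of_lt_one (by norm_num) (by norm_num))).const_mul _).const_mul _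
  simp only [mul_zero] at hlim
  obtain ⟨J₀, hJ₀⟩ := Filter.eventually_atTop.1 (hlim.eventually (gt_mem_nhds hρ))
  refine ⟨J₀, fun J hJ => ?_⟩
  have hk := fun s => hφ.continuous_perKernel hc (J + 1) s
  have hak : ∀ s, Continuous (absKernel φ (J + 1) s) := fun s => by
    have := hφ.vanishesOff.continuous_periodise hc (J + 1)
    unfold absKernel
    fun_prop
  have hone : ∫ v, ∏ i, perKernel φ (J + 1) (u i) (v i) ∂(uniformCube d) = 1 := by
    rw [integral_uniformCube_prod fun i t => perKernel φ (J + 1) (u i) t]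
    simp [hφ.integral_perKernel hc]
  have hcont : Continuous fun v : E d => ∏ i, perKernel φ (J + 1) (u i) (v i) :=
    continuous_finsetProd _ fun i _ => (hk (u i)).comp (by fun_prop)
  have hcont' : Continuous fun v : E d => ∏ i, absKernel φ (J + 1) (u i) (v i) :=
    continuous_finsetProd _ fun i _ => (hak (u i)).comp (by fun_prop)
  have e1 : partialSum (2 * M - 1) φ f (J + 1) u - f u =
      ∫ v, (f v - f u) * ∏ i, perKernel φ (J + 1) (u i) (v i) ∂(uniformCube d) := by
    have i1 : Integrable (fun v => f v * ∏ i, perKernel φ (J + 1) (u i) (v i)) (uniformCube d) :=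
      integrable_uniformCube (hf.mul hcont)
    have i2 : Integrable (fun v : E d => f u * ∏ i, perKernel φ (J + 1) (u i) (v i))
      (uniformCube d) := integrable_uniformCube (continuous_const.mul hcont)
    simp_rw [sub_mul]
    rw [integral_sub i1 i2, integral_const_mul, hone, mul_one, hφ.partialSum_eq hc hf]
  have e2 : ∀ v : E d, ‖(f v - f u) * ∏ i, perKernel φ (J + 1) (u i) (v i)‖ ≤
      ε' * ∏ i, absKernel φ (J + 1) (u i) (v i) := by
    intro v
    have hnn : 0 ≤ ∏ i, absKernel φ (J + 1) (u i) (v i) :=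
      Finset.prod_nonneg fun i _ => (abs_nonneg _).trans (abs_perKernel_le φ (J + 1) (u i) (v i))
    by_cases h0 : ∏ i, perKernel φ (J + 1) (u i) (v i) = 0
    · rw [h0, mul_zero, norm_zero]; positivity
    · have h0' := Finset.prod_ne_zero_iff.1 h0
      -- The kernel localises v only modulo ℤ^d; periodicity of f allows v to be replaced by the
      -- translate close to u.
      choose K hK using fun i => hφ.near_of_perKernel_ne_zero (h0' i (Finset.mem_univ i))
      have h1 : |f v - f u| ≤ ε' := by
        rw [← hper.add_int K v]
        refine (hρf _ ?_).le
        rw [dist_comm, dist_eq_norm]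
        refine (norm_le_sum_abs _).trans_lt (lt_of_le_of_lt ?_ (hJ₀ J hJ))
        refine (Finset.sum_le_card_nsmul _ _ _ fun i _ => hK i).trans (le_of_eq ?_)
        simp
      rw [norm_mul, Real.norm_eq_abs, Real.norm_eq_abs]
      refine mul_le_mul h1 ?_ (abs_nonneg _) hε'pos.le
      rw [Finset.abs_prod]
      exact Finset.prod_le_prod (fun _ _ => abs_nonneg _) fun i _ => abs_perKernel_le _ _ _ _
  have e3 : ∫ v, ∏ i, absKernel φ (J + 1) (u i) (v i) ∂(uniformCube d) ≤ A ^ d := by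
    rw [integral_uniformCube_prod fun i t => absKernel φ (J + 1) (u i) t]
    have h1 : ∀ i ∈ (Finset.univ : Finset (Fin d)),
        0 ≤ ∫ t, absKernel φ (J + 1) (u i) t ∂unifI := fun i _ =>
      integral_nonneg fun t => (abs_nonneg _).trans (abs_perKernel_le φ _ _ t)
    refine (Finset.prod_le_prod h1 fun i _ => hAi (J + 1) (u i)).trans (le_of_eq ?_)
    rw [Finset.prod_const, Finset.card_univ, Fintype.card_fin]
  rw [Real.dist_eq, e1, ← Real.norm_eq_abs]
  calc _ ≤ ∫ v, ε' * ∏ i, absKernel φ (J + 1) (u i) (v i) ∂(uniformCube d) :=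
        norm_integral_le_of_norm_le (integrable_uniformCube (continuous_const.mul hcont'))
          (Filter.Eventually.of_forall e2)
    _ ≤ ε' * A ^ d := by
        rw [integral_const_mul]
        exact mul_le_mul_of_nonneg_left e3 hε'pos.le
    _ = ε / 2 := by rw [hε']; field_simp
    _ < ε := half_lt_self hε

theorem sum_Ico_rpow_le {s : ℝ} (hs : 0 < s) (J J' : ℕ) :
    ∑ j ∈ Finset.Ico J J', (2 : ℝ) ^ (-(j : ℝ) * s) ≤
      (1 - (2 : ℝ) ^ (-s))⁻¹ * (2 : ℝ) ^ (-(J : ℝ) * s) := by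
  have h : ∀ j : ℕ, (2 : ℝ) ^ (-(j : ℝ) * s) = ((2 : ℝ) ^ (-s)) ^ j := by
    intro j
    rw [← Real.rpow_natCast, ← Real.rpow_mul zero_le_two]
    congr 1; ring
  simp_rw [h]
  rw [mul_comm, ← div_eq_mul_inv]
  exact geom_sum_Ico_le_of_lt_one (by positivity)
    (Real.rpow_lt_one_of_one_lt_of_neg one_lt_two (by linarith))

theorem one_sub_rpow_pos {s : ℝ} (hs : 0 < s) : 0 < 1 - (2 : ℝ) ^ (-s) :=
  sub_pos.2 (Real.rpow_lt_one_of_one_lt_of_neg one_lt_two (by linarith))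

theorem partialSum_sub (N : ℕ) (f : E d → ℝ) {J J' : ℕ} (h : J ≤ J') (u : E d) :
    partialSum N φ f J' u - partialSum N φ f J u =
      ∑ j ∈ Finset.Ico J J', ∑ l ∈ Finset.Icc 1 (2 ^ d), ∑ z ∈ positions d j,
        coeff N φ f j l z * perWavelet N φ j l z u :=
  (Finset.sum_Ico_eq_sub _ h).symm

/-- The coefficients of `f` decay like those of an `s`-smooth function. -/
def CoeffDecay (N : ℕ) (φ : ℝ → ℝ) (f : E d → ℝ) (s a : ℝ) : Prop :=
  ∀ j, ∀ l ∈ Finset.Icc 1 (2 ^ d), ∀ z ∈ positions d j,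
    |coeff N φ f j l z| ≤ a * (2 : ℝ) ^ (-(j : ℝ) * (s + d / 2))

/-- Level j contributes O(2^{-js}), since 2^{-jd/2} in the coefficients offsets 2^{jd/2} in the sum
over positions; the tail is geometric. -/
theorem IsDaubechies.exists_abs_sub_partialSum_le (hφ : IsDaubechies M φ) (hc : Continuous φ)
    (d : ℕ) {s : ℝ} (hs : 0 < s) : ∃ A, 0 < A ∧ ∀ (f : E d → ℝ) (a : ℝ), IsPeriodic f →
      Continuous f → 0 ≤ a → CoeffDecay (2 * M - 1) φ f s a → ∀ (J : ℕ) (u : E d),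
      |f u - partialSum (2 * M - 1) φ f J u| ≤ A * a * (2 : ℝ) ^ (-(J : ℝ) * s) := by
  obtain ⟨A, hA, h1⟩ := hφ.exists_sum_perWavelet_le hc d
  have hpos := one_sub_rpow_pos hs
  refine ⟨2 ^ d * A * (1 - (2 : ℝ) ^ (-s))⁻¹, by positivity, fun f a hper hf ha hdec J u => ?_⟩
  refine le_of_tendsto (((hφ.tendsto_partialSum hc hper hf u).sub_const _).abs)
    (Filter.eventually_atTop.2 ⟨J, fun J' hJ => ?_⟩)
  rw [partialSum_sub _ _ hJ]
  have h2 : ∀ j ∈ Finset.Ico J J', |∑ l ∈ Finset.Icc 1 (2 ^ d), ∑ z ∈ positions d j,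
      coeff (2 * M - 1) φ f j l z * perWavelet (2 * M - 1) φ j l z u| ≤
      2 ^ d * A * a * (2 : ℝ) ^ (-(j : ℝ) * s) := by
    intro j _
    have h3 : ∀ l ∈ Finset.Icc 1 (2 ^ d), |∑ z ∈ positions d j,
        coeff (2 * M - 1) φ f j l z * perWavelet (2 * M - 1) φ j l z u| ≤
        A * a * (2 : ℝ) ^ (-(j : ℝ) * s) := by
      intro l hl
      calc _ ≤ ∑ z ∈ positions d j, a * (2 : ℝ) ^ (-(j : ℝ) * (s + d / 2)) *
            |perWavelet (2 * M - 1) φ j l z u| := by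
            refine (Finset.abs_sum_le_sum_abs _ _).trans (Finset.sum_le_sum fun z hz => ?_)
            rw [abs_mul]
            exact mul_le_mul_of_nonneg_right (hdec j l hl z hz) (abs_nonneg _)
        _ ≤ a * (2 : ℝ) ^ (-(j : ℝ) * (s + d / 2)) * (A * (2 : ℝ) ^ ((j : ℝ) * (d / 2))) := by
            rw [← Finset.mul_sum]
            exact mul_le_mul_of_nonneg_left (h1 j l hl u) (by positivity)
        _ = A * a * ((2 : ℝ) ^ (-(j : ℝ) * (s + d / 2)) * (2 : ℝ) ^ ((j : ℝ) * (d / 2))) := by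
            ring
        _ = _ := by
            rw [← Real.rpow_add two_pos]
            congr 2; ring
    refine (Finset.abs_sum_le_sum_abs _ _).trans
      ((Finset.sum_le_card_nsmul _ _ _ h3).trans (le_of_eq ?_))
    simp; ring
  refine (Finset.abs_sum_le_sum_abs _ _).trans ((Finset.sum_le_sum h2).trans ?_)
  rw [← Finset.mul_sum]
  calc _ ≤ 2 ^ d * A * a * ((1 - (2 : ℝ) ^ (-s))⁻¹ * (2 : ℝ) ^ (-(J : ℝ) * s)) :=
        mul_le_mul_of_nonneg_left (sum_Ico_rpow_le hs J J') (by positivity)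
    _ = _ := by ring

/-- The remainder of a wavelet expansion is small in the weak sense. -/
theorem IsDaubechies.exists_abs_integral_mul_le (hφ : IsDaubechies M φ) (hc : Continuous φ)
    (d : ℕ) {s κ : ℝ} (hs : 0 < s) (hκ : 0 ≤ κ) : ∃ A, 0 < A ∧ ∀ (f G : E d → ℝ) (a b : ℝ),
      IsPeriodic f → Continuous f → Continuous G → 0 ≤ a → 0 ≤ b → (∀ u, |G u| ≤ b) →
      CoeffDecay (2 * M - 1) φ f s a → CoeffDecay (2 * M - 1) φ G κ b → ∀ J : ℕ,
      |∫ u, G u * (f u - partialSum (2 * M - 1) φ f J u) ∂(uniformCube d)| ≤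
        A * a * b * (2 : ℝ) ^ (-(J : ℝ) * (s + κ)) := by
  obtain ⟨A, hA, h1⟩ := hφ.exists_abs_sub_partialSum_le hc d hs
  have hsκ : 0 < s + κ := by linarith
  have hpos := one_sub_rpow_pos hsκ
  refine ⟨2 ^ d * (1 - (2 : ℝ) ^ (-(s + κ)))⁻¹, by positivity,
    fun f G a b hper hf hG ha hb hGb hdf hdG J => ?_⟩
  have hw := fun j l z => hφ.continuous_perWavelet (d := d) hc j l z
  have hP := fun J => hφ.continuous_partialSum hc f J
  have hterm : ∀ J' ≥ J, |∫ u, G u * (partialSum (2 * M - 1) φ f J' u -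
      partialSum (2 * M - 1) φ f J u) ∂(uniformCube d)| ≤
      2 ^ d * (1 - (2 : ℝ) ^ (-(s + κ)))⁻¹ * a * b * (2 : ℝ) ^ (-(J : ℝ) * (s + κ)) := by
    intro J' hJ
    simp_rw [partialSum_sub _ _ hJ, Finset.mul_sum]
    rw [integral_finsetSum _ fun j _ => integrable_uniformCube (by fun_prop)]
    have h2 : ∀ j ∈ Finset.Ico J J', |∫ u, ∑ l ∈ Finset.Icc 1 (2 ^ d), ∑ z ∈ positions d j,
        G u * (coeff (2 * M - 1) φ f j l z * perWavelet (2 * M - 1) φ j l z u) ∂(uniformCube d)| ≤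
        2 ^ d * a * b * (2 : ℝ) ^ (-(j : ℝ) * (s + κ)) := by
      intro j _
      rw [integral_finsetSum _ fun j _ => integrable_uniformCube (by fun_prop)]
      have h3 : ∀ l ∈ Finset.Icc 1 (2 ^ d), |∫ u, ∑ z ∈ positions d j,
          G u * (coeff (2 * M - 1) φ f j l z * perWavelet (2 * M - 1) φ j l z u)
            ∂(uniformCube d)| ≤ a * b * (2 : ℝ) ^ (-(j : ℝ) * (s + κ)) := by
        intro l hl
        rw [integral_finsetSum _ fun j _ => integrable_uniformCube (by fun_prop)]
        -- Integrating G against a wavelet produces the coefficient of G, so each of the 2^{jd}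
        -- positions contributes a product of two decaying coefficients. The powers of 2^{jd} cancel
        -- and the exponents s and κ add.
        have h4 : ∀ z ∈ positions d j, |∫ u, G u * (coeff (2 * M - 1) φ f j l z *
            perWavelet (2 * M - 1) φ j l z u) ∂(uniformCube d)| ≤
            a * (2 : ℝ) ^ (-(j : ℝ) * (s + d / 2)) * (b * (2 : ℝ) ^ (-(j : ℝ) * (κ + d / 2))) := by
          intro z hz
          simp_rw [mul_left_comm (G _)]
          rw [integral_const_mul, abs_mul]
          exact mul_le_mul (hdf j l hl z hz) (hdG j l hl z hz) (abs_nonneg _) (by positivity)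
        refine (Finset.abs_sum_le_sum_abs _ _).trans
          ((Finset.sum_le_card_nsmul _ _ _ h4).trans (le_of_eq ?_))
        rw [card_positions, nsmul_eq_mul]
        have e : (((2 ^ j) ^ d : ℕ) : ℝ) = (2 : ℝ) ^ ((j : ℝ) * d) := by
          rw [Real.rpow_mul zero_le_two, Real.rpow_natCast, Real.rpow_natCast]; push_cast; rfl
        rw [e]
        calc _ = a * b * ((2 : ℝ) ^ ((j : ℝ) * d) * ((2 : ℝ) ^ (-(j : ℝ) * (s + d / 2)) *
              (2 : ℝ) ^ (-(j : ℝ) * (κ + d / 2)))) := by ring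
          _ = _ := by
            rw [← Real.rpow_add two_pos, ← Real.rpow_add two_pos]
            congr 2; ring
      refine (Finset.abs_sum_le_sum_abs _ _).trans
        ((Finset.sum_le_card_nsmul _ _ _ h3).trans (le_of_eq ?_))
      simp; ring
    refine (Finset.abs_sum_le_sum_abs _ _).trans ((Finset.sum_le_sum h2).trans ?_)
    rw [← Finset.mul_sum]
    calc _ ≤ 2 ^ d * a * b * ((1 - (2 : ℝ) ^ (-(s + κ)))⁻¹ * (2 : ℝ) ^ (-(J : ℝ) * (s + κ))) :=
          mul_le_mul_of_nonneg_left (sum_Ico_rpow_le hsκ J J') (by positivity)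
      _ = _ := by ring
  -- The uniform remainder estimate provides the dominating constant for passing from finite tails
  -- to the full remainder.
  have hlim : Filter.Tendsto (fun J' : ℕ => ∫ u, G u * (partialSum (2 * M - 1) φ f J' u -
      partialSum (2 * M - 1) φ f J u) ∂(uniformCube d)) Filter.atTop
      (nhds (∫ u, G u * (f u - partialSum (2 * M - 1) φ f J u) ∂(uniformCube d))) := by
    refine tendsto_integral_of_dominated_convergence
      (fun _ => b * (A * a + A * a * (2 : ℝ) ^ (-(J : ℝ) * s)))
      (fun J' => (hG.mul ((hP J').sub (hP J))).aestronglyMeasurable) (integrable_const _)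
      (fun J' => Filter.Eventually.of_forall fun u => ?_)
      (Filter.Eventually.of_forall fun u =>
        ((hφ.tendsto_partialSum hc hper hf u).sub_const _).const_mul _)
    rw [norm_mul, Real.norm_eq_abs, Real.norm_eq_abs]
    refine mul_le_mul (hGb u) ?_ (abs_nonneg _) hb
    have e : partialSum (2 * M - 1) φ f J' u - partialSum (2 * M - 1) φ f J u =
        (f u - partialSum (2 * M - 1) φ f J u) - (f u - partialSum (2 * M - 1) φ f J' u) := by ring
    rw [e]
    refine (abs_sub _ _).trans ?_
    have b1 := h1 f a hper hf ha hdf J u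
    have b2 := h1 f a hper hf ha hdf J' u
    have b3 : (2 : ℝ) ^ (-(J' : ℝ) * s) ≤ 1 :=
      Real.rpow_le_one_of_one_le_of_nonpos one_le_two (by
        have : 0 ≤ (J' : ℝ) * s := by positivity
        linarith)
    have b4 : A * a * (2 : ℝ) ^ (-(J' : ℝ) * s) ≤ A * a * 1 :=
      mul_le_mul_of_nonneg_left b3 (by positivity)
    linarith
  exact le_of_tendsto hlim.abs (Filter.eventually_atTop.2 ⟨J, fun J' hJ => hterm J' hJ⟩)

end

section
variable {M : ℕ} {φ : ℝ → ℝ} {d : ℕ}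

/-! ### Besov norms of Hölder functions -/

theorem IsDaubechies.exists_besovHolderConst (hφ : IsDaubechies M φ) (d : ℕ) {η : ℝ} (hη : 0 < η)
    (hreg : ContDiff ℝ (⌊η⌋₊ + 1) φ) : ∃ c, IsBesovHolderConst d (2 * M - 1) φ η c := by
  have hα : 0 ≤ η - ⌊η⌋₊ := sub_nonneg.2 (Nat.floor_le hη.le)
  obtain ⟨A, hA, h⟩ := hφ.exists_coeff_le hreg.continuous d (hφ.moment_eq_zero hreg) hα
  have hc0 : 0 < 2 ^ d * A := by positivity
  refine ⟨2 ^ d * A, hc0, fun f hper hf => ?_⟩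
  by_cases htop : holderNorm η f = ⊤
  · rw [htop, ENNReal.mul_top (by simpa using hc0)]
    exact le_top
  set R := (holderNorm η f).toReal with hR
  have hRe : ENNReal.ofReal R = holderNorm η f := ENNReal.ofReal_toReal htop
  have hR0 : 0 ≤ R := ENNReal.toReal_nonneg
  have hE := HolE.of_holderNorm hη.le hR0 hf hRe.ge
  rw [← hRe]
  refine iSup_le fun j => ?_
  have h1 : ∀ l ∈ Finset.Icc 1 (2 ^ d), ⨆ z ∈ positions d j, ‖coeff (2 * M - 1) φ f j l z‖ₑ ≤
      ENNReal.ofReal (A * R * (2 : ℝ) ^ (-(j : ℝ) * (η + d / 2))) := by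
    intro l hl
    refine iSup₂_le fun z _ => ?_
    rw [Real.enorm_eq_ofReal_abs]
    refine ENNReal.ofReal_le_ofReal ?_
    have := h f R hper hE.continuous hE.abs_le (fun u i => hE.slice u i) j l hl z
    rwa [add_sub_cancel] at this
  refine (mul_le_mul_right (Finset.sum_le_card_nsmul _ _ _ h1) _).trans (le_of_eq ?_)
  rw [Nat.card_Icc, Nat.add_sub_cancel, nsmul_eq_mul, ← ENNReal.ofReal_natCast,
    ← ENNReal.ofReal_mul (by positivity), ← ENNReal.ofReal_mul (by positivity),
    ← ENNReal.ofReal_mul (by positivity)]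
  congr 1
  have e : (2 : ℝ) ^ ((j : ℝ) * (η + d / 2)) * (2 : ℝ) ^ (-(j : ℝ) * (η + d / 2)) = 1 := by
    rw [← Real.rpow_add two_pos, neg_mul, add_neg_cancel, Real.rpow_zero]
  push_cast
  linear_combination (2 ^ d * A * R) * e

/-- This is the link with the class: the true coefficients of a target meet exactly the constraint
imposed on α̂. -/
theorem IsBesovHolderConst.coeffDecay {N : ℕ} {η c K : ℝ} (h : IsBesovHolderConst d N φ η c)
    (hK : 0 ≤ K) {f : E d → ℝ} (hper : IsPeriodic f) (hf : f ∈ holderBall d η K) :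
    CoeffDecay N φ f η (c * K) := by
  intro j l hl z hz
  have h1 : besovNorm N φ η f ≤ ENNReal.ofReal (c * K) := by
    rw [ENNReal.ofReal_mul h.1.le]
    exact (h.2 f hper hf.1).trans (mul_le_mul_right hf.2 _)
  have h2 : ENNReal.ofReal (2 ^ ((j : ℝ) * (η + d / 2))) * ‖coeff N φ f j l z‖ₑ ≤
      ENNReal.ofReal (c * K) := by
    refine le_trans ?_ h1
    refine le_trans ?_ (le_iSup (fun j : ℕ => ENNReal.ofReal (2 ^ ((j : ℝ) * (η + d / 2))) *
      ∑ l ∈ Finset.Icc 1 (2 ^ d), ⨆ z ∈ positions d j, ‖coeff N φ f j l z‖ₑ) j)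
    refine mul_le_mul_right (le_trans ?_ (Finset.single_le_sum
      (f := fun l => ⨆ z ∈ positions d j, ‖coeff N φ f j l z‖ₑ) (fun _ _ => zero_le) hl)) _
    exact le_iSup₂ (f := fun z (_ : z ∈ positions d j) => ‖coeff N φ f j l z‖ₑ) z hz
  rw [Real.enorm_eq_ofReal_abs, ← ENNReal.ofReal_mul (by positivity),
    ENNReal.ofReal_le_ofReal_iff (mul_nonneg h.1.le hK)] at h2
  rw [neg_mul, Real.rpow_neg zero_le_two, ← div_eq_mul_inv, le_div_iff₀ (by positivity), mul_comm]
  exact h2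

/-! ### The approximate wavelets on the torus -/

/-- The bound is kept as a difference of two products so that its sum over positions still
factorises coordinate by coordinate. -/
theorem abs_prod_sub_prod_le {ι : Type*} (S : Finset ι) (x y : ι → ℝ) {e : ℝ} (he : 0 ≤ e)
    (h : ∀ i ∈ S, |x i - y i| ≤ e) :
    |∏ i ∈ S, x i - ∏ i ∈ S, y i| ≤ ∏ i ∈ S, (|y i| + e) - ∏ i ∈ S, |y i| := by
  classical
  induction S using Finset.induction_on with
  | empty => simp
  | insert a S ha ih =>
    rw [Finset.prod_insert ha, Finset.prod_insert ha, Finset.prod_insert ha, Finset.prod_insert ha]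
    have h1 := ih fun i hi => h i (Finset.mem_insert_of_mem hi)
    have h2 := h a (Finset.mem_insert_self a S)
    have h3 : |x a| ≤ |y a| + e := by
      have := abs_sub_abs_le_abs_sub (x a) (y a); linarith
    have e1 : x a * ∏ i ∈ S, x i - y a * ∏ i ∈ S, y i =
        x a * (∏ i ∈ S, x i - ∏ i ∈ S, y i) + (x a - y a) * ∏ i ∈ S, y i := by ring
    rw [e1]
    refine (abs_add_le _ _).trans ?_
    rw [abs_mul, abs_mul, Finset.abs_prod S y]
    have h4 : |x a| * |∏ i ∈ S, x i - ∏ i ∈ S, y i| ≤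
        (|y a| + e) * (∏ i ∈ S, (|y i| + e) - ∏ i ∈ S, |y i|) :=
      mul_le_mul h3 h1 (abs_nonneg _) (by positivity)
    have h5 : |x a - y a| * ∏ i ∈ S, |y i| ≤ e * ∏ i ∈ S, |y i| :=
      mul_le_mul_of_nonneg_right h2 (Finset.prod_nonneg fun _ _ => abs_nonneg _)
    linarith

theorem prod_add_sub_prod_le {ι : Type*} (S : Finset ι) (x : ι → ℝ) {X t : ℝ} (ht : 0 ≤ t)
    (hX : 0 ≤ X) (h0 : ∀ i ∈ S, 0 ≤ x i) (h : ∀ i ∈ S, x i ≤ X) :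
    ∏ i ∈ S, (x i + t) - ∏ i ∈ S, x i ≤ (X + t) ^ S.card - X ^ S.card := by
  classical
  induction S using Finset.induction_on with
  | empty => simp
  | insert a S ha ih =>
    rw [Finset.prod_insert ha, Finset.prod_insert ha, Finset.card_insert_of_notMem ha,
      pow_succ, pow_succ]
    have h0' := fun i hi => h0 i (Finset.mem_insert_of_mem hi)
    have h' := fun i hi => h i (Finset.mem_insert_of_mem hi)
    have h1 := ih h0' h'
    have h2 : ∏ i ∈ S, (x i + t) ≤ (X + t) ^ S.card := by
      rw [← Finset.prod_const]
      exact Finset.prod_le_prod (fun i hi => add_nonneg (h0' i hi) ht)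
        fun i hi => by linarith [h' i hi]
    have h3 : ∏ i ∈ S, x i ≤ ∏ i ∈ S, (x i + t) :=
      Finset.prod_le_prod h0' fun i hi => by linarith
    have h4 := mul_le_mul (h a (Finset.mem_insert_self a S)) h1 (by linarith) hX
    have h5 := mul_le_mul_of_nonneg_left h2 ht
    nlinarith

theorem add_pow_sub_pow_le {A τ T : ℝ} (hA : 0 ≤ A) (hτ : 0 ≤ τ) (hT : τ ≤ T) (n : ℕ) :
    (A + τ) ^ n - A ^ n ≤ n * (A + T + 1) ^ n * τ := by
  induction n with
  | zero => simp
  | succ n ih =>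
    have h1 : A ^ n ≤ (A + T + 1) ^ n := pow_le_pow_left₀ hA (by linarith) n
    have h2 : 0 ≤ (A + T + 1) ^ n := pow_nonneg (by linarith) n
    have h3 : (A + τ) * ((A + τ) ^ n - A ^ n) ≤ (A + T + 1) * (n * (A + T + 1) ^ n * τ) := by
      have h0 : 0 ≤ (A + τ) ^ n - A ^ n :=
        sub_nonneg.2 (pow_le_pow_left₀ hA (by linarith) n)
      exact mul_le_mul (by linarith) ih h0 (by linarith)
    have h4 : τ * A ^ n ≤ τ * ((A + T + 1) ^ n * (A + T + 1)) := by
      refine mul_le_mul_of_nonneg_left (h1.trans ?_) hτ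
      exact le_mul_of_one_le_right h2 (by linarith)
    rw [pow_succ, pow_succ, pow_succ]
    push_cast
    nlinarith

/-- In one dimension the 2^j positions each err by O(D2^{j/2}), against a total size O(2^{j/2}). The
relative error is thus O(2^jD), and `add_pow_sub_pow_le` shows that taking d-fold products keeps it
linear while 2^jD ≤ C₀. -/
theorem IsDaubechies.exists_sum_hat_sub_le (hφ : IsDaubechies M φ) (hc : Continuous φ) (d : ℕ)
    {C₀ : ℝ} (hC₀ : 0 < C₀) : ∃ A, 0 < A ∧ ∀ (φhat : ℝ → ℝ) (D : ℝ), (∀ x, |φ x - φhat x| ≤ D) →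
      ∀ (j l : ℕ), 2 ^ j * D ≤ C₀ → l ∈ Finset.Icc 1 (2 ^ d) → ∀ u ∈ unitCube d,
      ∑ z ∈ positions d j, |hatPerWavelet (2 * M - 1) φ φhat j l z u -
        perWavelet (2 * M - 1) φ j l z u| ≤ A * (2 ^ j * D) * (2 : ℝ) ^ ((j : ℝ) * (d / 2)) := by
  obtain ⟨A₁, hA₁, h1⟩ := hφ.exists_hat_close
  obtain ⟨A₂, hA₂, h2⟩ := hφ.exists_sum_factor_le hc
  set T := A₁ * C₀ with hT
  refine ⟨d * (A₂ + T + 1) ^ d * A₁ + 1, by positivity, fun φhat D hD j l hjD hl u hu => ?_⟩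
  have hD0 : 0 ≤ D := (abs_nonneg _).trans (hD 0)
  rcases (Finset.mem_Icc.1 hl).2.eq_or_lt with rfl | hlt
  · simp only [hatPerWavelet, perWavelet, tensorWavelet_top, sub_self, abs_zero,
      Finset.sum_const_zero]
    positivity
  set q : ℝ := (2 : ℝ) ^ ((j : ℝ) / 2) with hq
  have hqpos : 0 < q := by positivity
  set e := A₁ * D * q with he
  have he0 : 0 ≤ e := by positivity
  set a : Fin d → ℕ → ℝ := fun i z => (if l.testBit i then
    periodise (waveletOf (2 * M - 1) φ φ) j else periodise φ j) (u i - (z : ℝ) / 2 ^ j) with ha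
  set x : Fin d → ℕ → ℝ := fun i z => (if l.testBit i then hatWaveletPer (2 * M - 1) φ φhat j
    else hatScalingPer (2 * M - 1) φhat j) (u i - (z : ℝ) / 2 ^ j) with hx
  have hclose : ∀ i, ∀ z ∈ Finset.range (2 ^ j), |x i z - a i z| ≤ e := by
    intro i z hz
    have hp : (0 : ℝ) < 2 ^ j := by positivity
    have hz1 : (z : ℝ) < 2 ^ j := by exact_mod_cast Finset.mem_range.1 hz
    have hz2 : (z : ℝ) / 2 ^ j < 1 := by rwa [div_lt_one hp]
    have hz3 : 0 ≤ (z : ℝ) / 2 ^ j := by positivity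
    have hu' := hu i
    have h3 := h1 φhat D hD j (u i - (z : ℝ) / 2 ^ j) (by linarith [hu'.1]) (by linarith [hu'.2])
    simp only [hx, ha]
    split_ifs
    · exact h3.2
    · exact h3.1
  have hS : ∀ i, ∑ z ∈ Finset.range (2 ^ j), |a i z| ≤ A₂ * q := fun i => h2 _ j _
  have hτ : A₁ * (2 ^ j * D) ≤ T := mul_le_mul_of_nonneg_left hjD hA₁.le
  calc _ ≤ ∑ z ∈ positions d j, (∏ i, (|a i (z i)| + e) - ∏ i, |a i (z i)|) := by
        refine Finset.sum_le_sum fun z hz => ?_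
        rw [hatPerWavelet, perWavelet, tensorWavelet_of_lt _ _ _ hlt,
          tensorWavelet_of_lt _ _ _ hlt]
        exact abs_prod_sub_prod_le Finset.univ (fun i => x i (z i)) (fun i => a i (z i)) he0
          fun i _ => hclose i (z i) (Fintype.mem_piFinset.1 hz i)
    _ = ∏ i, (∑ z ∈ Finset.range (2 ^ j), |a i z| + 2 ^ j * e) -
          ∏ i, ∑ z ∈ Finset.range (2 ^ j), |a i z| := by
        rw [Finset.sum_sub_distrib, positions,
          ← Finset.prod_univ_sum (fun _ => Finset.range (2 ^ j)) fun i z => |a i z| + e,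
          ← Finset.prod_univ_sum (fun _ => Finset.range (2 ^ j)) fun i z => |a i z|]
        simp [Finset.sum_add_distrib]
    _ ≤ (A₂ * q + 2 ^ j * e) ^ d - (A₂ * q) ^ d := by
        have := prod_add_sub_prod_le Finset.univ
          (fun i => ∑ z ∈ Finset.range (2 ^ j), |a i z|) (t := 2 ^ j * e) (by positivity)
          (by positivity) (fun i _ => Finset.sum_nonneg fun _ _ => abs_nonneg _) fun i _ => hS i
        simpa using this
    _ = ((A₂ + A₁ * (2 ^ j * D)) ^ d - A₂ ^ d) * q ^ d := by
        rw [sub_mul, ← mul_pow, ← mul_pow, he]; ring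
    _ ≤ (d * (A₂ + T + 1) ^ d * (A₁ * (2 ^ j * D))) * q ^ d :=
        mul_le_mul_of_nonneg_right (add_pow_sub_pow_le hA₂.le (by positivity) hτ d) (by positivity)
    _ ≤ _ := by
        rw [hq, rpow_half_pow]
        refine mul_le_mul_of_nonneg_right ?_ (by positivity)
        have : 0 ≤ 2 ^ j * D := by positivity
        linarith

theorem IsDaubechies.exists_sum_hat_le (hφ : IsDaubechies M φ) (hc : Continuous φ) (d : ℕ)
    {C₀ : ℝ} (hC₀ : 0 < C₀) : ∃ A, 0 < A ∧ ∀ (φhat : ℝ → ℝ) (D : ℝ), (∀ x, |φ x - φhat x| ≤ D) →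
      ∀ (j l : ℕ), 2 ^ j * D ≤ C₀ → l ∈ Finset.Icc 1 (2 ^ d) → ∀ u ∈ unitCube d,
      ∑ z ∈ positions d j, |hatPerWavelet (2 * M - 1) φ φhat j l z u| ≤
        A * (2 : ℝ) ^ ((j : ℝ) * (d / 2)) := by
  obtain ⟨A, hA, h1⟩ := hφ.exists_sum_hat_sub_le hc d hC₀
  obtain ⟨B, hB, h2⟩ := hφ.exists_sum_perWavelet_le hc d
  refine ⟨A * C₀ + B, by positivity, fun φhat D hD j l hjD hl u hu => ?_⟩
  have h3 := h1 φhat D hD j l hjD hl u hu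
  have h4 := h2 j l hl u
  have h5 : A * (2 ^ j * D) * (2 : ℝ) ^ ((j : ℝ) * (d / 2)) ≤
      A * C₀ * (2 : ℝ) ^ ((j : ℝ) * (d / 2)) := by gcongr
  rw [add_mul]
  refine le_trans ?_ (add_le_add (h3.trans h5) h4)
  rw [← Finset.sum_add_distrib]
  refine Finset.sum_le_sum fun z _ => ?_
  have := abs_sub_abs_le_abs_sub (hatPerWavelet (2 * M - 1) φ φhat j l z u)
    (perWavelet (2 * M - 1) φ j l z u)
  linarith

/-! ### Covering numbers -/

theorem two_pow_floor_logb_le {δ : ℝ} (h0 : 0 < δ) (h1 : δ < 1) :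
    (2 : ℝ) ^ ⌊Real.logb 2 δ⁻¹⌋₊ ≤ δ⁻¹ := by
  have h2 : 0 ≤ Real.logb 2 δ⁻¹ := Real.logb_nonneg one_lt_two ((one_le_inv₀ h0).2 h1.le)
  rw [← Real.rpow_natCast]
  calc _ ≤ (2 : ℝ) ^ Real.logb 2 δ⁻¹ :=
        Real.rpow_le_rpow_of_exponent_le one_le_two (Nat.floor_le h2)
    _ = δ⁻¹ := Real.rpow_logb two_pos (by norm_num) (inv_pos.2 h0)

theorem inv_lt_two_pow_floor_logb {δ : ℝ} (h0 : 0 < δ) :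
    δ⁻¹ < (2 : ℝ) ^ (⌊Real.logb 2 δ⁻¹⌋₊ + 1) := by
  rw [← Real.rpow_natCast]
  calc δ⁻¹ = (2 : ℝ) ^ Real.logb 2 δ⁻¹ := (Real.rpow_logb two_pos (by norm_num) (inv_pos.2 h0)).symm
    _ < _ := Real.rpow_lt_rpow_of_exponent_lt one_lt_two (by
      push_cast; exact Nat.lt_floor_add_one _)

theorem sum_range_pow_le {b : ℕ} (hb : 2 ≤ b) (n : ℕ) : ∑ j ∈ Finset.range n, b ^ j ≤ b ^ n := by
  induction n with
  | zero => simp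
  | succ n ih =>
    rw [Finset.sum_range_succ, pow_succ]
    nlinarith [Nat.zero_le (b ^ n)]

/-- For x ≥ 2 one has x ≤ ⌊x⌋². -/
theorem log_inv_le_two_mul_log_floor {δ : ℝ} (h0 : 0 < δ) (h1 : δ ≤ 1 / 2) :
    Real.log δ⁻¹ ≤ 2 * Real.log (⌊δ⁻¹⌋₊ : ℝ) := by
  have h2 : (2 : ℝ) ≤ δ⁻¹ := by
    rw [le_inv_comm₀ two_pos h0]; linarith
  have h3 : 2 ≤ ⌊δ⁻¹⌋₊ := Nat.le_floor (by exact_mod_cast h2)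
  have h4 : (2 : ℝ) ≤ (⌊δ⁻¹⌋₊ : ℝ) := by exact_mod_cast h3
  have h5 := Nat.lt_floor_add_one δ⁻¹
  have h6 : 2 * Real.log (⌊δ⁻¹⌋₊ : ℝ) = Real.log ((⌊δ⁻¹⌋₊ : ℝ) ^ 2) := by
    rw [Real.log_pow]; norm_num
  rw [h6]
  exact Real.log_le_log (by positivity) (by nlinarith)

/-- The indices `(j, l, z)` of the first `J + 1` levels. -/
def waveletIndex (d J : ℕ) : Finset (Σ _ : ℕ, ℕ × (Fin d → ℕ)) :=
  (Finset.range (J + 1)).sigma fun j => Finset.Icc 1 (2 ^ d) ×ˢ positions d j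

theorem card_waveletIndex_le (hd : 1 ≤ d) (J : ℕ) :
    (waveletIndex d J).card ≤ 2 ^ d * (2 ^ d * (2 ^ J) ^ d) := by
  rw [waveletIndex, Finset.card_sigma]
  have h1 : ∀ j ∈ Finset.range (J + 1), (Finset.Icc 1 (2 ^ d) ×ˢ positions d j).card =
      2 ^ d * (2 ^ d) ^ j := by
    intro j _
    rw [Finset.card_product, Nat.card_Icc, Nat.add_sub_cancel, card_positions]
    ring
  rw [Finset.sum_congr rfl h1, ← Finset.mul_sum]
  refine Nat.mul_le_mul_left _ ?_
  have h2 : 2 ≤ 2 ^ d := by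
    calc 2 = 2 ^ 1 := rfl
      _ ≤ 2 ^ d := Nat.pow_le_pow_right two_pos hd
  refine (sum_range_pow_le h2 (J + 1)).trans (le_of_eq ?_)
  ring

/-- Every coefficient is rounded to the nearest multiple of a mesh τ. The cover consists of all
functions with such rounded coefficients, one choice among 2n + 1 values for each index and
component. -/
theorem exists_finite_cover {p N J : ℕ} (hp : 0 < p) {φhat : ℝ → ℝ} {c K η δ A : ℝ}
    (hJ : J = ⌊Real.logb 2 δ⁻¹⌋₊) (hA : 0 < A) (hcK : 0 ≤ c * K) (hη : 0 < η)
    (hsum : ∀ j ∈ Finset.range (J + 1), ∀ l ∈ Finset.Icc 1 (2 ^ d), ∀ u ∈ unitCube d,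
      ∑ z ∈ positions d j, |hatPerWavelet N φ φhat j l z u| ≤ A * (2 : ℝ) ^ ((j : ℝ) * (d / 2)))
    {ε : ℝ} (hε : 0 < ε) :
    ∃ n : ℕ, ((2 * n + 1 : ℕ) : ℝ) ≤
        c * K * (p * 2 ^ d * A * (2 ^ J) ^ (d + 1)) / ε + 5 ∧
      coveringNumber (hatF d p N φ φhat c K η δ) ε ≤
        (((2 * n + 1) ^ ((waveletIndex d J).card * p) : ℕ) : ℕ∞) := by
  classical
  set Q : ℝ := p * 2 ^ d * A * (2 ^ J) ^ (d + 1) with hQ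
  have hp' : (0 : ℝ) < p := by exact_mod_cast hp
  have hQpos : 0 < Q := by positivity
  -- Rounding errs by τ/2 per coefficient, and Q bounds the amplification into the norm: p
  -- components, 2^d types, at most 2^J levels, and A·2^{Jd} for the sum over positions. Hence τQ/2
  -- = ε. The extra 1 in n leaves room for rounding.
  set τ := 2 * ε / Q with hτ
  have hτpos : 0 < τ := by positivity
  set n := ⌈c * K / τ⌉₊ + 1 with hn
  refine ⟨n, ?_, ?_⟩
  · have h1 := Nat.ceil_lt_add_one (div_nonneg hcK hτpos.le)
    have h2 : c * K * Q / ε = 2 * (c * K / τ) := by rw [hτ]; field_simp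
    rw [h2, hn]; push_cast; linarith
  set T := waveletIndex d J with hTdef
  set code := (↥T × Fin p → ↥(Finset.Icc (-(n : ℤ)) n)) with hcode
  set dec : code → ℕ → ℕ → (Fin d → ℕ) → Fin p → ℝ := fun κ j l z i =>
    if h : (⟨j, l, z⟩ : Σ _ : ℕ, ℕ × (Fin d → ℕ)) ∈ T then
      τ * ((κ (⟨_, h⟩, i) : ℤ) : ℝ) else 0 with hdec
  set G : code → E d → E p := fun κ u => WithLp.toLp 2 fun i =>
    ∑ j ∈ Finset.range (J + 1), ∑ l ∈ Finset.Icc 1 (2 ^ d), ∑ z ∈ positions d j,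
      dec κ j l z i * hatPerWavelet N φ φhat j l z (fractE u) with hG
  have hcard : (Set.range G).encard ≤ (((2 * n + 1) ^ (T.card * p) : ℕ) : ℕ∞) := by
    have h1 : (Set.range G).encard ≤ (Set.univ : Set code).encard := by
      rw [← Set.image_univ]
      exact Set.encard_image_le _ _
    refine h1.trans (le_of_eq ?_)
    rw [Set.encard_univ, ENat.card_eq_coe_fintype_card]
    congr 1
    simp only [hcode]
    rw [Fintype.card_fun, Fintype.card_prod, Fintype.card_coe, Fintype.card_coe, Fintype.card_fin,
      Int.card_Icc]
    congr 1
    omega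
  refine le_trans (iInf₂_le (Set.range G) ?_) hcard
  rintro f ⟨hper, α, hα, hfα⟩
  rw [← hJ] at hα hfα
  have hαB : ∀ j ∈ Finset.range (J + 1), ∀ l ∈ Finset.Icc 1 (2 ^ d), ∀ z ∈ positions d j, ∀ i,
      |α j l z i| ≤ c * K := fun j hj l hl z hz i =>
    (hα j hj l hl z hz i).trans (mul_le_of_le_one_right hcK
      (Real.rpow_le_one_of_one_le_of_nonpos one_le_two (by
        have : 0 ≤ (j : ℝ) * (η + d / 2) := by positivity
        linarith)))
  have hround : ∀ x : ℝ, |x| ≤ c * K → round (x / τ) ∈ Finset.Icc (-(n : ℤ)) n := by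
    intro x hx
    have h1 := abs_sub_round (x / τ)
    have h2 : |x / τ| ≤ c * K / τ := by
      rw [abs_div, abs_of_pos hτpos]
      exact div_le_div_of_nonneg_right hx hτpos.le
    have h3 := Nat.le_ceil (c * K / τ)
    have h4 : |(round (x / τ) : ℝ)| ≤ n := by
      have h5 := abs_sub_abs_le_abs_sub (round (x / τ) : ℝ) (x / τ)
      rw [abs_sub_comm] at h5
      rw [hn]; push_cast; linarith
    rw [Finset.mem_Icc, ← abs_le]
    exact_mod_cast h4
  -- The coefficient bound holds at every index in T, so the default value 0 never occurs.
  set κ : code := fun q => if h : |α q.1.1.1 q.1.1.2.1 q.1.1.2.2 q.2| ≤ c * K then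
    ⟨_, hround _ h⟩ else ⟨0, by simp⟩ with hκ
  refine ⟨G κ, ⟨κ, rfl⟩, fun u => ?_⟩
  have hclose : ∀ j ∈ Finset.range (J + 1), ∀ l ∈ Finset.Icc 1 (2 ^ d), ∀ z ∈ positions d j, ∀ i,
      |α j l z i - dec κ j l z i| ≤ τ / 2 := by
    intro j hj l hl z hz i
    have hT : (⟨j, l, z⟩ : Σ _ : ℕ, ℕ × (Fin d → ℕ)) ∈ T :=
      Finset.mem_sigma.2 ⟨hj, Finset.mem_product.2 ⟨hl, hz⟩⟩
    have h1 := hαB j hj l hl z hz i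
    have h2 : dec κ j l z i = τ * (round (α j l z i / τ) : ℝ) := by
      simp only [hdec, hκ]
      rw [dif_pos hT, dif_pos h1]
    rw [h2]
    have h3 := abs_sub_round (α j l z i / τ)
    have h4 : α j l z i - τ * (round (α j l z i / τ) : ℝ) =
        τ * (α j l z i / τ - round (α j l z i / τ)) := by field_simp
    rw [h4, abs_mul, abs_of_pos hτpos]
    calc _ ≤ τ * (1 / 2) := mul_le_mul_of_nonneg_left h3 hτpos.le
      _ = τ / 2 := by ring
  have hcomp : ∀ i, |(f u - G κ u) i| ≤ τ / 2 * (2 ^ d * A * (2 ^ J) ^ (d + 1)) := by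
    intro i
    have e1 : (f u - G κ u) i = ∑ j ∈ Finset.range (J + 1), ∑ l ∈ Finset.Icc 1 (2 ^ d),
        ∑ z ∈ positions d j, (α j l z i - dec κ j l z i) *
          hatPerWavelet N φ φhat j l z (fractE u) := by
      rw [← hper.apply_fractE u, PiLp.sub_apply, hfα _ (fractE_mem u) i]
      simp only [hG]
      simp_rw [← Finset.sum_sub_distrib, sub_mul]
    rw [e1]
    have h1 : ∀ j ∈ Finset.range (J + 1), |∑ l ∈ Finset.Icc 1 (2 ^ d), ∑ z ∈ positions d j,
        (α j l z i - dec κ j l z i) * hatPerWavelet N φ φhat j l z (fractE u)| ≤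
        τ / 2 * (2 ^ d * A * (2 ^ J) ^ d) := by
      intro j hj
      have h2 : ∀ l ∈ Finset.Icc 1 (2 ^ d), |∑ z ∈ positions d j,
          (α j l z i - dec κ j l z i) * hatPerWavelet N φ φhat j l z (fractE u)| ≤
          τ / 2 * (A * (2 ^ J) ^ d) := by
        intro l hl
        calc _ ≤ ∑ z ∈ positions d j, τ / 2 * |hatPerWavelet N φ φhat j l z (fractE u)| := by
              refine (Finset.abs_sum_le_sum_abs _ _).trans (Finset.sum_le_sum fun z hz => ?_)
              rw [abs_mul]
              exact mul_le_mul_of_nonneg_right (hclose j hj l hl z hz i) (abs_nonneg _)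
          _ ≤ τ / 2 * (A * (2 : ℝ) ^ ((j : ℝ) * (d / 2))) := by
              rw [← Finset.mul_sum]
              exact mul_le_mul_of_nonneg_left (hsum j hj l hl _ (fractE_mem u)) (by positivity)
          _ ≤ _ := by
              have h3 : (2 : ℝ) ^ ((j : ℝ) * (d / 2)) ≤ (2 ^ J) ^ d := by
                rw [← pow_mul, ← Real.rpow_natCast]
                refine Real.rpow_le_rpow_of_exponent_le one_le_two ?_
                have h4 : (j : ℝ) ≤ J := by
                  exact_mod_cast Nat.lt_succ_iff.1 (Finset.mem_range.1 hj)
                push_cast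
                have : (0 : ℝ) ≤ d := Nat.cast_nonneg d
                nlinarith
              gcongr
      refine (Finset.abs_sum_le_sum_abs _ _).trans
        ((Finset.sum_le_card_nsmul _ _ _ h2).trans (le_of_eq ?_))
      simp; ring
    refine (Finset.abs_sum_le_sum_abs _ _).trans
      ((Finset.sum_le_card_nsmul _ _ _ h1).trans ?_)
    have h5 : ((J + 1 : ℕ) : ℝ) ≤ 2 ^ J := by exact_mod_cast Nat.lt_two_pow_self
    rw [Finset.card_range, nsmul_eq_mul, pow_succ]
    calc _ ≤ 2 ^ J * (τ / 2 * (2 ^ d * A * (2 ^ J) ^ d)) :=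
          mul_le_mul_of_nonneg_right h5 (by positivity)
      _ = _ := by ring
  refine (norm_le_sum_abs _).trans ((Finset.sum_le_card_nsmul _ _ _ fun i _ => hcomp i).trans
    (le_of_eq ?_))
  rw [Finset.card_univ, Fintype.card_fin, nsmul_eq_mul, hτ, hQ]
  field_simp

/-- The entropy bound for the class of generators. -/
theorem exists_log_coveringNumber_le (hd : 1 ≤ d) {p : ℕ} (hp : 0 < p) (N : ℕ) (φ : ℝ → ℝ)
    {c K η A r : ℝ} (hA : 0 < A) (hcK : 0 ≤ c * K) (hη : 0 < η) (hr : r < 1) :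
    ∃ C, 0 < C ∧ ∀ (δ : ℝ) (φhat : ℝ → ℝ), 0 < δ → δ ≤ 1 / 2 →
      (∀ j ∈ Finset.range (⌊Real.logb 2 δ⁻¹⌋₊ + 1), ∀ l ∈ Finset.Icc 1 (2 ^ d), ∀ u ∈ unitCube d,
        ∑ z ∈ positions d j, |hatPerWavelet N φ φhat j l z u| ≤
          A * (2 : ℝ) ^ ((j : ℝ) * (d / 2))) →
      ∀ ε, 0 < ε → ε ≤ r →
        coveringNumber (hatF d p N φ φhat c K η δ) ε ≠ ⊤ ∧
        Real.log ((coveringNumber (hatF d p N φ φhat c K η δ) ε).toNat : ℝ)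
          ≤ C * δ ^ (-(d : ℝ)) * Real.log (⌊δ⁻¹⌋₊ : ℝ) * Real.log ε⁻¹ := by
  by_cases hr0 : 0 < r
  swap
  · exact ⟨1, one_pos, fun δ φhat _ _ _ ε h1 h2 => absurd (h1.trans_le h2) hr0⟩
  set ρ := Real.log r⁻¹ with hρ
  have hρpos : 0 < ρ := Real.log_pos ((one_lt_inv₀ hr0).2 hr)
  set C₁ := c * K * (p * 2 ^ d * A) + 5 with hC₁
  have hC₁1 : 1 ≤ C₁ := by
    have : 0 ≤ c * K * (p * 2 ^ d * A) := by positivity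
    linarith
  have hlC₁ : 0 ≤ Real.log C₁ := Real.log_nonneg hC₁1
  have hl2 : 0 < Real.log 2 := Real.log_pos one_lt_two
  -- The three terms absorb log C₁, log ε⁻¹ and (d + 1) log δ⁻¹ into the product of logarithms,
  -- using log⌊δ⁻¹⌋ ≥ log 2 and log ε⁻¹ ≥ log r⁻¹ = ρ.
  set C₂ := Real.log C₁ / (ρ * Real.log 2) + 1 / Real.log 2 + 2 * (d + 1) / ρ with hC₂
  have hC₂pos : 0 < C₂ := by positivity
  have hp' : (0 : ℝ) < p := by exact_mod_cast hp
  refine ⟨2 ^ d * 2 ^ d * p * C₂, by positivity, fun δ φhat hδ0 hδ hsum ε hε hεr => ?_⟩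
  set J := ⌊Real.logb 2 δ⁻¹⌋₊ with hJ
  obtain ⟨n, hn, hcov⟩ := exists_finite_cover hp hJ hA hcK hη hsum hε
  refine ⟨ne_top_of_le_ne_top (ENat.natCast_ne_top _) hcov, ?_⟩
  have hδinv : 1 ≤ δ⁻¹ := (one_le_inv₀ hδ0).2 (by linarith)
  have hX : (2 : ℝ) ^ J ≤ δ⁻¹ := two_pow_floor_logb_le hδ0 (by linarith)
  have hεinv : 1 ≤ ε⁻¹ := (one_le_inv₀ hε).2 (by linarith)
  set Eε := Real.log ε⁻¹ with hEε
  set Ld := Real.log (⌊δ⁻¹⌋₊ : ℝ) with hLd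
  have hE : ρ ≤ Eε := Real.log_le_log (inv_pos.2 hr0) (inv_anti₀ hε hεr)
  have hLd2 : Real.log 2 ≤ Ld := by
    have h3 : 2 ≤ ⌊δ⁻¹⌋₊ := Nat.le_floor (by
      push_cast
      rw [le_inv_comm₀ two_pos hδ0]; linarith)
    exact Real.log_le_log two_pos (by exact_mod_cast h3)
  have hLdδ : Real.log δ⁻¹ ≤ 2 * Ld := log_inv_le_two_mul_log_floor hδ0 hδ
  have hcount : ((2 * n + 1 : ℕ) : ℝ) ≤ C₁ * ε⁻¹ * δ⁻¹ ^ (d + 1) := by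
    refine hn.trans ?_
    have h1 : (2 ^ J : ℝ) ^ (d + 1) ≤ δ⁻¹ ^ (d + 1) := pow_le_pow_left₀ (by positivity) hX _
    have h2 : (1 : ℝ) ≤ ε⁻¹ * δ⁻¹ ^ (d + 1) :=
      one_le_mul_of_one_le_of_one_le hεinv (one_le_pow₀ hδinv)
    have h3 : c * K * (p * 2 ^ d * A * (2 ^ J) ^ (d + 1)) / ε ≤
        c * K * (p * 2 ^ d * A) * (ε⁻¹ * δ⁻¹ ^ (d + 1)) := by
      rw [div_eq_mul_inv]
      calc _ = c * K * (p * 2 ^ d * A) * (ε⁻¹ * (2 ^ J) ^ (d + 1)) := by ring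
        _ ≤ _ := by gcongr
    rw [hC₁, mul_assoc (_ + 5), add_mul]
    linarith
  have hlog : Real.log ((2 * n + 1 : ℕ) : ℝ) ≤ C₂ * (Ld * Eε) := by
    have h1 : Real.log ((2 * n + 1 : ℕ) : ℝ) ≤ Real.log C₁ + Eε + (d + 1) * Real.log δ⁻¹ := by
      refine (Real.log_le_log (by positivity) hcount).trans (le_of_eq ?_)
      rw [Real.log_mul (by positivity) (by positivity), Real.log_mul (by positivity)
        (by positivity), Real.log_pow]
      push_cast; rfl
    have h2 : Real.log C₁ ≤ Real.log C₁ / (ρ * Real.log 2) * (Ld * Eε) := by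
      rw [div_mul_eq_mul_div, le_div_iff₀ (by positivity)]
      refine mul_le_mul_of_nonneg_left ?_ hlC₁
      rw [mul_comm Ld]
      exact mul_le_mul hE hLd2 hl2.le (hρpos.le.trans hE)
    have hE0 : 0 ≤ Eε := hρpos.le.trans hE
    have hL0 : 0 ≤ Ld := hl2.le.trans hLd2
    have h3 : Eε ≤ 1 / Real.log 2 * (Ld * Eε) := by
      rw [div_mul_eq_mul_div, le_div_iff₀ hl2, one_mul, mul_comm]
      exact mul_le_mul_of_nonneg_right hLd2 hE0
    have h4 : (d + 1) * Real.log δ⁻¹ ≤ 2 * (d + 1) / ρ * (Ld * Eε) := by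
      rw [div_mul_eq_mul_div, le_div_iff₀ hρpos]
      calc _ ≤ (d + 1) * (2 * Ld) * Eε := by gcongr
        _ = _ := by ring
    rw [hC₂, add_mul, add_mul]
    linarith
  have hnat : (coveringNumber (hatF d p N φ φhat c K η δ) ε).toNat ≤
      (2 * n + 1) ^ ((waveletIndex d J).card * p) := ENat.toNat_le_of_le_natCast hcov
  have hlogle : Real.log ((coveringNumber (hatF d p N φ φhat c K η δ) ε).toNat : ℝ) ≤
      Real.log (((2 * n + 1) ^ ((waveletIndex d J).card * p) : ℕ) : ℝ) := by
    rcases Nat.eq_zero_or_pos (coveringNumber (hatF d p N φ φhat c K η δ) ε).toNat with h0 | h0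
    · rw [h0, Nat.cast_zero, Real.log_zero]
      exact Real.log_natCast_nonneg _
    · exact Real.log_le_log (by exact_mod_cast h0) (by exact_mod_cast hnat)
  refine hlogle.trans ?_
  have hδd : δ⁻¹ ^ d = δ ^ (-(d : ℝ)) := by
    rw [Real.rpow_neg hδ0.le, Real.rpow_natCast, inv_pow]
  have hcardR : ((waveletIndex d J).card : ℝ) ≤ 2 ^ d * 2 ^ d * δ ^ (-(d : ℝ)) := by
    have h1 : ((waveletIndex d J).card : ℝ) ≤ 2 ^ d * (2 ^ d * (2 ^ J) ^ d) := by
      exact_mod_cast card_waveletIndex_le hd J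
    refine h1.trans ?_
    rw [← hδd, ← mul_assoc]
    gcongr
  rw [Nat.cast_pow, Real.log_pow]
  push_cast at hlog ⊢
  have hnn : 0 ≤ C₂ * (Ld * Eε) := by
    have := hl2.le.trans hLd2
    have := hρpos.le.trans hE
    positivity
  calc _ ≤ ((waveletIndex d J).card : ℝ) * p * (C₂ * (Ld * Eε)) :=
        mul_le_mul_of_nonneg_left hlog (by positivity)
    _ ≤ (2 ^ d * 2 ^ d * δ ^ (-(d : ℝ))) * p * (C₂ * (Ld * Eε)) := by gcongr
    _ = _ := by ring

end

/-! ### Approximation in the integral probability metric -/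

/-- For k = 0 the gradient is α-Hölder and h^η ≤ h because η ≥ 1. For k ≥ 1 it is Lipschitz and h^η
≤ h^{k+α} because k + α ≤ η. -/
theorem HolE.abs_partialD_sub_le {p k : ℕ} {α C : ℝ} {g : E p → ℝ} (hg : HolE (k + 1) α C g)
    (h0 : 0 ≤ α) (h1 : α ≤ 1) {η h T : ℝ} (hη : 1 ≤ η) (hk : k + α ≤ η) (hh : 0 < h) (hh1 : h ≤ 1)
    (hT : 0 ≤ T) (i : Fin p) {x y : E p} (hv : ‖y - x‖ ≤ T * h ^ η) :
    |partialD i g y - partialD i g x| ≤ C * (p + 1) * (T + 1) * h ^ (k + α) := by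
  have hC := hg.nonneg
  have hpos : 0 ≤ h ^ (k + α) := by positivity
  have hi := hg.2.2 i
  rcases k with _ | k
  · have h2 : ‖y - x‖ ^ α ≤ (T + 1) * h ^ α := by
      have hle : ‖y - x‖ ≤ (T + 1) * h := by
        refine hv.trans (mul_le_mul (by linarith) ?_ (by positivity) (by linarith))
        calc h ^ η ≤ h ^ (1 : ℝ) := Real.rpow_le_rpow_of_exponent_ge hh hh1 hη
          _ = h := Real.rpow_one h
      refine (Real.rpow_le_rpow (norm_nonneg _) hle h0).trans ?_
      rw [Real.mul_rpow (by linarith) hh.le]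
      refine mul_le_mul_of_nonneg_right ?_ (by positivity)
      calc (T + 1) ^ α ≤ (T + 1) ^ (1 : ℝ) :=
            Real.rpow_le_rpow_of_exponent_le (by linarith) h1
        _ = T + 1 := Real.rpow_one _
    have h3 : (1 : ℝ) ≤ p + 1 := by linarith [(Nat.cast_nonneg p : (0 : ℝ) ≤ p)]
    calc |partialD i g y - partialD i g x| ≤ C * ‖y - x‖ ^ α := hi.2.2 y x
      _ ≤ C * ((T + 1) * h ^ α) := mul_le_mul_of_nonneg_left h2 hC
      _ ≤ (p + 1) * (C * ((T + 1) * h ^ α)) := le_mul_of_one_le_left (by positivity) h3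
      _ = _ := by rw [Nat.cast_zero, zero_add]; ring
  · have h2 : h ^ η ≤ h ^ (((k + 1 : ℕ) : ℝ) + α) := Real.rpow_le_rpow_of_exponent_ge hh hh1 hk
    calc |partialD i g y - partialD i g x| ≤ p * C * ‖y - x‖ := hi.abs_sub_le y x
      _ ≤ p * C * (T * h ^ (((k + 1 : ℕ) : ℝ) + α)) :=
        mul_le_mul_of_nonneg_left (hv.trans (mul_le_mul_of_nonneg_left h2 hT)) (by positivity)
      _ ≤ C * (p + 1) * ((T + 1) * h ^ (((k + 1 : ℕ) : ℝ) + α)) := by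
        refine mul_le_mul ?_ (mul_le_mul_of_nonneg_right (by linarith) hpos) (by positivity)
          (by positivity)
        linarith
      _ = _ := by ring

theorem HolE.abs_taylor_le {p k : ℕ} {α C : ℝ} {g : E p → ℝ} (hg : HolE (k + 1) α C g)
    (h0 : 0 ≤ α) (h1 : α ≤ 1) {η h T : ℝ} (hη : 1 ≤ η) (hk : k + α ≤ η) (hh : 0 < h) (hh1 : h ≤ 1)
    (hT : 0 ≤ T) {x y : E p} (hv : ‖y - x‖ ≤ T * h ^ η) :
    |g y - g x - ∑ i, partialD i g x * (y - x) i| ≤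
      p * (C * (p + 1) * (T + 1)) * T * h ^ (η + (k + α)) := by
  have hC := hg.nonneg
  have hb : ∀ z ∈ Metric.closedBall x ‖y - x‖, ‖fderiv ℝ g z - fderiv ℝ g x‖ ≤
      p * (C * (p + 1) * (T + 1) * h ^ (k + α)) := by
    intro z hz
    refine ContinuousLinearMap.opNorm_le_bound _ (by positivity) fun v => ?_
    rw [sub_apply, fderiv_apply_eq_sum, fderiv_apply_eq_sum, ← Finset.sum_sub_distrib,
      Real.norm_eq_abs]
    refine (Finset.abs_sum_le_sum_abs _ _).trans ?_
    have : ∀ i ∈ Finset.univ, |partialD i g z * v i - partialD i g x * v i| ≤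
        C * (p + 1) * (T + 1) * h ^ (k + α) * ‖v‖ := by
      intro i _
      rw [← sub_mul, abs_mul]
      refine mul_le_mul (hg.abs_partialD_sub_le h0 h1 hη hk hh hh1 hT i ?_) ?_ (abs_nonneg _)
        (by positivity)
      · rw [← dist_eq_norm]
        exact (Metric.mem_closedBall.1 hz).trans hv
      · exact PiLp.norm_apply_le v i
    refine (Finset.sum_le_card_nsmul _ _ _ this).trans (le_of_eq ?_)
    rw [Finset.card_univ, Fintype.card_fin, nsmul_eq_mul]
    ring
  have h2 := Convex.norm_image_sub_le_of_norm_hasFDerivWithin_le' (𝕜 := ℝ)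
    (s := Metric.closedBall x ‖y - x‖) (φ := fderiv ℝ g x)
    (fun z _ => (hg.2.1 z).hasFDerivAt.hasFDerivWithinAt) hb (convex_closedBall _ _)
    (Metric.mem_closedBall_self (norm_nonneg _)) (y := y)
    (by rw [Metric.mem_closedBall, dist_eq_norm])
  rw [fderiv_apply_eq_sum, Real.norm_eq_abs] at h2
  refine h2.trans ((mul_le_mul_of_nonneg_left hv (by positivity)).trans (le_of_eq ?_))
  rw [Real.rpow_add hh η (k + α)]
  ring

section

variable {M d p : ℕ} {φ : ℝ → ℝ}

/-- The vector of the partial sums of the components of `f`. -/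
def partialSumVec (N : ℕ) (φ : ℝ → ℝ) (f : E d → E p) (J : ℕ) (u : E d) : E p :=
  WithLp.toLp 2 fun i => partialSum N φ (fun v => f v i) J u

theorem IsDaubechies.continuous_partialSumVec (hφ : IsDaubechies M φ) (hc : Continuous φ)
    (f : E d → E p) (J : ℕ) : Continuous (partialSumVec (2 * M - 1) φ f J) :=
  (PiLp.continuous_toLp 2 _).comp
    (continuous_pi fun _ => hφ.continuous_partialSum hc _ J)

theorem continuous_of_mem_holderBallTorus {η K : ℝ} (hη : 0 ≤ η) (hK : 0 ≤ K) {f : E d → E p}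
    (hf : f ∈ holderBallTorus d p η K) : Continuous f :=
  (PiLp.continuous_toLp 2 _).comp (f := fun u i => f u i) (continuous_pi fun i =>
    (HolE.of_holderNorm hη hK (hf.2 i).1 (hf.2 i).2).continuous)

theorem IsPeriodic.component {f : E d → E p} (hf : IsPeriodic f) (i : Fin p) :
    IsPeriodic fun u => f u i := fun u j => congrArg (fun v : E p => v i) (hf u j)

theorem IsDaubechies.exists_norm_sub_partialSumVec_le (hφ : IsDaubechies M φ) (hc : Continuous φ)
    (d p : ℕ) {η K a : ℝ} (hη : 0 < η) (hK : 0 ≤ K) (ha : 0 ≤ a) : ∃ T, 0 ≤ T ∧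
      ∀ f ∈ holderBallTorus d p η K,
      (∀ i, CoeffDecay (2 * M - 1) φ (fun u => f u i) η a) → ∀ J u,
      ‖partialSumVec (2 * M - 1) φ f J u - f u‖ ≤ T * ((2 : ℝ) ^ (-(J : ℝ))) ^ η := by
  obtain ⟨A, hA, h⟩ := hφ.exists_abs_sub_partialSum_le hc d hη
  refine ⟨p * (A * a), by positivity, fun f hf hdec J u => ?_⟩
  have hcf := continuous_of_mem_holderBallTorus hη.le hK hf
  refine (norm_le_sum_abs _).trans ?_
  have h1 : ∀ i ∈ Finset.univ, |(partialSumVec (2 * M - 1) φ f J u - f u) i| ≤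
      A * a * ((2 : ℝ) ^ (-(J : ℝ))) ^ η := by
    intro i _
    rw [← Real.rpow_mul two_pos.le, PiLp.sub_apply, abs_sub_comm]
    exact h (fun u => f u i) a (hf.1.component i) (by fun_prop) ha (hdec i) J u
  refine (Finset.sum_le_card_nsmul _ _ _ h1).trans (le_of_eq ?_)
  rw [Finset.card_univ, Fintype.card_fin, nsmul_eq_mul]
  ring

/-- Along coordinate lines f has smoothness k + α because k + α ≤ η, and it is Lipschitz because η ≥
1. Composition with g therefore keeps smoothness k + α, and the vanishing moments turn this into
coefficient decay. -/
theorem IsDaubechies.exists_coeffDecay_comp (hφ : IsDaubechies M φ) (hc : Continuous φ)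
    (d p : ℕ) {η K : ℝ} (hη : 1 ≤ η) (hK : 0 ≤ K) {k : ℕ} {α : ℝ} (h0 : 0 ≤ α) (h1 : α < 1)
    (hk : k + α ≤ η) (hm : ∀ m ≤ k, ∫ x, x ^ m * waveletOf (2 * M - 1) φ φ x = 0) :
    ∃ b, 1 ≤ b ∧ ∀ f ∈ holderBallTorus d p η K, ∀ g : E p → ℝ, HolE k α 1 g →
      CoeffDecay (2 * M - 1) φ (fun u => g (f u)) (k + α) b := by
  have hη0 : 0 ≤ η := zero_le_one.trans hη
  obtain ⟨A, hA, hco⟩ := hφ.exists_coeff_le hc d hm h0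
  -- The first summand pays for lowering the smoothness of the slices of f, the second is their
  -- Lipschitz constant.
  set B := 2 ^ (⌊η⌋₊ + 1) * K + d * K with hB
  have hB0 : 0 ≤ B := by positivity
  obtain ⟨Γ, hΓ⟩ := HolE.exists_comp (p := p) k h0 h1.le hB0 (C := 1)
  have hmax : (1 : ℝ) ≤ max 1 Γ := le_max_left _ _
  refine ⟨(A + 1) * max 1 Γ, by nlinarith, fun f hf g hg j l hl z _ => ?_⟩
  have hcf := continuous_of_mem_holderBallTorus hη0 hK hf
  have hE := fun i => HolE.of_holderNorm hη0 hK (hf.2 i).1 (hf.2 i).2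
  obtain ⟨m, hmη⟩ : ∃ m, ⌊η⌋₊ = m + 1 :=
    Nat.exists_eq_add_one.2 (Nat.floor_pos.2 hη)
  have hsl : ∀ u i, HolN k α (max 1 Γ) fun s => g (f (u + s • EuclideanSpace.single i 1)) := by
    intro u i
    refine HolN.mono_const (hΓ g (fun s => f (u + s • EuclideanSpace.single i 1)) hg
      (fun q => ?_) fun q x y => ?_) (le_max_right _ _)
    · refine ((hE q).slice u i).mono (sub_nonneg.2 (Nat.floor_le hη0)) ?_ h0 h1 (by linarith)
        |>.mono_const (by rw [hB]; linarith [show 0 ≤ (d : ℝ) * K by positivity])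
      linarith [Nat.lt_floor_add_one η]
    · have h2 := hE q
      rw [hmη] at h2
      refine (h2.abs_sub_le _ _).trans ?_
      rw [add_sub_add_left_eq_sub, ← sub_smul, norm_smul, PiLp.norm_single, norm_one,
        mul_one, Real.norm_eq_abs]
      refine mul_le_mul_of_nonneg_right ?_ (abs_nonneg _)
      rw [hB]
      linarith [show 0 ≤ (2 : ℝ) ^ (⌊η⌋₊ + 1) * K by positivity]
  refine (hco (fun u => g (f u)) (max 1 Γ) (fun u i => congrArg g (hf.1 u i))
    (hg.continuous.comp hcf) (fun u => (hg.abs_le _).trans hmax) hsl j l hl z).trans ?_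
  refine mul_le_mul_of_nonneg_right ?_ (by positivity)
  nlinarith

/-- First-order expansion of g about f. The remainder is controlled pointwise by the oscillation of
∇g; the linear term is controlled only after integration, by pairing the tail of f with the smooth
function ∇g∘f. -/
theorem IsDaubechies.exists_integral_comp_sub_le (hφ : IsDaubechies M φ) (hc : Continuous φ)
    (d p : ℕ) {η K a : ℝ} (hη : 0 < η) (hK : 0 ≤ K) (ha : 0 ≤ a) {k : ℕ} {α : ℝ} (h0 : 0 ≤ α)
    (h1 : α < 1) (hk : k + α ≤ η) (hcase : 1 ≤ η ∨ (k : ℝ) + α = 0)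
    (hm : ∀ m ≤ k, ∫ x, x ^ m * waveletOf (2 * M - 1) φ φ x = 0) :
    ∃ A, 0 ≤ A ∧ ∀ f ∈ holderBallTorus d p η K,
      (∀ i, CoeffDecay (2 * M - 1) φ (fun u => f u i) η a) →
      ∀ g : E p → ℝ, HolE (k + 1) α 1 g → ∀ J,
      |∫ u, (g (partialSumVec (2 * M - 1) φ f J u) - g (f u)) ∂(uniformCube d)| ≤
        A * ((2 : ℝ) ^ (-(J : ℝ))) ^ (η + (k + α)) := by
  obtain ⟨T, hT, hTe⟩ := hφ.exists_norm_sub_partialSumVec_le hc d p hη hK ha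
  have hint : ∀ {F : E d → ℝ} {b : ℝ}, (∀ u, |F u| ≤ b) →
      |∫ u, F u ∂(uniformCube d)| ≤ b := by
    intro F b hF
    have := norm_integral_le_of_norm_le_const (μ := uniformCube d)
      (f := F) (C := b)
      (Filter.Eventually.of_forall fun u => (Real.norm_eq_abs (F u)).trans_le (hF u))
    simpa using this
  -- When k + α = 0 there is no extra power to gain: the Lipschitz bound on g suffices, also for η <
  -- 1.
  by_cases hκ : (k : ℝ) + α = 0
  · refine ⟨p * 1 * T, by positivity, fun f hf hdec g hg J => ?_⟩
    refine hint fun u => (hg.abs_sub_le _ _).trans ?_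
    rw [hκ, add_zero, mul_assoc (p * 1 : ℝ) T]
    exact mul_le_mul_of_nonneg_left (hTe f hf hdec J u) (by positivity)
  have hη1 := hcase.resolve_right hκ
  obtain ⟨b, hb, hdecG⟩ := hφ.exists_coeffDecay_comp hc d p hη1 hK h0 h1 hk hm
  obtain ⟨A, hA, hmul⟩ := hφ.exists_abs_integral_mul_le hc d hη (κ := k + α) (by positivity)
  have hb0 : 0 ≤ b := zero_le_one.trans hb
  refine ⟨p * (1 * (p + 1) * (T + 1)) * T + p * (A * a * b), by positivity,
    fun f hf hdec g hg J => ?_⟩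
  have hcf := continuous_of_mem_holderBallTorus hη.le hK hf
  have hcP := hφ.continuous_partialSumVec hc f J
  have hh : (0 : ℝ) < 2 ^ (-(J : ℝ)) := by positivity
  have hh1 : (2 : ℝ) ^ (-(J : ℝ)) ≤ 1 :=
    Real.rpow_le_one_of_one_le_of_nonpos one_le_two (neg_nonpos.2 (Nat.cast_nonneg J))
  set P := partialSumVec (2 * M - 1) φ f J with hP
  have hcg := hg.continuous
  have hcD := fun i => (hg.2.2 i).continuous
  have hI1 : Integrable (fun u => g (P u) - g (f u) - ∑ i, partialD i g (f u) * (P u - f u) i)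
      (uniformCube d) := integrable_uniformCube (by fun_prop)
  have hI2 : ∀ i, Integrable (fun u => partialD i g (f u) * (P u - f u) i) (uniformCube d) :=
    fun i => integrable_uniformCube (by fun_prop)
  have e1 : ∫ u, (g (P u) - g (f u)) ∂(uniformCube d) =
      ∫ u, (g (P u) - g (f u) - ∑ i, partialD i g (f u) * (P u - f u) i) ∂(uniformCube d) +
        ∑ i, ∫ u, partialD i g (f u) * (P u - f u) i ∂(uniformCube d) := by
    rw [← integral_finsetSum _ fun i _ => hI2 i, ← integral_add hI1
      (integrable_finsetSum _ fun i _ => hI2 i)]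
    simp only [sub_add_cancel]
  rw [e1, add_mul]
  refine (abs_add_le _ _).trans (add_le_add (hint fun u => ?_) ?_)
  · exact hg.abs_taylor_le h0 h1.le hη1 hk hh hh1 hT (hTe f hf hdec J u)
  · refine (Finset.abs_sum_le_sum_abs _ _).trans ?_
    have h2 : ∀ i ∈ Finset.univ, |∫ u, partialD i g (f u) * (P u - f u) i ∂(uniformCube d)| ≤
        A * a * b * ((2 : ℝ) ^ (-(J : ℝ))) ^ (η + (k + α)) := by
      intro i _
      have e2 : ∫ u, partialD i g (f u) * (P u - f u) i ∂(uniformCube d) =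
          -∫ u, partialD i g (f u) * (f u i - partialSum (2 * M - 1) φ (fun v => f v i) J u)
            ∂(uniformCube d) := by
        rw [← integral_neg]
        refine integral_congr_ae (Filter.Eventually.of_forall fun u => ?_)
        simp only [hP, partialSumVec, PiLp.sub_apply]
        ring
      rw [e2, abs_neg, ← Real.rpow_mul two_pos.le]
      exact hmul (fun u => f u i) (fun u => partialD i g (f u)) a b (hf.1.component i)
        (by fun_prop) (by fun_prop) ha hb0 (fun u => ((hg.2.2 i).abs_le _).trans hb) (hdec i)
        (hdecG f hf _ (hg.2.2 i)) J
    refine (Finset.sum_le_card_nsmul _ _ _ h2).trans (le_of_eq ?_)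
    rw [Finset.card_univ, Fintype.card_fin, nsmul_eq_mul]
    ring

end

/-! ### Generators built from the approximate wavelets, and the resulting bound in the integral
probability metric -/

section

variable {M d p : ℕ} {φ : ℝ → ℝ}

theorem continuous_hatPerWavelet (N : ℕ) (φ : ℝ → ℝ) {φhat : ℝ → ℝ} (hc : Continuous φhat)
    (j l : ℕ) (z : Fin d → ℕ) : Continuous (hatPerWavelet N φ φhat j l z) := by
  have h1 : Continuous (hatScalingPer N φhat j) := by unfold hatScalingPer; fun_prop
  have h2 : Continuous (hatWaveletPer N φ φhat j) := by
    unfold hatWaveletPer waveletOf; fun_prop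
  have h3 : ∀ b : Bool, Continuous
      (if b then hatWaveletPer N φ φhat j else hatScalingPer N φhat j) := by
    rintro (_ | _) <;> assumption
  unfold hatPerWavelet tensorWavelet
  by_cases hl : l = 2 ^ d
  · simp only [hl, if_true]; exact continuous_const
  · simp only [hl, if_false]
    exact continuous_finsetProd _ fun i _ => (h3 (l.testBit i)).comp (by fun_prop)

/-- The map whose components are the sums of the levels `j < J` of the approximate wavelets with
the wavelet coefficients of `f`. -/
def hatSum (N : ℕ) (φ φhat : ℝ → ℝ) (f : E d → E p) (J : ℕ) (u : E d) : E p :=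
  WithLp.toLp 2 fun i => ∑ j ∈ Finset.range J, ∑ l ∈ Finset.Icc 1 (2 ^ d), ∑ z ∈ positions d j,
    coeff N φ (fun v => f v i) j l z * hatPerWavelet N φ φhat j l z u

theorem continuous_hatSum (N : ℕ) (φ : ℝ → ℝ) {φhat : ℝ → ℝ} (hc : Continuous φhat)
    (f : E d → E p) (J : ℕ) : Continuous (hatSum N φ φhat f J) := by
  have := fun j l z => continuous_hatPerWavelet (d := d) N φ hc j l z
  refine (PiLp.continuous_toLp 2 _).comp (continuous_pi fun i => ?_)
  fun_prop

/-- Coefficient decay cancels the 2^{jd/2} of the sum over positions, leaving 2^jD·2^{-jη} on level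
j. Bounding every level by the same Q gives the factor J, the source of the logarithm. -/
theorem IsDaubechies.exists_norm_hatSum_sub_le (hφ : IsDaubechies M φ) (hc : Continuous φ)
    (d p : ℕ) {C₀ : ℝ} (hC₀ : 0 < C₀) : ∃ A, 0 ≤ A ∧ ∀ (φhat : ℝ → ℝ) (D : ℝ),
      (∀ x, |φ x - φhat x| ≤ D) → ∀ (f : E d → E p) (η a : ℝ), 0 ≤ a →
      (∀ i, CoeffDecay (2 * M - 1) φ (fun u => f u i) η a) → ∀ (J : ℕ) (Q : ℝ),
      (∀ j < J, 2 ^ j * D ≤ C₀) → (∀ j < J, 2 ^ j * D * (2 : ℝ) ^ (-(j : ℝ) * η) ≤ Q) →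
      ∀ u ∈ unitCube d, ‖hatSum (2 * M - 1) φ φhat f J u -
        partialSumVec (2 * M - 1) φ f J u‖ ≤ A * a * (J * Q) := by
  obtain ⟨A, hA, h1⟩ := hφ.exists_sum_hat_sub_le hc d hC₀
  refine ⟨p * (2 ^ d * A), by positivity, fun φhat D hD f η a ha hdec J Q hJD hQ u hu => ?_⟩
  refine (norm_le_sum_abs _).trans ?_
  have key : ∀ i ∈ Finset.univ, |(hatSum (2 * M - 1) φ φhat f J u -
      partialSumVec (2 * M - 1) φ f J u) i| ≤ J * (2 ^ d * (a * A * Q)) := by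
    intro i _
    simp only [hatSum, partialSumVec, partialSum, PiLp.sub_apply, ← Finset.sum_sub_distrib,
      ← mul_sub]
    refine (Finset.abs_sum_le_sum_abs _ _).trans ?_
    have hj : ∀ j ∈ Finset.range J, |∑ l ∈ Finset.Icc 1 (2 ^ d), ∑ z ∈ positions d j,
        coeff (2 * M - 1) φ (fun v => f v i) j l z * (hatPerWavelet (2 * M - 1) φ φhat j l z u -
          perWavelet (2 * M - 1) φ j l z u)| ≤ 2 ^ d * (a * A * Q) := by
      intro j hj
      refine (Finset.abs_sum_le_sum_abs _ _).trans ?_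
      have hjJ := Finset.mem_range.1 hj
      have hl : ∀ l ∈ Finset.Icc 1 (2 ^ d), |∑ z ∈ positions d j,
          coeff (2 * M - 1) φ (fun v => f v i) j l z * (hatPerWavelet (2 * M - 1) φ φhat j l z u -
            perWavelet (2 * M - 1) φ j l z u)| ≤ a * A * Q := by
        intro l hl
        have h2 := h1 φhat D hD j l (hJD j hjJ) hl u hu
        calc _ ≤ ∑ z ∈ positions d j, a * (2 : ℝ) ^ (-(j : ℝ) * (η + d / 2)) *
              |hatPerWavelet (2 * M - 1) φ φhat j l z u - perWavelet (2 * M - 1) φ j l z u| := by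
              refine (Finset.abs_sum_le_sum_abs _ _).trans (Finset.sum_le_sum fun z hz => ?_)
              rw [abs_mul]
              exact mul_le_mul_of_nonneg_right (hdec i j l hl z hz) (abs_nonneg _)
          _ ≤ a * (2 : ℝ) ^ (-(j : ℝ) * (η + d / 2)) *
              (A * (2 ^ j * D) * (2 : ℝ) ^ ((j : ℝ) * (d / 2))) := by
              rw [← Finset.mul_sum]
              exact mul_le_mul_of_nonneg_left h2 (by positivity)
          _ = a * A * (2 ^ j * D * (2 : ℝ) ^ (-(j : ℝ) * η)) := by
              have e : (2 : ℝ) ^ (-(j : ℝ) * η) =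
                  (2 : ℝ) ^ (-(j : ℝ) * (η + d / 2)) * (2 : ℝ) ^ ((j : ℝ) * (d / 2)) := by
                rw [← Real.rpow_add two_pos]
                congr 1; ring
              rw [e]; ring
          _ ≤ a * A * Q := mul_le_mul_of_nonneg_left (hQ j hjJ) (by positivity)
      refine (Finset.sum_le_card_nsmul _ _ _ hl).trans (le_of_eq ?_)
      rw [Nat.card_Icc, Nat.add_sub_cancel, nsmul_eq_mul]
      push_cast; ring
    refine (Finset.sum_le_card_nsmul _ _ _ hj).trans (le_of_eq ?_)
    rw [Finset.card_range, nsmul_eq_mul]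
  refine (Finset.sum_le_card_nsmul _ _ _ key).trans (le_of_eq ?_)
  rw [Finset.card_univ, Fintype.card_fin, nsmul_eq_mul]
  ring

theorem hatSum_mem_hatF {N : ℕ} {φhat : ℝ → ℝ} {c K η δ : ℝ} {f : E d → E p}
    (hdec : ∀ i, CoeffDecay N φ (fun u => f u i) η (c * K)) :
    (fun u => hatSum N φ φhat f (⌊Real.logb 2 δ⁻¹⌋₊ + 1) (fractE u)) ∈
      hatF d p N φ φhat c K η δ :=
  ⟨isPeriodic_comp_fractE _, fun j l z i => coeff N φ (fun v => f v i) j l z,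
    fun j _ l hl z hz i => hdec i j l hl z hz, fun u hu i => by simp only [fractE_eq hu]; rfl⟩

theorem floor_logb_add_one_le {δ r : ℝ} (h0 : 0 < δ) (hδ : δ ≤ r) (hr : r < 1) :
    ((⌊Real.logb 2 δ⁻¹⌋₊ + 1 : ℕ) : ℝ) ≤
      ((Real.log 2)⁻¹ + (Real.log r⁻¹)⁻¹) * Real.log δ⁻¹ := by
  have hr0 := h0.trans_le hδ
  have hρ : 0 < Real.log r⁻¹ := Real.log_pos ((one_lt_inv₀ hr0).2 hr)
  have h1 : Real.log r⁻¹ ≤ Real.log δ⁻¹ :=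
    Real.log_le_log (inv_pos.2 hr0) (inv_anti₀ h0 hδ)
  have h2 : 0 ≤ Real.logb 2 δ⁻¹ :=
    Real.logb_nonneg one_lt_two ((one_le_inv₀ h0).2 (hδ.trans hr.le))
  have h3 : 1 ≤ (Real.log r⁻¹)⁻¹ * Real.log δ⁻¹ := by
    rw [← div_eq_inv_mul, one_le_div hρ]; exact h1
  push_cast
  rw [add_mul]
  refine add_le_add ((Nat.floor_le h2).trans (le_of_eq ?_)) h3
  rw [Real.logb, div_eq_inv_mul]

/-- For η ≥ 1 the factor 2^{j(1-η)} is at most 1 and b + 1 + γ ≥ η + γ - 1. For η < 1 one spends 2^j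
≤ δ⁻¹ instead, and b + γ ≥ η + γ - 1 still holds. -/
theorem two_pow_mul_rpow_le {δ γ η b : ℝ} {j : ℕ} (h0 : 0 < δ) (h1 : δ ≤ 1)
    (hj : (2 : ℝ) ^ j ≤ δ⁻¹) (hη : 0 < η) (hb0 : 0 ≤ b) (hb : η ≤ b + 2) :
    2 ^ j * δ ^ (b + 1 + γ) * (2 : ℝ) ^ (-(j : ℝ) * η) ≤ δ ^ (η + γ - 1) := by
  have hpow : (2 : ℝ) ^ j = (2 : ℝ) ^ (j : ℝ) := (Real.rpow_natCast _ _).symm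
  by_cases hη1 : 1 ≤ η
  · have h2 : (2 : ℝ) ^ j * (2 : ℝ) ^ (-(j : ℝ) * η) ≤ 1 := by
      rw [hpow, ← Real.rpow_add two_pos]
      refine Real.rpow_le_one_of_one_le_of_nonpos one_le_two ?_
      nlinarith [(Nat.cast_nonneg j : (0 : ℝ) ≤ j)]
    calc _ = 2 ^ j * (2 : ℝ) ^ (-(j : ℝ) * η) * δ ^ (b + 1 + γ) := by ring
      _ ≤ 1 * δ ^ (b + 1 + γ) := mul_le_mul_of_nonneg_right h2 (by positivity)
      _ ≤ _ := by
        rw [one_mul]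
        exact Real.rpow_le_rpow_of_exponent_ge h0 h1 (by linarith)
  · have h2 : (2 : ℝ) ^ (-(j : ℝ) * η) ≤ 1 := by
      refine Real.rpow_le_one_of_one_le_of_nonpos one_le_two ?_
      nlinarith [(Nat.cast_nonneg j : (0 : ℝ) ≤ j)]
    calc _ ≤ 2 ^ j * δ ^ (b + 1 + γ) := mul_le_of_le_one_right (by positivity) h2
      _ ≤ δ⁻¹ * δ ^ (b + 1 + γ) := mul_le_mul_of_nonneg_right hj (by positivity)
      _ = δ ^ (b + γ) := by
        rw [← Real.rpow_neg_one, ← Real.rpow_add h0]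
        congr 1; ring
      _ ≤ _ := Real.rpow_le_rpow_of_exponent_ge h0 h1 (by linarith)

theorem two_pow_mul_inv_le {δ γ b C₀ L : ℝ} {j : ℕ} (h0 : 0 < δ) (h1 : δ ≤ 1) (hC₀ : 0 ≤ C₀)
    (hj : (2 : ℝ) ^ j ≤ δ⁻¹) (hb : 0 ≤ b + γ) (hL : L⁻¹ ≤ δ ^ (b + 1 + γ)) :
    2 ^ j * (C₀ * L⁻¹) ≤ C₀ := by
  calc _ ≤ 2 ^ j * (C₀ * δ ^ (b + 1 + γ)) := by gcongr
    _ ≤ δ⁻¹ * (C₀ * δ ^ (b + 1 + γ)) := mul_le_mul_of_nonneg_right hj (by positivity)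
    _ = C₀ * δ ^ (b + γ) := by
      rw [mul_left_comm, ← Real.rpow_neg_one, ← Real.rpow_add h0]
      congr 2; ring
    _ ≤ C₀ := mul_le_of_le_one_right hC₀ (Real.rpow_le_one h0.le h1 hb)

theorem two_pow_le_inv {δ : ℝ} (h0 : 0 < δ) (h1 : δ < 1) {j : ℕ}
    (hj : j < ⌊Real.logb 2 δ⁻¹⌋₊ + 1) : (2 : ℝ) ^ j ≤ δ⁻¹ :=
  (pow_le_pow_right₀ one_le_two (Nat.lt_succ_iff.1 hj)).trans (two_pow_floor_logb_le h0 h1)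

theorem inv_le_rpow_of_rpow_neg_le {δ s L : ℝ} (h0 : 0 < δ) (hL : δ ^ (-s) ≤ L) :
    L⁻¹ ≤ δ ^ s := by
  have h1 : 0 < δ ^ (-s) := by positivity
  have := inv_anti₀ h1 hL
  rwa [Real.rpow_neg h0.le, inv_inv] at this

/-- The exact partial sum P is inserted between generator and target. `hfirst` is the uniform
perturbation error, `hsecond` the truncation error measured weakly through the test function. -/
theorem IsDaubechies.exists_ipm_le (hφ : IsDaubechies M φ) (hc : Continuous φ)
    {c K η γ b C₀ r : ℝ} (hcst : IsBesovHolderConst d (2 * M - 1) φ η c) (hη : 0 < η)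
    (hK : 0 ≤ K) (hγ : 1 ≤ γ) (hγη : γ ≤ η + 1) (hcase : 1 ≤ η ∨ γ = 1)
    (hm : ∀ m ≤ ⌊γ⌋₊ - 1, ∫ x, x ^ m * waveletOf (2 * M - 1) φ φ x = 0)
    (hb0 : 0 ≤ b) (hb : η ≤ b + 2) (hC₀ : 0 < C₀) (hr : r < 1) (p : ℕ) :
    ∃ C, 0 < C ∧ ∀ δ L : ℝ, 0 < δ → δ ≤ r → δ ^ (-(b + 1 + γ)) ≤ L → ∀ φhat : ℝ → ℝ,
      Continuous φhat → (∀ x, |φ x - φhat x| ≤ C₀ * L⁻¹) →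
      (⨆ fstar ∈ holderBallTorus d p η K, ⨅ f ∈ hatF d p (2 * M - 1) φ φhat c K η δ,
        ipm γ (Measure.map f (uniformCube d)) (Measure.map fstar (uniformCube d))) ≤
        ENNReal.ofReal (C * Real.log δ⁻¹ * δ ^ (η + γ - 1)) := by
  have ha : 0 ≤ c * K := mul_nonneg hcst.1.le hK
  obtain ⟨k, hk⟩ : ∃ k, ⌊γ⌋₊ = k + 1 := Nat.exists_eq_add_one.2 (Nat.floor_pos.2 hγ)
  have hγ0 : 0 ≤ γ := zero_le_one.trans hγ
  have hα0 : 0 ≤ γ - ⌊γ⌋₊ := sub_nonneg.2 (Nat.floor_le hγ0)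
  have hα1 : γ - ⌊γ⌋₊ < 1 := by linarith [Nat.lt_floor_add_one γ]
  have hkα : (k : ℝ) + (γ - ⌊γ⌋₊) = γ - 1 := by rw [hk]; push_cast; ring
  obtain ⟨A₁, hA₁, h1⟩ := hφ.exists_norm_hatSum_sub_le hc d p hC₀
  obtain ⟨A₂, hA₂, h2⟩ := hφ.exists_integral_comp_sub_le hc d p hη hK ha (k := k) hα0 hα1
    (by linarith) (hcase.imp_right fun h => by linarith) (by rwa [hk, Nat.add_sub_cancel] at hm)
  rw [hkα] at h2
  set c₁ := (Real.log 2)⁻¹ + (Real.log r⁻¹)⁻¹ with hc₁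
  by_cases hr0 : 0 < r
  swap
  · exact ⟨1, one_pos, fun δ L h0 hδ => absurd (h0.trans_le hδ) hr0⟩
  have hlog2 : 0 < Real.log 2 := Real.log_pos one_lt_two
  have hρ : 0 < Real.log r⁻¹ := Real.log_pos ((one_lt_inv₀ hr0).2 hr)
  have hc₁0 : 0 < c₁ := by positivity
  refine ⟨p * (A₁ * (c * K)) * (c₁ * C₀) + A₂ * (Real.log r⁻¹)⁻¹ + 1, by positivity,
    fun δ L h0 hδ hL φhat hchat hclose => ?_⟩
  have hδ1 : δ < 1 := hδ.trans_lt hr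
  have hLi := inv_le_rpow_of_rpow_neg_le h0 hL
  have hlog : 0 < Real.log δ⁻¹ := Real.log_pos ((one_lt_inv₀ h0).2 hδ1)
  have hJle := floor_logb_add_one_le h0 hδ hr
  have hjδ := fun j => two_pow_le_inv (j := j) h0 hδ1
  have hinv := inv_lt_two_pow_floor_logb h0
  set J := ⌊Real.logb 2 δ⁻¹⌋₊ + 1 with hJ
  set w := δ ^ (η + γ - 1) with hw
  have hw0 : 0 < w := by positivity
  refine iSup₂_le fun f hf => ?_
  have hdec : ∀ i, CoeffDecay (2 * M - 1) φ (fun u => f u i) η (c * K) := fun i =>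
    hcst.coeffDecay hK (hf.1.component i) (hf.2 i)
  refine (iInf₂_le _ (hatSum_mem_hatF hdec)).trans (iSup₂_le fun g hg => ?_)
  refine ENNReal.ofReal_le_ofReal ?_
  have hgE := HolE.of_holderNorm hγ0 zero_le_one hg.1 hg.2
  rw [hk] at hgE
  have hgE' : HolE (k + 1) (γ - ⌊γ⌋₊) 1 g := by rw [hk]; exact hgE
  have hcf := continuous_of_mem_holderBallTorus hη.le hK hf
  have hcg := hgE'.continuous
  have hmeas : Measurable fun u => hatSum (2 * M - 1) φ φhat f J (fractE u) :=
    (continuous_hatSum _ φ hchat f J).measurable.comp measurable_fractE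
  rw [integral_map hmeas.aemeasurable hcg.aestronglyMeasurable,
    integral_map hcf.aemeasurable hcg.aestronglyMeasurable]
  set P := partialSumVec (2 * M - 1) φ f J with hP
  have hcP : Continuous P := hφ.continuous_partialSumVec hc f J
  have hI1 : Integrable (fun u => g (hatSum (2 * M - 1) φ φhat f J (fractE u)))
      (uniformCube d) :=
    Integrable.of_bound (hcg.measurable.comp hmeas).aestronglyMeasurable 1
      (Filter.Eventually.of_forall fun u => (Real.norm_eq_abs _).trans_le (hgE'.abs_le _))
  have hI2 : Integrable (fun u => g (P u)) (uniformCube d) :=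
    integrable_uniformCube (hcg.comp hcP)
  have hI3 : Integrable (fun u => g (f u)) (uniformCube d) :=
    integrable_uniformCube (hcg.comp hcf)
  have hfirst : ∫ u, (g (hatSum (2 * M - 1) φ φhat f J (fractE u)) - g (P u)) ∂(uniformCube d) ≤
      p * (A₁ * (c * K)) * (c₁ * C₀) * Real.log δ⁻¹ * w := by
    have hb1 : ∀ᵐ u ∂(uniformCube d),
        ‖g (hatSum (2 * M - 1) φ φhat f J (fractE u)) - g (P u)‖ ≤
          p * (A₁ * (c * K)) * (c₁ * C₀) * Real.log δ⁻¹ * w := by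
      filter_upwards [ae_mem_unitCube d] with u hu
      rw [fractE_eq hu, Real.norm_eq_abs]
      have h3 := h1 φhat (C₀ * L⁻¹) hclose f η (c * K) ha hdec J (C₀ * w)
        (fun j hj => two_pow_mul_inv_le h0 hδ1.le hC₀.le (hjδ j hj) (by linarith) hLi)
        (fun j hj => ?_) u hu
      · calc _ ≤ p * 1 * ‖hatSum (2 * M - 1) φ φhat f J u - P u‖ := hgE'.abs_sub_le _ _
          _ ≤ p * 1 * (A₁ * (c * K) * ((c₁ * Real.log δ⁻¹) * (C₀ * w))) := by
            refine mul_le_mul_of_nonneg_left (h3.trans ?_) (by positivity)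
            refine mul_le_mul_of_nonneg_left ?_ (by positivity)
            exact mul_le_mul_of_nonneg_right hJle (by positivity)
          _ = _ := by ring
      · calc _ = C₀ * (2 ^ j * L⁻¹ * (2 : ℝ) ^ (-(j : ℝ) * η)) := by ring
          _ ≤ C₀ * (2 ^ j * δ ^ (b + 1 + γ) * (2 : ℝ) ^ (-(j : ℝ) * η)) := by gcongr
          _ ≤ C₀ * w := mul_le_mul_of_nonneg_left
            (two_pow_mul_rpow_le h0 hδ1.le (hjδ j hj) hη hb0 hb) hC₀.le
    have := norm_integral_le_of_norm_le_const hb1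
    rw [probReal_univ, mul_one] at this
    exact (Real.le_norm_self _).trans this
  have hsecond : ∫ u, (g (P u) - g (f u)) ∂(uniformCube d) ≤
      A₂ * (Real.log r⁻¹)⁻¹ * Real.log δ⁻¹ * w := by
    refine (le_abs_self _).trans ((h2 f hf hdec g hgE' J).trans ?_)
    -- With J = ⌊log₂ δ⁻¹⌋ + 1 levels, 2^{-J} < δ.
    have h4 : ((2 : ℝ) ^ (-(J : ℝ))) ^ (η + (γ - 1)) ≤ w := by
      rw [hw, add_sub_assoc]
      refine Real.rpow_le_rpow (by positivity) ?_ (by linarith)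
      rw [Real.rpow_neg two_pos.le, Real.rpow_natCast]
      exact (inv_lt_of_inv_lt₀ h0 hinv).le
    -- Since δ ≤ r < 1, log δ⁻¹ is bounded below, so the truncation error may be given the
    -- logarithmic factor as well.
    have h5 : 1 ≤ (Real.log r⁻¹)⁻¹ * Real.log δ⁻¹ := by
      rw [← div_eq_inv_mul, one_le_div hρ]
      exact Real.log_le_log (inv_pos.2 hr0) (inv_anti₀ h0 hδ)
    calc _ ≤ A₂ * w := mul_le_mul_of_nonneg_left h4 hA₂
      _ ≤ A₂ * w * ((Real.log r⁻¹)⁻¹ * Real.log δ⁻¹) :=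
        le_mul_of_one_le_right (by positivity) h5
      _ = _ := by ring
  have hsum : ∫ u, g (hatSum (2 * M - 1) φ φhat f J (fractE u)) ∂(uniformCube d) -
      ∫ u, g (f u) ∂(uniformCube d) =
      ∫ u, (g (hatSum (2 * M - 1) φ φhat f J (fractE u)) - g (P u)) ∂(uniformCube d) +
        ∫ u, (g (P u) - g (f u)) ∂(uniformCube d) := by
    rw [integral_sub hI1 hI2, integral_sub hI2 hI3]
    ring
  rw [hsum]
  have h6 : 0 < Real.log δ⁻¹ * w := by positivity
  linarith

theorem abs_le_of_mem_holderBallLine {s R : ℝ} (hR : 0 ≤ R) {f : ℝ → ℝ}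
    (hf : f ∈ holderBallLine s R) (x : ℝ) : |f x| ≤ R := by
  have h1 : ‖f x‖ₑ ≤ ENNReal.ofReal R := by
    refine le_trans ?_ (le_self_add.trans hf.2)
    refine le_trans ?_ (Finset.single_le_sum (f := fun n => ⨆ x, ‖iteratedDeriv n f x‖ₑ)
      (fun _ _ => zero_le) (Finset.mem_range.2 (Nat.succ_pos _)))
    simp only [iteratedDeriv_zero]
    exact le_iSup (fun x => ‖f x‖ₑ) x
  rwa [Real.enorm_eq_ofReal_abs, ENNReal.ofReal_le_ofReal_iff hR] at h1

end

end HatPer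

end

/-! ### Proof of the proposition -/

open HatPer
theorem mainTheorem10
    (p d : ℕ) (hp : 2 ≤ p) (hd : 1 ≤ d) (hdp : d ≤ p)
    (β γ K η : ℝ) (hβ : 1 ≤ β) (hγ : γ ∈ Set.Icc 1 (β + 1)) (hK : 1 < K)
    (hη : η ∈ Set.Ioc 0 (β + 1))
    (M : ℕ) (φ : ℝ → ℝ) (hφ : IsDaubechies M φ)
    (hφreg : φ ∈ holderSpaceLine ((⌊β⌋₊ : ℝ) + 3)) :
    (∃ Cη : ℝ, IsBesovHolderConst d (2 * M - 1) φ η Cη) ∧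
    ∀ Cη : ℝ, IsBesovHolderConst d (2 * M - 1) φ η Cη →
    ∀ C₀ : ℝ, 0 < C₀ → ∀ r ∈ Set.Ioo (0 : ℝ) 1,
    ∃ C C₂ : ℝ, 0 < C ∧ 0 < C₂ ∧
      ∀ δ ∈ Set.Ioc 0 r, ∀ L : ℝ, δ ^ (-((⌊β⌋₊ : ℝ) + 1 + γ)) ≤ L →
      ∀ φhat : ℝ → ℝ,
        (fun x => φ x - φhat x) ∈ holderBallLine ((⌊β⌋₊ : ℝ) + 2) (C₀ * L⁻¹) →
        ((1 ≤ η ∨ γ = 1) → γ ≤ η + 1 →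
          (⨆ fstar ∈ holderBallTorus d p η K,
            ⨅ f ∈ hatF d p (2 * M - 1) φ φhat Cη K η δ,
              ipm γ (Measure.map f (uniformCube d)) (Measure.map fstar (uniformCube d)))
            ≤ ENNReal.ofReal (C * Real.log δ⁻¹ ^ C₂ * δ ^ (η + γ - 1))) ∧
        (δ ≤ 1 / 2 → ∀ ε : ℝ, δ ^ (η - 1) * L⁻¹ < ε → ε ≤ r →
          coveringNumber (hatF d p (2 * M - 1) φ φhat Cη K η δ) ε ≠ ⊤ ∧
          Real.log ((coveringNumber (hatF d p (2 * M - 1) φ φhat Cη K η δ) ε).toNat : ℝ)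
            ≤ C * δ ^ (-(d : ℝ)) * Real.log (⌊δ⁻¹⌋₊ : ℝ) * Real.log ε⁻¹) := by
  have hfl : ⌊(⌊β⌋₊ : ℝ) + 3⌋₊ = ⌊β⌋₊ + 3 := by exact_mod_cast Nat.floor_natCast (⌊β⌋₊ + 3)
  have hreg3 : ContDiff ℝ ((⌊β⌋₊ + 3 : ℕ) : WithTop ℕ∞) φ := hfl ▸ hφreg.1
  have hreg : ∀ n : ℕ, n ≤ ⌊β⌋₊ + 3 → ContDiff ℝ n φ := fun n hn =>
    hreg3.of_le (by exact_mod_cast hn)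
  have hc : Continuous φ := hreg3.continuous
  have hβ0 : 0 ≤ β := zero_le_one.trans hβ
  have hfloor : ∀ {x : ℝ}, x ≤ β + 1 → ⌊x⌋₊ ≤ ⌊β⌋₊ + 1 := fun hx =>
    (Nat.floor_le_floor hx).trans (Nat.floor_add_one hβ0).le
  have hηfl := hfloor hη.2
  have hγfl := hfloor hγ.2
  have hK0 : 0 ≤ K := by linarith
  refine ⟨hφ.exists_besovHolderConst d hη.1 (by exact_mod_cast hreg (⌊η⌋₊ + 1) (by omega)),
    fun Cη hCη C₀ hC₀ r hr => ?_⟩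
  have hcK : 0 ≤ Cη * K := mul_nonneg hCη.1.le hK0
  -- The ⌊γ⌋ moments required come from φ being of class C^{⌊β⌋+3} together with γ ≤ β + 1.
  have hm : ∀ m ≤ ⌊γ⌋₊ - 1, ∫ x, x ^ m * waveletOf (2 * M - 1) φ φ x = 0 :=
    hφ.moment_eq_zero (by exact_mod_cast hreg (⌊γ⌋₊ - 1 + 1) (by omega))
  have hb : η ≤ (⌊β⌋₊ : ℝ) + 2 := by linarith [hη.2, Nat.lt_floor_add_one β]
  have hb0 : (0 : ℝ) ≤ ⌊β⌋₊ := Nat.cast_nonneg _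
  obtain ⟨A, hA, hAle⟩ := hφ.exists_sum_hat_le hc d hC₀
  obtain ⟨Ccov, hCcov, hcov⟩ := exists_log_coveringNumber_le hd (by omega : 0 < p) (2 * M - 1) φ
    hA hcK hη.1 hr.2
  obtain ⟨Cipm, hCipm, hipm⟩ : ∃ C, 0 < C ∧ ((1 ≤ η ∨ γ = 1) → γ ≤ η + 1 →
      ∀ δ L : ℝ, 0 < δ → δ ≤ r → δ ^ (-((⌊β⌋₊ : ℝ) + 1 + γ)) ≤ L → ∀ φhat : ℝ → ℝ,
      Continuous φhat → (∀ x, |φ x - φhat x| ≤ C₀ * L⁻¹) →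
      (⨆ fstar ∈ holderBallTorus d p η K, ⨅ f ∈ hatF d p (2 * M - 1) φ φhat Cη K η δ,
        ipm γ (Measure.map f (uniformCube d)) (Measure.map fstar (uniformCube d))) ≤
        ENNReal.ofReal (C * Real.log δ⁻¹ * δ ^ (η + γ - 1))) := by
    -- The constant is chosen before the assumptions of the first claim are available; if they fail,
    -- any positive value serves.
    by_cases hcase : (1 ≤ η ∨ γ = 1) ∧ γ ≤ η + 1
    · obtain ⟨C, hC, h⟩ := hφ.exists_ipm_le hc hCη hη.1 hK0 hγ.1 hcase.2 hcase.1 hm hb0 hb hC₀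
        hr.2 p
      exact ⟨C, hC, fun _ _ => h⟩
    · exact ⟨1, one_pos, fun h1 h2 => absurd ⟨h1, h2⟩ hcase⟩
  -- The logarithm occurs to the first power, so C₂ = 1; one constant serves both claims.
  refine ⟨Cipm + Ccov, 1, by positivity, one_pos, fun δ hδ L hL φhat hhat => ?_⟩
  have hδ1 : δ < 1 := hδ.2.trans_lt hr.2
  have hLi := inv_le_rpow_of_rpow_neg_le hδ.1 hL
  have hL0 : 0 < L := (Real.rpow_pos_of_pos hδ.1 _).trans_le hL
  have hclose : ∀ x, |φ x - φhat x| ≤ C₀ * L⁻¹ :=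
    abs_le_of_mem_holderBallLine (by positivity) hhat
  have hchat : Continuous φhat :=
    (hc.sub hhat.1.continuous).congr fun x => sub_sub_cancel (φ x) (φhat x)
  have hlogδ : 0 < Real.log δ⁻¹ := Real.log_pos ((one_lt_inv₀ hδ.1).2 hδ1)
  constructor
  · intro h1 h2
    refine (hipm h1 h2 δ L hδ.1 hδ.2 hL φhat hchat hclose).trans (ENNReal.ofReal_le_ofReal ?_)
    rw [Real.rpow_one]
    have : 0 < δ ^ (η + γ - 1) := Real.rpow_pos_of_pos hδ.1 _
    gcongr
    linarith
  · intro hδ2 ε hε hεr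
    have hε0 : 0 < ε := lt_trans (mul_pos (Real.rpow_pos_of_pos hδ.1 _) (inv_pos.2 hL0)) hε
    -- The size of L gives 2^j C₀L⁻¹ ≤ C₀ on every level used, so the sums of the approximate
    -- wavelets over positions obey the same bound as the exact ones, with A independent of δ, L and
    -- φ̂.
    have h := hcov δ φhat hδ.1 hδ2 (fun j hj l hl u hu => hAle φhat _ hclose j l
      (two_pow_mul_inv_le hδ.1 hδ1.le hC₀.le (two_pow_le_inv hδ.1 hδ1 (Finset.mem_range.1 hj))
        (by linarith [hγ.1]) hLi) hl u hu) ε hε0 hεr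
    refine ⟨h.1, h.2.trans ?_⟩
    have h3 : 0 ≤ Real.log (⌊δ⁻¹⌋₊ : ℝ) := Real.log_natCast_nonneg _
    have h4 : 0 ≤ Real.log ε⁻¹ :=
      Real.log_nonneg ((one_le_inv₀ hε0).2 (hεr.trans hr.2.le))
    have h5 : 0 < δ ^ (-(d : ℝ)) := Real.rpow_pos_of_pos hδ.1 _
    gcongr
    linarith
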